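/- Let $n\ge 1$ and work at the prime $2$. Let $$S(n,n)=\mathbb F_2[t_n,t_{n+1},t_{n+2},\dots]/(t_s^{2^n}-t_s),\qquad |t_s|=2(2^s-1)\in\mathbb Z/2(2^n-1),$$ be the quotient of the Morava stabilizer algebra $S(n)=\mathbb F_2\otimes_{K(n)_*}K(n)_*K(n)\otimes_{K(n)_*}\mathbb F_2=\mathbb F_2[t_1,t_2,\dots]/(t_s^{2^n}-t_s)$ by the ideal $(t_s\mid s<n)$. Its coproduct is the reduction modulo $2$ (with $v_n=1$, $v_i=0$ for $i\ne n$, $t_0=1$, $t_s=0$ for $0<s<n$) of the coproduct of $BP_*BP$, $\sum_{i+j=s}m_i\,\Delta(t_j)^{2^i}=\sum_{i+j+k=s}m_i\,t_j^{2^i}\otimes t_k^{2^{i+j}}$; so $m_{ni}=2^{-i}$ and the other $m_i$ are $0$. Let $C^{s,t}$ be the reduced cobar complex of $S(n,n)$ and $H^{s,t}S(n,n)=\mathrm{Ext}^{s,t}_{S(n,n)}(\mathbb F_2,\mathbb F_2)$ its cohomology, with the product induced by juxtaposition. Define the May filtration by $M(t_s^{2^j})=2s-1$ for $n\le s\le 2n-1$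 and $M(t_s^{2^j})=\max\{2s-1,\,2M(t_{s-n}^{2^{j+n-1}})+1\}$ for $s\ge 2n$, extended to monomials with exponents $<2^n$ through binary expansion of the exponents and additivity, and to $[m_1|\cdots|m_s]$ by $\sum_i M(m_i)$. The increasing filtration of $C^{*,*}$ by the spans of the words $[m_1|\cdots|m_s]$ of filtration $\le M$ gives the May spectral sequence $E_r^{s,t,M}$, $d_r:E_r^{s,t,M}\to E_r^{s+1,t,M-r}$. Put $h_{s,j}=[t_s^{2^j}]$ and $\rho_{2n}=\sum_{0\le j<n}h_{2n,j}$. **Theorem.** The May spectral sequence collapses at $E_2$: $d_r=0$ for all $r\ge2$, and $E_\infty^{s,t,M}\cong E_2^{s,t,M}$. The cochains $h_{s,j}$ ($n\le s<2n$, $0\le j<n$) and $\rho_{2n}$ are cocycles, and as bigraded $\mathbb F_2$-vector spaces $$H^{*,*}S(n,n)\cong E[h_{s,j}\mid n<s<2n,\ 0\le j<n]\otimes E[h_{n,j}\ (1\le j<n),\ \rho_{2n}]\otimes P[h_{n,0}].$$ More precisely, the products of these classes that correspond to the monomials of bidegree $(s,t)$ on the right-hand side form a basis of $H^{s,t}S(n,n)$,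 and for every $M$ those with May filtration $\le M$ form a basis of the subspace of classes represented by cocycles of May filtration $\le M$. In $H^{*,*}S(n,n)$ the classes $h_{s,j}$ ($n\le s<2n$) and $\rho_{2n}$ commute with each other, and $h_{n,j}^2=h_{n,0}^2$ for all $j$; the classes $h_{s,j}^2$ ($n<s<2n$) and $\rho_{2n}^2$ have May filtration at most $2M(h_{s,j})-1$ and $2M(\rho_{2n})-1$ respectively, so that they vanish in $E_\infty$ (where $M(h_{s,j})=M(t_s)$, $M(\rho_{2n})=M(t_{2n})$). -/

import Mathlib

namespace MoravaMay

section coproductPolynomials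

open MvPolynomial Finset

/-- The integral form of the right-hand side of the Brown--Peterson coproduct formula
`∑ mᵢ Δ(tⱼ)^(2^i) = ∑ mᵢ tⱼ^(2^i) ⊗ tₖ^(2^(i+j))` (`i + j = s`, resp. `i + j + k = s`) at the
prime `2`, after `vₙ ↦ 1` and `vᵢ ↦ 0` for `i ≠ n`. For Hazewinkel's generators this gives
`m_{n i} = 2^(-i)`, and all other `mᵢ` vanish; both sides are multiplied by `2^⌊s/n⌋`.
The variables `X (inl j)`, `X (inr k)` stand for `tⱼ ⊗ 1`, `1 ⊗ tₖ`, including `t₀`, which is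
set to `1` later. -/
noncomputable def coprodSum (n s : ℕ) : MvPolynomial (ℕ ⊕ ℕ) ℤ :=
  ∑ i ∈ range (s / n + 1), 2 ^ (s / n - i) *
    ∑ jk ∈ antidiagonal (s - n * i),
      X (Sum.inl jk.1) ^ 2 ^ (n * i) * X (Sum.inr jk.2) ^ 2 ^ (n * i + jk.1)

open Classical in
/-- The quotient `x / a` when `a` divides `x` (and `0` otherwise). -/
noncomputable def exactDiv {A : Type*} [CommRing A] (a x : A) : A :=
  if h : a ∣ x then h.choose else 0

theorem mul_exactDiv {A : Type*} [CommRing A] {a x : A} (h : a ∣ x) : a * exactDiv a x = x := by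
  rw [exactDiv, dif_pos h]
  exact h.choose_spec.symm

/-- The integral polynomial that expresses `Δ(tₛ)` in terms of the `tⱼ ⊗ 1` and `1 ⊗ tₖ`, defined by
recursion from the coproduct formula
`∑ᵢ 2^(⌊s/n⌋ - i) Δ(t_{s - n i})^(2^(n i)) = coprodSum n s`. The division by `2^⌊s/n⌋` is
exact, see `coprodPoly_ghost`. -/
noncomputable def coprodPoly (n s : ℕ) : MvPolynomial (ℕ ⊕ ℕ) ℤ :=
  exactDiv (2 ^ (s / n)) (coprodSum n s - ∑ i : Fin (s / n),
    2 ^ (s / n - (i + 1)) * coprodPoly n (s - n * (i + 1)) ^ 2 ^ (n * (i + 1)))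
termination_by s
decreasing_by
  have hi := i.2
  have hn : 0 < n := by
    rcases Nat.eq_zero_or_pos n with h | h
    · subst h; simp at hi
    · exact h
  have hs : 0 < s := by
    rcases Nat.eq_zero_or_pos s with h | h
    · subst h; simp at hi
    · exact h
  have : 0 < n * ((i : ℕ) + 1) := by positivity
  omega

theorem sub_div_of_le {n s i : ℕ} : (s - n * i) / n = s / n - i :=
  Nat.sub_mul_div s n i

theorem coprodSum_sub_expand (n s : ℕ) (hn : 0 < n) (hs : n ≤ s) :
    ∃ c, coprodSum n s - expand (2 ^ n) (coprodSum n (s - n)) = 2 ^ (s / n) * c := by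
  have hm : 1 ≤ s / n := (Nat.one_le_div_iff hn).2 hs
  have h1 : (s - n) / n + 1 = s / n := by
    have := sub_div_of_le (n := n) (s := s) (i := 1)
    simp only [mul_one] at this
    omega
  refine ⟨∑ jk ∈ antidiagonal s, X (Sum.inl jk.1) * X (Sum.inr jk.2) ^ 2 ^ jk.1, ?_⟩
  rw [coprodSum, Finset.sum_range_succ', coprodSum, h1]
  simp only [map_sum, map_mul, map_pow, expand_X, map_ofNat]
  rw [sub_eq_iff_eq_add, add_comm]
  congr 1
  · simp
  · refine Finset.sum_congr rfl fun i hi => ?_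
    rw [show s - n - n * i = s - n * (i + 1) by rw [Nat.sub_sub]; ring_nf,
      show (s - n) / n - i = s / n - (i + 1) by omega]
    congr 1
    refine Finset.sum_congr rfl fun jk _ => ?_
    rw [← pow_mul, ← pow_mul, ← pow_add, ← pow_add]
    ring_nf

theorem sum_dvd_aux {A : Type*} [CommRing A] (n m : ℕ) (hn : 0 < n) (x y : ℕ → A)
    (h : ∀ i, (2 : A) ∣ x i ^ 2 ^ n - y i) :
    (2 : A) ^ m ∣ ∑ i ∈ range m, 2 ^ (m - (i + 1)) * x i ^ 2 ^ (n * (i + 1))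
      - ∑ i ∈ range m, 2 ^ (m - (i + 1)) * y i ^ 2 ^ (n * i) := by
  rw [← Finset.sum_sub_distrib]
  refine Finset.dvd_sum fun i hi => ?_
  rw [← mul_sub, mul_add, mul_one, add_comm (n * i), pow_add 2 n, pow_mul (x i)]
  have := dvd_sub_pow_of_dvd_sub (p := 2) (by exact_mod_cast h i) (n * i)
  have h2 : (2 : A) ^ m ∣ 2 ^ (m - (i + 1)) * 2 ^ (n * i + 1) := by
    rw [← pow_add]
    apply pow_dvd_pow
    have : i ≤ n * i := Nat.le_mul_of_pos_left i hn
    omega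
  exact h2.trans (mul_dvd_mul_left _ (by exact_mod_cast this))

theorem two_dvd_expand (n : ℕ) (f : MvPolynomial (ℕ ⊕ ℕ) ℤ) :
    (2 : MvPolynomial (ℕ ⊕ ℕ) ℤ) ∣ f ^ 2 ^ n - expand (2 ^ n) f := by
  have key : ∀ g : MvPolynomial (ℕ ⊕ ℕ) (ZMod 2), expand (2 ^ n) g = g ^ 2 ^ n := by
    intro g
    induction n with
    | zero => simp
    | succ n ih => rw [pow_succ, expand_mul, expand_zmod, map_pow, ih, ← pow_mul]
  have := (C_dvd_iff_zmod 2 (f ^ 2 ^ n - expand (2 ^ n) f)).2 (by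
    rw [map_sub, map_pow, map_expand, key, sub_self])
  simpa using this

/-- The polynomials `coprodPoly n s` are integral and satisfy the coproduct formula. -/
theorem coprodPoly_ghost (n : ℕ) (hn : 0 < n) (s : ℕ) :
    ∑ i ∈ range (s / n + 1), 2 ^ (s / n - i) * coprodPoly n (s - n * i) ^ 2 ^ (n * i)
      = coprodSum n s := by
  induction s using Nat.strong_induction_on with
  | _ s ih =>
  have hdvd : (2 : MvPolynomial (ℕ ⊕ ℕ) ℤ) ^ (s / n) ∣ coprodSum n s - ∑ i ∈ range (s / n),
      2 ^ (s / n - (i + 1)) * coprodPoly n (s - n * (i + 1)) ^ 2 ^ (n * (i + 1)) := by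
    rcases lt_or_ge s n with hs | hs
    · simp [Nat.div_eq_of_lt hs]
    obtain ⟨c, hc⟩ := coprodSum_sub_expand n s hn hs
    have h1 : (s - n) / n + 1 = s / n := by
      have := sub_div_of_le (n := n) (s := s) (i := 1)
      have hm : 1 ≤ s / n := (Nat.one_le_div_iff hn).2 hs
      simp only [mul_one] at this
      omega
    have h2 := sum_dvd_aux n (s / n) hn (fun i => coprodPoly n (s - n * (i + 1)))
      (fun i => expand (2 ^ n) (coprodPoly n (s - n * (i + 1)))) (fun i => two_dvd_expand n _)
    have h3 : expand (2 ^ n) (coprodSum n (s - n)) = ∑ i ∈ range (s / n),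
        2 ^ (s / n - (i + 1)) * expand (2 ^ n) (coprodPoly n (s - n * (i + 1))) ^ 2 ^ (n * i) := by
      rw [← ih (s - n) (by omega), h1]
      simp only [map_sum, map_mul, map_pow, map_ofNat]
      refine Finset.sum_congr rfl fun i hi => ?_
      rw [show s - n - n * i = s - n * (i + 1) by rw [Nat.sub_sub]; ring_nf,
        show (s - n) / n - i = s / n - (i + 1) by omega]
    rw [← h3] at h2
    have h4 := dvd_sub (Dvd.intro _ hc.symm) h2
    convert h4 using 1
    ring
  rw [Finset.sum_range_succ']
  conv_lhs => enter [2]; rw [mul_zero, coprodPoly.eq_def]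
  simp only [Nat.sub_zero, pow_zero, pow_one]
  rw [Fin.sum_univ_eq_sum_range (fun i => 2 ^ (s / n - (i + 1)) *
    coprodPoly n (s - n * (i + 1)) ^ 2 ^ (n * (i + 1))) (s / n), mul_exactDiv hdvd]
  ring


end coproductPolynomials

section twisted

open Finset

variable {W : Type*} [CommRing W] (φ : W →+* W)

/-- Coefficients of the product of the twisted power series `∑ x_s S^s`, `∑ y_s S^s`, `S a = φ(a) S`. -/
def twistMul (x y : ℕ → W) (s : ℕ) : W :=
  ∑ jk ∈ antidiagonal s, x jk.1 * (φ ^ jk.1) (y jk.2)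

theorem twistMul_assoc (x y z : ℕ → W) :
    twistMul φ (twistMul φ x y) z = twistMul φ x (twistMul φ y z) := by
  funext s
  simp only [twistMul, Finset.sum_mul, map_sum, map_mul, Finset.mul_sum, Finset.sum_sigma']
  refine Finset.sum_nbij' (fun a => ⟨(a.2.1, a.2.2 + a.1.2), (a.2.2, a.1.2)⟩)
    (fun a => ⟨(a.1.1 + a.2.1, a.2.2), (a.1.1, a.2.1)⟩) ?_ ?_ ?_ ?_ ?_
  · rintro ⟨⟨i, j⟩, ⟨k, l⟩⟩ h
    simp only [mem_sigma, HasAntidiagonal.mem_antidiagonal] at h ⊢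
    grind
  · rintro ⟨⟨i, j⟩, ⟨k, l⟩⟩ h
    simp only [mem_sigma, HasAntidiagonal.mem_antidiagonal] at h ⊢
    grind
  · rintro ⟨⟨i, j⟩, ⟨k, l⟩⟩ h
    simp only [mem_sigma, HasAntidiagonal.mem_antidiagonal] at h ⊢
    obtain ⟨h1, h2⟩ := h
    subst h2
    rfl
  · rintro ⟨⟨i, j⟩, ⟨k, l⟩⟩ h
    simp only [mem_sigma, HasAntidiagonal.mem_antidiagonal] at h ⊢
    obtain ⟨h1, h2⟩ := h
    subst h2
    rfl
  · rintro ⟨⟨i, j⟩, ⟨k, l⟩⟩ h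
    simp only [mem_sigma, HasAntidiagonal.mem_antidiagonal] at h
    obtain ⟨h1, rfl⟩ := h
    rw [pow_add, RingHom.mul_def, RingHom.comp_apply, mul_assoc]

/-- Congruence of twisted power series modulo `S^n - 2`. -/
def TwistEquiv (n : ℕ) (x y : ℕ → W) : Prop :=
  ∃ u : ℕ → W, ∀ s, x s - y s = (if n ≤ s then u (s - n) else 0) - 2 * u s

theorem TwistEquiv.symm {n : ℕ} {x y : ℕ → W} (h : TwistEquiv n x y) : TwistEquiv n y x := by
  obtain ⟨u, hu⟩ := h
  refine ⟨fun s => - u s, fun s => ?_⟩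
  have := hu s
  split_ifs at this ⊢ <;> linear_combination -this

theorem TwistEquiv.trans {n : ℕ} {x y z : ℕ → W} (h : TwistEquiv n x y) (h' : TwistEquiv n y z) :
    TwistEquiv n x z := by
  obtain ⟨u, hu⟩ := h
  obtain ⟨v, hv⟩ := h'
  refine ⟨fun s => u s + v s, fun s => ?_⟩
  have h1 := hu s
  have h2 := hv s
  split_ifs at h1 h2 ⊢ <;> linear_combination h1 + h2

theorem sum_shift_right (n s : ℕ) (hs : n ≤ s) (f : ℕ → ℕ → W) :
    ∑ jk ∈ antidiagonal s, (if n ≤ jk.2 then f jk.1 (jk.2 - n) else 0)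
      = ∑ jk ∈ antidiagonal (s - n), f jk.1 jk.2 := by
  rw [← Finset.sum_filter]
  refine Finset.sum_nbij' (fun a => (a.1, a.2 - n)) (fun a => (a.1, a.2 + n)) ?_ ?_ ?_ ?_ ?_ <;>
  · rintro ⟨i, j⟩ h
    simp only [Finset.mem_filter, HasAntidiagonal.mem_antidiagonal, Prod.mk.injEq, true_and] at h ⊢
    try omega

theorem sum_shift_left (n s : ℕ) (hs : n ≤ s) (f : ℕ → ℕ → W) :
    ∑ jk ∈ antidiagonal s, (if n ≤ jk.1 then f (jk.1 - n) jk.2 else 0)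
      = ∑ jk ∈ antidiagonal (s - n), f jk.1 jk.2 := by
  rw [← Finset.sum_filter]
  refine Finset.sum_nbij' (fun a => (a.1 - n, a.2)) (fun a => (a.1 + n, a.2)) ?_ ?_ ?_ ?_ ?_ <;>
  · rintro ⟨i, j⟩ h
    simp only [Finset.mem_filter, HasAntidiagonal.mem_antidiagonal, Prod.mk.injEq, and_true] at h ⊢
    try omega

theorem TwistEquiv.mul_left {n : ℕ} {y y' : ℕ → W} (x : ℕ → W) (h : TwistEquiv n y y') :
    TwistEquiv n (twistMul φ x y) (twistMul φ x y') := by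
  obtain ⟨u, hu⟩ := h
  refine ⟨twistMul φ x u, fun s => ?_⟩
  have h1 : ∀ jk ∈ antidiagonal s, x jk.1 * (φ ^ jk.1) (y jk.2) - x jk.1 * (φ ^ jk.1) (y' jk.2)
      = (if n ≤ jk.2 then x jk.1 * (φ ^ jk.1) (u (jk.2 - n)) else 0)
        - 2 * (x jk.1 * (φ ^ jk.1) (u jk.2)) := by
    intro jk _
    rw [← mul_sub, ← map_sub, hu]
    split_ifs <;> simp only [map_sub, map_mul, map_ofNat, map_zero] <;> ring
  rw [twistMul, twistMul, ← Finset.sum_sub_distrib, Finset.sum_congr rfl h1,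
    Finset.sum_sub_distrib, ← Finset.mul_sum]
  congr 1
  split_ifs with hs
  · exact sum_shift_right n s hs fun j k => x j * (φ ^ j) (u k)
  · refine Finset.sum_eq_zero fun jk hjk => ?_
    rw [HasAntidiagonal.mem_antidiagonal] at hjk
    rw [if_neg (by omega)]

theorem TwistEquiv.mul_right {n : ℕ} (hφ : φ ^ n = 1) {x x' : ℕ → W} (y : ℕ → W)
    (h : TwistEquiv n x x') : TwistEquiv n (twistMul φ x y) (twistMul φ x' y) := by
  obtain ⟨u, hu⟩ := h
  refine ⟨twistMul φ u y, fun s => ?_⟩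
  have h1 : ∀ jk ∈ antidiagonal s, x jk.1 * (φ ^ jk.1) (y jk.2) - x' jk.1 * (φ ^ jk.1) (y jk.2)
      = (if n ≤ jk.1 then u (jk.1 - n) * (φ ^ (jk.1 - n)) (y jk.2) else 0)
        - 2 * (u jk.1 * (φ ^ jk.1) (y jk.2)) := by
    intro jk _
    rw [← sub_mul, hu]
    split_ifs with h
    · have : φ ^ jk.1 = φ ^ (jk.1 - n) := by
        conv_lhs => rw [← Nat.sub_add_cancel h, pow_add, hφ, mul_one]
      rw [this]; ring
    · ring
  rw [twistMul, twistMul, ← Finset.sum_sub_distrib, Finset.sum_congr rfl h1,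
    Finset.sum_sub_distrib, ← Finset.mul_sum]
  congr 1
  split_ifs with hs
  · exact sum_shift_left n s hs fun j k => u j * (φ ^ j) (y k)
  · refine Finset.sum_eq_zero fun jk hjk => ?_
    rw [HasAntidiagonal.mem_antidiagonal] at hjk
    rw [if_neg (by omega)]

theorem twistEquiv_of_dvd {n : ℕ} (hn : 0 < n) (h2 : ∀ w : W, 2 * w = 0 → w = 0) (x y : ℕ → W)
    (h : ∀ s, (2 : W) ^ (s / n + 1) ∣
      ∑ i ∈ range (s / n + 1), 2 ^ (s / n - i) * (x (s - n * i) - y (s - n * i))) :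
    TwistEquiv n x y := by
  have h2' : ∀ (m : ℕ) (w : W), 2 ^ m * w = 0 → w = 0 := by
    intro m
    induction m with
    | zero => intro w hw; simpa using hw
    | succ m ih => intro w hw; exact ih w (h2 _ (by rw [← hw]; ring))
  choose v hv using h
  refine ⟨fun s => - v s, fun s => ?_⟩
  have hs := hv s
  rw [Finset.sum_range_succ'] at hs
  simp only [Nat.sub_zero, mul_zero] at hs
  rcases lt_or_ge s n with hlt | hge
  · rw [if_neg (by omega)]
    rw [Nat.div_eq_of_lt hlt] at hs
    simp at hs
    linear_combination hs
  · rw [if_pos hge]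
    have h1 : (s - n) / n + 1 = s / n := by
      have := sub_div_of_le (n := n) (s := s) (i := 1)
      have hm : 1 ≤ s / n := (Nat.one_le_div_iff hn).2 hge
      simp only [mul_one] at this
      omega
    have hp := hv (s - n)
    rw [h1] at hp
    have h3 : ∑ i ∈ range (s / n), (2 : W) ^ ((s - n) / n - i) *
        (x (s - n - n * i) - y (s - n - n * i)) = ∑ i ∈ range (s / n),
        (2 : W) ^ (s / n - (i + 1)) * (x (s - n * (i + 1)) - y (s - n * (i + 1))) := by
      refine Finset.sum_congr rfl fun i hi => ?_
      rw [show s - n - n * i = s - n * (i + 1) by rw [Nat.sub_sub]; ring_nf,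
        show (s - n) / n - i = s / n - (i + 1) by omega]
    rw [h3] at hp
    rw [hp] at hs
    have := h2' (s / n) (x s - y s - (-v (s - n) - 2 * -v s)) (by
      linear_combination hs)
    linear_combination this

end twisted

section evaluation

open MvPolynomial

/-- The value of `coprodPoly n s` at `tⱼ ⊗ 1 ↦ x j`, `1 ⊗ tₖ ↦ y k` in a commutative ring. -/
noncomputable def coprodEval {A : Type*} [CommRing A] (n : ℕ) (x y : ℕ → A) (s : ℕ) : A :=
  eval₂ (Int.castRingHom A) (Sum.elim x y) (coprodPoly n s)

theorem map_coprodEval {A B : Type*} [CommRing A] [CommRing B] (f : A →+* B) (n : ℕ)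
    (x y : ℕ → A) (s : ℕ) :
    f (coprodEval n x y s) = coprodEval n (fun j => f (x j)) (fun j => f (y j)) s := by
  rw [coprodEval, hom_eval₂, RingHom.ext_int (f.comp (Int.castRingHom A)) (Int.castRingHom B),
    coprodEval]
  congr 1
  funext i
  rcases i with i | i <;> rfl

end evaluation

section coassoc

open Finset MvPolynomial

variable {R : Type*} [CommRing R] [CharP R 2]

theorem coprodPoly_coassoc (n : ℕ) (hn : 0 < n) (hR : ∀ r : R, r ^ 2 ^ n = r)
    (x y z : ℕ → R) (s : ℕ) :
    coprodEval n (coprodEval n x y) z s = coprodEval n x (coprodEval n y z) s := by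
  have : PerfectRing R 2 := by
    refine ⟨Function.bijective_iff_has_inverse.2 ⟨fun r => r ^ 2 ^ (n - 1), fun r => ?_,
      fun r => ?_⟩⟩
    · change (r ^ 2) ^ 2 ^ (n - 1) = r
      rw [← pow_mul, ← pow_succ', Nat.sub_add_cancel hn, hR]
    · change (r ^ 2 ^ (n - 1)) ^ 2 = r
      rw [← pow_mul, ← pow_succ, Nat.sub_add_cancel hn, hR]
  let φ : WittVector 2 R →+* WittVector 2 R := WittVector.frobenius
  have hφc : ∀ (j : ℕ) (w : WittVector 2 R) (m : ℕ), ((φ ^ j) w).coeff m = w.coeff m ^ 2 ^ j := by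
    intro j
    induction j with
    | zero => simp
    | succ j ih =>
      intro w m
      rw [pow_succ, RingHom.mul_def, RingHom.comp_apply, ih, WittVector.coeff_frobenius_charP,
        ← pow_mul, pow_succ']
  have hφ : φ ^ n = 1 := by
    ext w m
    rw [hφc, hR]
    rfl
  have hφt : ∀ (j : ℕ) (r : R), (φ ^ j) (WittVector.teichmuller 2 r)
      = WittVector.teichmuller 2 r ^ 2 ^ j := by
    intro j r
    ext m
    rw [hφc, ← map_pow]
    rcases Nat.eq_zero_or_pos m with rfl | hm
    · rw [WittVector.teichmuller_coeff_zero, WittVector.teichmuller_coeff_zero]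
    · rw [WittVector.teichmuller_coeff_pos _ _ _ hm, WittVector.teichmuller_coeff_pos _ _ _ hm,
        zero_pow (by positivity)]
  have hdvd : ∀ w : WittVector 2 R, w.coeff 0 = 0 → (2 : WittVector 2 R) ∣ w := by
    intro w hw
    have := (WittVector.mem_span_p_iff_coeff_zero_eq_zero (p := 2) w).2 hw
    exact_mod_cast Ideal.mem_span_singleton.1 this
  have htors : ∀ w : WittVector 2 R, 2 * w = 0 → w = 0 := by
    intro w hw
    exact WittVector.eq_zero_of_p_mul_eq_zero (p := 2) w (by rw [mul_comm]; exact_mod_cast hw)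
  let T : (ℕ → R) → ℕ → WittVector 2 R := fun x s => WittVector.teichmuller 2 (x s)
  have hTpow : ∀ (r : R) (i : ℕ), WittVector.teichmuller 2 r ^ 2 ^ (n * i)
      = WittVector.teichmuller 2 r := by
    intro r i
    induction i with
    | zero => simp
    | succ i ih => rw [mul_add, mul_one, pow_add, pow_mul, ih, ← map_pow, hR]
  have main : ∀ x y : ℕ → R,
      TwistEquiv n (T (coprodEval n x y)) (twistMul φ (T x) (T y)) := by
    intro x y
    refine twistEquiv_of_dvd hn htors _ _ fun s => ?_
    let ev : MvPolynomial (ℕ ⊕ ℕ) ℤ →+* WittVector 2 R :=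
      eval₂Hom (Int.castRingHom _) (Sum.elim (T x) (T y))
    have hev : ∀ k, (ev (coprodPoly n k)).coeff 0 = coprodEval n x y k := by
      intro k
      refine (map_coprodEval (WittVector.constantCoeff : WittVector 2 R →+* R) n
        (T x) (T y) k).trans ?_
      simp [T, WittVector.constantCoeff]
    have hg := congrArg ev (coprodPoly_ghost n hn s)
    have hsum : ev (coprodSum n s) = ∑ i ∈ range (s / n + 1), 2 ^ (s / n - i) *
        twistMul φ (T x) (T y) (s - n * i) := by
      simp only [coprodSum, map_sum, map_mul, map_pow, map_ofNat, twistMul]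
      refine Finset.sum_congr rfl fun i _ => ?_
      congr 1
      refine Finset.sum_congr rfl fun jk _ => ?_
      simp only [ev, eval₂Hom_X', Sum.elim_inl, Sum.elim_inr, T, hφt, hTpow, pow_add,
        pow_mul _ (2 ^ (n * i))]
    simp only [mul_sub]
    rw [Finset.sum_sub_distrib, ← hsum, ← hg]
    simp only [map_sum, map_mul, map_pow, map_ofNat]
    rw [← Finset.sum_sub_distrib]
    refine Finset.dvd_sum fun i hi => ?_
    rw [← mul_sub]
    have h1 : (2 : WittVector 2 R) ∣ T (coprodEval n x y) (s - n * i)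
        - ev (coprodPoly n (s - n * i)) := by
      apply hdvd
      have : ∀ a b : WittVector 2 R, (a - b).coeff 0 = a.coeff 0 - b.coeff 0 :=
        fun a b => map_sub (WittVector.constantCoeff : WittVector 2 R →+* R) a b
      rw [this, hev]
      simp [T]
    have h3 := dvd_sub_pow_of_dvd_sub (p := 2) (by exact_mod_cast h1) (n * i)
    simp only [T, hTpow] at h3
    have h4 : (2 : WittVector 2 R) ^ (s / n + 1) ∣ 2 ^ (s / n - i) * 2 ^ (n * i + 1) := by
      rw [← pow_add]
      apply pow_dvd_pow
      have : i ≤ n * i := Nat.le_mul_of_pos_left i hn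
      omega
    exact h4.trans (mul_dvd_mul_left _ (by exact_mod_cast h3))
  have inj : ∀ x y : ℕ → R, TwistEquiv n (T x) (T y) → x = y := by
    rintro x y ⟨u, hu⟩
    have hcoeff : ∀ s, T x s - T y s = - (2 * u s) → x s = y s ∧ u s = 0 := by
      intro s hs
      have h0 : x s = y s := by
        have h5 := congrArg (WittVector.constantCoeff : WittVector 2 R →+* R) hs
        rw [map_sub, map_neg, map_mul, map_ofNat, CharTwo.two_eq_zero (R := R), zero_mul,
          neg_zero, sub_eq_zero] at h5
        simpa [T, WittVector.constantCoeff] using h5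
      refine ⟨h0, htors _ ?_⟩
      simp only [T, h0, sub_self] at hs
      exact neg_eq_zero.1 hs.symm
    have key : ∀ s, x s = y s ∧ u s = 0 := by
      intro s
      induction s using Nat.strong_induction_on with
      | _ s ih =>
      apply hcoeff
      rw [hu]
      split_ifs with h
      · rw [(ih (s - n) (by omega)).2, zero_sub]
      · rw [zero_sub]
    funext s
    exact (key s).1
  have := inj _ _ (((main _ z).trans ((main x y).mul_right φ hφ (T z))).trans
    (by rw [twistMul_assoc]; exact (((main x _).trans ((main y z).mul_left φ (T x)))).symm))
  exact congrFun this s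

end coassoc


section algebra

open Finset MvPolynomial

open scoped TensorProduct

/-- The algebra `S(n,n) = F₂[tₙ, tₙ₊₁, …] / (tₛ^(2^n) - tₛ)` at the prime `2`, the quotient
of the Morava stabilizer algebra `S(n) = F₂[t₁, t₂, …] / (tₛ^(2^n) - tₛ)` by the ideal
`(tₛ | s < n)`. -/
def StabAlg (n : ℕ) : Type :=
  MvPolynomial {s : ℕ // n ≤ s} (ZMod 2) ⧸
    Ideal.span (Set.range fun s : {s : ℕ // n ≤ s} =>
      (X s ^ 2 ^ n - X s : MvPolynomial {s : ℕ // n ≤ s} (ZMod 2)))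

noncomputable instance commRingStabAlg (n : ℕ) : CommRing (StabAlg n) := inferInstanceAs (CommRing (_ ⧸ _))

noncomputable instance algebraStabAlg (n : ℕ) : Algebra (ZMod 2) (StabAlg n) :=
  inferInstanceAs (Algebra (ZMod 2) (_ ⧸ _))

/-- The projection from the polynomial algebra `F₂[tₙ, tₙ₊₁, …]`. -/
noncomputable def StabAlg.mk (n : ℕ) :
    MvPolynomial {s : ℕ // n ≤ s} (ZMod 2) →ₐ[ZMod 2] StabAlg n :=
  Ideal.Quotient.mkₐ (ZMod 2) _

/-- The element `tₛ` of `S(n,n)` for every `s`: `t₀ = 1`, and `tₛ = 0` for `0 < s < n`. -/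
noncomputable def tGen (n s : ℕ) : StabAlg n :=
  if s = 0 then 1 else if h : n ≤ s then StabAlg.mk n (X ⟨s, h⟩) else 0

variable (n : ℕ)

theorem mk_X_pow (s : {s : ℕ // n ≤ s}) :
    StabAlg.mk n (X s) ^ 2 ^ n = StabAlg.mk n (X s) := by
  rw [← map_pow, ← sub_eq_zero, ← map_sub]
  exact Ideal.Quotient.eq_zero_iff_mem.2 (Ideal.subset_span ⟨s, rfl⟩)

/-- The universal property of `S(n,n)` as an algebra. -/
noncomputable def StabAlg.lift {A : Type*} [CommRing A] [Algebra (ZMod 2) A]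
    (f : {s : ℕ // n ≤ s} → A) (hf : ∀ s, f s ^ 2 ^ n = f s) : StabAlg n →ₐ[ZMod 2] A :=
  Ideal.Quotient.liftₐ _ (aeval f) (fun a ha => by
    have : Ideal.span (Set.range fun s : {s : ℕ // n ≤ s} =>
        (X s ^ 2 ^ n - X s : MvPolynomial {s : ℕ // n ≤ s} (ZMod 2))) ≤ RingHom.ker (aeval f) := by
      rw [Ideal.span_le]
      rintro _ ⟨s, rfl⟩
      simp [RingHom.mem_ker, hf]
    exact this ha)

@[simp] theorem StabAlg.lift_mk_X {A : Type*} [CommRing A] [Algebra (ZMod 2) A]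
    (f : {s : ℕ // n ≤ s} → A) (hf : ∀ s, f s ^ 2 ^ n = f s) (s : {s : ℕ // n ≤ s}) :
    StabAlg.lift n f hf (StabAlg.mk n (X s)) = f s :=
  (Ideal.Quotient.lift_mk _ _ _).trans (by simp)

theorem StabAlg.algHom_ext {A : Type*} [CommRing A] [Algebra (ZMod 2) A]
    {f g : StabAlg n →ₐ[ZMod 2] A}
    (h : ∀ s, f (StabAlg.mk n (X s)) = g (StabAlg.mk n (X s))) : f = g := by
  have h1 : f.comp (StabAlg.mk n) = g.comp (StabAlg.mk n) := MvPolynomial.algHom_ext h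
  ext x
  obtain ⟨y, rfl⟩ := Ideal.Quotient.mk_surjective x
  exact DFunLike.congr_fun h1 y

/-- The augmentation of `S(n,n)`, which sends every `tₛ` with `s ≥ n` to `0`. -/
noncomputable def counit : StabAlg n →ₐ[ZMod 2] ZMod 2 :=
  StabAlg.lift n (fun _ => 0) fun _ => zero_pow (by positivity)

instance nontrivial_stabAlg : Nontrivial (StabAlg n) := (counit n).toRingHom.domain_nontrivial

theorem add_pow_two_pow {A : Type*} [CommRing A] [Algebra (ZMod 2) A] (x y : A) :
    (x + y) ^ 2 ^ n = x ^ 2 ^ n + y ^ 2 ^ n := by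
  cases subsingleton_or_nontrivial A
  · exact Subsingleton.elim _ _
  have : CharP A 2 := charP_of_injective_algebraMap (algebraMap (ZMod 2) A).injective 2
  exact add_pow_char_pow x y 2 n

theorem stab_pow (x : StabAlg n) : x ^ 2 ^ n = x := by
  obtain ⟨y, rfl⟩ : ∃ y, StabAlg.mk n y = x := Ideal.Quotient.mk_surjective x
  induction y using MvPolynomial.induction_on with
  | C a =>
    rw [← map_pow, ← C_pow]
    congr 2
    induction n with
    | zero => simp
    | succ n ih => rw [pow_succ, pow_mul, ih, ZMod.pow_card]
  | add p q hp hq => rw [map_add, add_pow_two_pow, hp, hq]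
  | mul_X p i hp => rw [map_mul, mul_pow, hp, mk_X_pow]

theorem tensor_pow {A B : Type*} [CommRing A] [Algebra (ZMod 2) A] [CommRing B]
    [Algebra (ZMod 2) B] (hA : ∀ x : A, x ^ 2 ^ n = x) (hB : ∀ x : B, x ^ 2 ^ n = x)
    (x : A ⊗[ZMod 2] B) : x ^ 2 ^ n = x := by
  induction x using TensorProduct.induction_on with
  | zero => exact zero_pow (by positivity)
  | tmul a b => rw [Algebra.TensorProduct.tmul_pow, hA, hB]
  | add x y hx hy => rw [add_pow_two_pow, hx, hy]

/-- The coproduct of `S(n,n)`, the reduction of the Brown--Peterson coproduct modulo `2` with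
`vₙ = 1`, `vᵢ = 0` for `i ≠ n`, and `tₛ = 0` for `0 < s < n`. -/
noncomputable def comul : StabAlg n →ₐ[ZMod 2] StabAlg n ⊗[ZMod 2] StabAlg n :=
  StabAlg.lift n (fun s => coprodEval n (fun j => tGen n j ⊗ₜ 1) (fun j => 1 ⊗ₜ tGen n j) s)
    fun _ => tensor_pow n (stab_pow n) (stab_pow n) _

theorem coprodPoly_of_lt {s : ℕ} (hs : s < n) :
    coprodPoly n s = ∑ jk ∈ antidiagonal s, X (Sum.inl jk.1) * X (Sum.inr jk.2) ^ 2 ^ jk.1 := by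
  have := coprodPoly_ghost n (by omega) s
  simpa [Nat.div_eq_of_lt hs, coprodSum] using this

variable [NeZero n]

theorem comul_tGen (s : ℕ) : comul n (tGen n s) =
    coprodEval n (fun j => tGen n j ⊗ₜ[ZMod 2] 1) (fun j => 1 ⊗ₜ[ZMod 2] tGen n j) s := by
  rcases lt_or_ge s n with hs | hs
  · rw [coprodEval, coprodPoly_of_lt n hs]
    rcases Nat.eq_zero_or_pos s with rfl | h0
    · simp [tGen, Algebra.TensorProduct.one_def]
    · have : tGen n s = 0 := by rw [tGen, if_neg (by omega), dif_neg (by omega)]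
      rw [this, map_zero, eval₂_sum]
      symm
      refine Finset.sum_eq_zero fun jk hjk => ?_
      rw [HasAntidiagonal.mem_antidiagonal] at hjk
      rcases Nat.eq_zero_or_pos jk.1 with h1 | h1
      · have : tGen n jk.2 = 0 := by rw [tGen, if_neg (by omega), dif_neg (by omega)]
        simp [this]
      · have : tGen n jk.1 = 0 := by rw [tGen, if_neg (by omega), dif_neg (by omega)]
        simp [this]
  · have := NeZero.ne n
    conv_lhs => rw [tGen, if_neg (by omega), dif_pos hs]
    exact StabAlg.lift_mk_X n _ _ _

theorem comul_coassoc :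
    ((Algebra.TensorProduct.assoc (ZMod 2) (ZMod 2) (ZMod 2) (StabAlg n) (StabAlg n)
      (StabAlg n)).toAlgHom.comp
      (Algebra.TensorProduct.map (comul n) (AlgHom.id (ZMod 2) (StabAlg n)))).comp (comul n) =
    (Algebra.TensorProduct.map (AlgHom.id (ZMod 2) (StabAlg n)) (comul n)).comp (comul n) := by
  have hn : 0 < n := Nat.pos_of_ne_zero (NeZero.ne n)
  have : CharP (StabAlg n ⊗[ZMod 2] (StabAlg n ⊗[ZMod 2] StabAlg n)) 2 := by
    have f : StabAlg n ⊗[ZMod 2] (StabAlg n ⊗[ZMod 2] StabAlg n) →ₐ[ZMod 2] ZMod 2 :=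
      Algebra.TensorProduct.lift (counit n) (Algebra.TensorProduct.lift (counit n) (counit n)
        fun _ _ => Commute.all _ _) fun _ _ => Commute.all _ _
    have := f.toRingHom.domain_nontrivial
    exact charP_of_injective_algebraMap (algebraMap (ZMod 2) _).injective 2
  let f1 : StabAlg n ⊗[ZMod 2] StabAlg n →ₐ[ZMod 2]
      StabAlg n ⊗[ZMod 2] (StabAlg n ⊗[ZMod 2] StabAlg n) :=
    (Algebra.TensorProduct.assoc (ZMod 2) (ZMod 2) (ZMod 2) (StabAlg n) (StabAlg n)
      (StabAlg n)).toAlgHom.comp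
      (Algebra.TensorProduct.map (comul n) (AlgHom.id (ZMod 2) (StabAlg n)))
  let f2 : StabAlg n ⊗[ZMod 2] StabAlg n →ₐ[ZMod 2]
      StabAlg n ⊗[ZMod 2] (StabAlg n ⊗[ZMod 2] StabAlg n) :=
    Algebra.TensorProduct.map (AlgHom.id (ZMod 2) (StabAlg n)) (comul n)
  let i1 : StabAlg n ⊗[ZMod 2] StabAlg n →ₐ[ZMod 2]
      StabAlg n ⊗[ZMod 2] (StabAlg n ⊗[ZMod 2] StabAlg n) :=
    (Algebra.TensorProduct.assoc (ZMod 2) (ZMod 2) (ZMod 2) (StabAlg n) (StabAlg n)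
      (StabAlg n)).toAlgHom.comp Algebra.TensorProduct.includeLeft
  let i2 : StabAlg n ⊗[ZMod 2] StabAlg n →ₐ[ZMod 2]
      StabAlg n ⊗[ZMod 2] (StabAlg n ⊗[ZMod 2] StabAlg n) :=
    Algebra.TensorProduct.includeRight
  change f1.comp (comul n) = f2.comp (comul n)
  refine StabAlg.algHom_ext n fun s => ?_
  have hs : StabAlg.mk n (X s) = tGen n s := by
    have h1 := s.2
    rw [tGen, if_neg (by omega), dif_pos h1]
  rw [hs]
  change f1 (comul n (tGen n s)) = f2 (comul n (tGen n s))
  rw [comul_tGen]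
  let x : ℕ → StabAlg n ⊗[ZMod 2] (StabAlg n ⊗[ZMod 2] StabAlg n) := fun j => tGen n j ⊗ₜ 1
  let y : ℕ → StabAlg n ⊗[ZMod 2] (StabAlg n ⊗[ZMod 2] StabAlg n) :=
    fun j => 1 ⊗ₜ (tGen n j ⊗ₜ 1)
  let z : ℕ → StabAlg n ⊗[ZMod 2] (StabAlg n ⊗[ZMod 2] StabAlg n) :=
    fun j => 1 ⊗ₜ (1 ⊗ₜ tGen n j)
  have hx1 : ∀ j, f1 (tGen n j ⊗ₜ 1) = coprodEval n x y j := by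
    intro j
    have e1 : f1 (tGen n j ⊗ₜ 1) = i1 (comul n (tGen n j)) := by simp [f1, i1]
    rw [e1, comul_tGen]
    refine (map_coprodEval i1.toRingHom n _ _ j).trans ?_
    congr 1
  have hz1 : ∀ j, f1 (1 ⊗ₜ tGen n j) = z j := by
    intro j
    simp [f1, z, Algebra.TensorProduct.one_def]
  have hx2 : ∀ j, f2 (tGen n j ⊗ₜ 1) = x j := by
    intro j
    simp [f2, x]
  have hz2 : ∀ j, f2 (1 ⊗ₜ tGen n j) = coprodEval n y z j := by
    intro j
    have e1 : f2 (1 ⊗ₜ tGen n j) = i2 (comul n (tGen n j)) := by simp [f2, i2]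
    rw [e1, comul_tGen]
    exact map_coprodEval i2.toRingHom n _ _ j
  refine (map_coprodEval f1.toRingHom n _ _ s).trans (Eq.trans ?_
    (map_coprodEval f2.toRingHom n _ _ s).symm)
  change coprodEval n (fun j => f1 (tGen n j ⊗ₜ 1)) (fun j => f1 (1 ⊗ₜ tGen n j)) s =
    coprodEval n (fun j => f2 (tGen n j ⊗ₜ 1)) (fun j => f2 (1 ⊗ₜ tGen n j)) s
  simp only [hx1, hz1, hx2, hz2]
  exact coprodPoly_coassoc n hn
    (tensor_pow n (stab_pow n) (tensor_pow n (stab_pow n) (stab_pow n))) x y z s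

end algebra

section cobar

open scoped TensorProduct

variable (n : ℕ)

/-- The augmentation ideal of `S(n,n)`. -/
noncomputable abbrev AugIdeal : Submodule (ZMod 2) (StabAlg n) := LinearMap.ker (counit n).toLinearMap

/-- The projection `x ↦ x - ε(x)` of `S(n,n)` onto its augmentation ideal. -/
noncomputable def augProj : StabAlg n →ₗ[ZMod 2] AugIdeal n :=
  (LinearMap.id - (Algebra.linearMap (ZMod 2) (StabAlg n)).comp (counit n).toLinearMap).codRestrict
    (AugIdeal n) fun x => by simp

/-- The underlying algebra of the reduced cobar complex: the tensor algebra on the augmentation ideal.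
The word `[α₁|⋯|αₛ]` is the product of the `αᵢ`, and the juxtaposition product is the product of
the tensor algebra. -/
abbrev Cobar : Type := TensorAlgebra (ZMod 2) (AugIdeal n)

/-- The word `[x - ε(x)]` of length one. -/
noncomputable def bar : StabAlg n →ₗ[ZMod 2] Cobar n :=
  (TensorAlgebra.ι (ZMod 2)).comp (augProj n)

/-- The reduced coproduct `∑ [x'|x'']`, i.e. `Δ(x) - x ⊗ 1 - 1 ⊗ x` for `x` in the augmentation
ideal, as an element of the cobar complex. -/
noncomputable def barComul : StabAlg n →ₗ[ZMod 2] Cobar n :=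
  (LinearMap.mul' (ZMod 2) (Cobar n)).comp
    ((TensorProduct.map (bar n) (bar n)).comp (comul n).toLinearMap)

/-- The algebra homomorphism `w ↦ w + d(w) ε` to the dual numbers over the tensor algebra; it encodes
the unique derivation `d` that extends the reduced coproduct. -/
noncomputable def cobarDualHom : Cobar n →ₐ[ZMod 2] DualNumber (Cobar n) :=
  TensorAlgebra.lift (ZMod 2)
    ((TrivSqZeroExt.inlAlgHom (ZMod 2) (Cobar n) (Cobar n)).toLinearMap.comp
        (TensorAlgebra.ι (ZMod 2)) +
      ((TrivSqZeroExt.inrHom (Cobar n) (Cobar n)).restrictScalars (ZMod 2)).comp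
        ((barComul n).comp (AugIdeal n).subtype))

/-- The differential of the cobar complex,
`d[α₁|⋯|αₛ] = ∑ᵢ [α₁|⋯|Δ(αᵢ) - αᵢ ⊗ 1 - 1 ⊗ αᵢ|⋯|αₛ]` (no signs over `F₂`). -/
noncomputable def cobarD : Cobar n →ₗ[ZMod 2] Cobar n :=
  ((TrivSqZeroExt.sndHom (Cobar n) (Cobar n)).restrictScalars (ZMod 2)).comp
    (cobarDualHom n).toLinearMap

theorem cobarD_ι (a : AugIdeal n) :
    cobarD n (TensorAlgebra.ι (ZMod 2) a) = barComul n a := by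
  simp [cobarD, cobarDualHom]

theorem fst_cobarDualHom (x : Cobar n) : (cobarDualHom n x).fst = x := by
  have : (TrivSqZeroExt.fstHom (ZMod 2) (Cobar n) (Cobar n)).comp (cobarDualHom n) =
      AlgHom.id (ZMod 2) _ := by
    ext a
    simp [cobarDualHom]
  exact DFunLike.congr_fun this x

theorem cobarD_mul (x y : Cobar n) : cobarD n (x * y) = cobarD n x * y + x * cobarD n y := by
  have h : ∀ z, cobarD n z = (cobarDualHom n z).snd := fun z => rfl
  rw [h, h, h, map_mul, DualNumber.snd_mul, fst_cobarDualHom, fst_cobarDualHom, add_comm]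

theorem bar_one : bar n 1 = 0 := by
  have : augProj n 1 = 0 := Subtype.ext <| by
    change (1 : StabAlg n) - algebraMap (ZMod 2) (StabAlg n) (counit n 1) = 0
    simp
  rw [bar, LinearMap.comp_apply, this, map_zero]

theorem cobarD_bar (x : StabAlg n) : cobarD n (bar n x) = barComul n x := by
  have h : ((augProj n x : AugIdeal n) : StabAlg n) =
      x - algebraMap (ZMod 2) (StabAlg n) (counit n x) := rfl
  have h1 : barComul n 1 = 0 := by
    simp [barComul, bar_one, Algebra.TensorProduct.one_def]
  rw [bar, LinearMap.comp_apply, cobarD_ι, h, map_sub, Algebra.algebraMap_eq_smul_one, map_smul, h1,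
    smul_zero, sub_zero]

variable [NeZero n]

theorem cobarD_barComul (x : StabAlg n) : cobarD n (barComul n x) = 0 := by
  let m3 : StabAlg n ⊗[ZMod 2] (StabAlg n ⊗[ZMod 2] StabAlg n) →ₗ[ZMod 2] Cobar n :=
    (LinearMap.mul' (ZMod 2) (Cobar n)).comp (TensorProduct.map (bar n)
      ((LinearMap.mul' (ZMod 2) (Cobar n)).comp (TensorProduct.map (bar n) (bar n))))
  have h : ∀ w : StabAlg n ⊗[ZMod 2] StabAlg n,
      cobarD n (LinearMap.mul' (ZMod 2) (Cobar n) (TensorProduct.map (bar n) (bar n) w)) =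
      m3 (Algebra.TensorProduct.assoc (ZMod 2) (ZMod 2) (ZMod 2) (StabAlg n) (StabAlg n)
        (StabAlg n) (Algebra.TensorProduct.map (comul n) (AlgHom.id (ZMod 2) (StabAlg n)) w)) +
      m3 (Algebra.TensorProduct.map (AlgHom.id (ZMod 2) (StabAlg n)) (comul n) w) := by
    intro w
    induction w using TensorProduct.induction_on with
    | zero => simp
    | add a b ha hb => simp only [map_add, ha, hb]; abel
    | tmul a b =>
      rw [TensorProduct.map_tmul, LinearMap.mul'_apply, cobarD_mul, cobarD_bar, cobarD_bar]
      congr 1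
      rw [Algebra.TensorProduct.map_tmul]
      have : ∀ v : StabAlg n ⊗[ZMod 2] StabAlg n,
          LinearMap.mul' (ZMod 2) (Cobar n) (TensorProduct.map (bar n) (bar n) v) * bar n b =
          m3 (Algebra.TensorProduct.assoc (ZMod 2) (ZMod 2) (ZMod 2) (StabAlg n) (StabAlg n)
            (StabAlg n) (v ⊗ₜ b)) := by
        intro v
        induction v using TensorProduct.induction_on with
        | zero => simp
        | add c d hc hd => simp only [map_add, add_mul, TensorProduct.add_tmul, hc, hd]
        | tmul c d => simp [m3, mul_assoc]
      exact this _
  have hc := DFunLike.congr_fun (comul_coassoc n) x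
  refine (h (comul n x)).trans ?_
  have hc' : Algebra.TensorProduct.assoc (ZMod 2) (ZMod 2) (ZMod 2) (StabAlg n) (StabAlg n)
      (StabAlg n) (Algebra.TensorProduct.map (comul n) (AlgHom.id (ZMod 2) (StabAlg n))
        (comul n x)) = Algebra.TensorProduct.map (AlgHom.id (ZMod 2) (StabAlg n)) (comul n)
        (comul n x) := hc
  rw [hc', ← two_smul (ZMod 2), show (2 : ZMod 2) = 0 from rfl, zero_smul]

theorem cobarD_comp_self : (cobarD n).comp (cobarD n) = 0 := by
  ext x
  change cobarD n (cobarD n x) = 0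
  induction x using TensorAlgebra.induction with
  | algebraMap r =>
    have : cobarD n (algebraMap (ZMod 2) (Cobar n) r) = 0 := by
      change (cobarDualHom n (algebraMap (ZMod 2) (Cobar n) r)).snd = 0
      rw [AlgHom.commutes]
      rfl
    rw [this, map_zero]
  | ι a => rw [cobarD_ι, cobarD_barComul]
  | mul a b ha hb =>
    rw [cobarD_mul, map_add, cobarD_mul, cobarD_mul, ha, hb, zero_mul, mul_zero, zero_add, add_zero,
      ← two_smul (ZMod 2), show (2 : ZMod 2) = 0 from rfl, zero_smul]
  | add a b ha hb => rw [map_add, map_add, ha, hb, add_zero]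

end cobar

section spectral

variable {k V : Type*} [CommRing k] [AddCommGroup V] [Module k V]
  (d : V →ₗ[k] V) (F : ℤ → ℤ → Submodule k V)

/-- The elements of filtration `M` whose boundary has filtration `M - r`. Here `F s M` is the part of
filtration `≤ M` in cohomological degree `s`. -/
def specZ (r s M : ℤ) : Submodule k V := F s M ⊓ (F (s + 1) (M - r)).comap d

/-- Boundaries of elements of `Z_r` in filtration `M + r`. -/
def specB (r s M : ℤ) : Submodule k V := (specZ d F r (s - 1) (M + r)).map d

/-- The page `E_r^{s,M} = Z_r^{s,M} / (Z_{r-1}^{s,M-1} + d Z_{r-1}^{s-1,M+r-1})` of the spectral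
sequence of an increasingly filtered cochain complex. -/
abbrev SpecE (r s M : ℤ) : Type _ :=
  specZ d F r s M ⧸
    (specZ d F (r - 1) s (M - 1) ⊔ specB d F (r - 1) s M).submoduleOf (specZ d F r s M)

theorem map_specZ_le (hd : d.comp d = 0) (r s M : ℤ) :
    ∀ x ∈ specZ d F r s M, d x ∈ specZ d F r (s + 1) (M - r) := by
  rintro x ⟨_, h2⟩
  refine ⟨h2, ?_⟩
  have : d (d x) = 0 := DFunLike.congr_fun hd x
  simp [this]

/-- The differential `d_r : E_r^{s,M} → E_r^{s+1,M-r}` induced by `d`. -/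
def specD (hd : d.comp d = 0) (r s M : ℤ) : SpecE d F r s M →ₗ[k] SpecE d F r (s + 1) (M - r) :=
  Submodule.mapQ _ _ (d.restrict (map_specZ_le d F hd r s M)) (by
    rintro ⟨x, hx⟩ h
    have h' : x ∈ specZ d F (r - 1) s (M - 1) ⊔ specB d F (r - 1) s M := h
    change d x ∈ specZ d F (r - 1) (s + 1) (M - r - 1) ⊔ specB d F (r - 1) (s + 1) (M - r)
    obtain ⟨y, hy, z, ⟨w, _, rfl⟩, rfl⟩ := Submodule.mem_sup.1 h'
    have hw : d (d w) = 0 := DFunLike.congr_fun hd w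
    rw [map_add, hw, add_zero]
    refine Submodule.mem_sup_right ⟨y, ?_, rfl⟩
    rwa [show s + 1 - 1 = s by ring, show M - r + (r - 1) = M - 1 by ring])

/-- Cocycles of filtration `≤ M`. -/
def specZInf (s M : ℤ) : Submodule k V := F s M ⊓ LinearMap.ker d

/-- Coboundaries of filtration `≤ M`. -/
def specBInf (s M : ℤ) : Submodule k V := F s M ⊓ (⨆ N, F (s - 1) N).map d

/-- The limit page `E_∞^{s,M} = Z_∞^{s,M} / (Z_∞^{s,M-1} + B_∞^{s,M})`, i.e. the quotient of two
consecutive terms of the induced filtration on cohomology. -/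
abbrev SpecEInf (s M : ℤ) : Type _ :=
  specZInf d F s M ⧸ (specZInf d F s (M - 1) ⊔ specBInf d F s M).submoduleOf (specZInf d F s M)

end spectral

section may

variable (n : ℕ)

/-- The May filtration `M(tₛ^(2^j))`, which does not depend on `j`: it is `2s - 1` for
`n ≤ s ≤ 2n - 1`, and `max {2s - 1, 2 M(t_{s-n}) + 1}` for `s ≥ 2n`. -/
def mayWeight (s : ℕ) : ℕ :=
  if n = 0 ∨ s < 2 * n then 2 * s - 1 else max (2 * s - 1) (2 * mayWeight (s - n) + 1)
termination_by s
decreasing_by omega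

/-- Exponents of the monomials in `tₙ, tₙ₊₁, …`. -/
abbrev Expo : Type := {s : ℕ // n ≤ s} →₀ ℕ

/-- The monomial `∏ tₛ^{e(s)}` in `S(n,n)`. -/
noncomputable def tMonomial (e : Expo n) : StabAlg n :=
  e.prod fun s k => tGen n s ^ k

/-- The May filtration of a monomial: with `e(s) = ∑ᵢ jᵢ 2^i` in binary, the factor `tₛ^{e(s)}`
contributes `∑ᵢ jᵢ M(tₛ^(2^i))`. -/
noncomputable def expoMay (e : Expo n) : ℕ :=
  e.sum fun s k => (Nat.digits 2 k).sum * mayWeight n s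

/-- The inner degree of a monomial, where `|tₛ| = 2(1 + 2 + ⋯ + 2^{s-1}) = 2(2^s - 1)` is taken
modulo `2(1 + 2 + ⋯ + 2^{n-1}) = 2(2^n - 1)`. -/
noncomputable def expoDeg (e : Expo n) : ZMod (2 * (2 ^ n - 1)) :=
  e.sum fun s k => (k : ZMod (2 * (2 ^ n - 1))) * (2 * (2 ^ (s : ℕ) - 1))

/-- A word of nontrivial reduced monomials (all exponents are less than `2^n`). The reduced
monomials form a basis of `S(n,n)`, the nontrivial ones a basis of the augmentation ideal. -/
def IsBarWord (L : List (Expo n)) : Prop :=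
  ∀ e ∈ L, e ≠ 0 ∧ ∀ s, e s < 2 ^ n

/-- The element `[m₁|⋯|mₛ]` of the cobar complex for a word of monomials. -/
noncomputable def barWord (L : List (Expo n)) : Cobar n :=
  (L.map fun e => bar n (tMonomial n e)).prod

/-- The part `C^{s,t}` of the cobar complex, spanned by the words of length `s` and inner
degree `t`. -/
noncomputable def cobarPart (s : ℤ) (t : ZMod (2 * (2 ^ n - 1))) : Submodule (ZMod 2) (Cobar n) :=
  Submodule.span (ZMod 2) (barWord n ''
    {L | IsBarWord n L ∧ (L.length : ℤ) = s ∧ (L.map (expoDeg n)).sum = t})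

/-- The part `FC^{s,t,M}` of May filtration `≤ M` of the cobar complex, spanned by the words
`[m₁|⋯|mₛ]` of inner degree `t` with `M(m₁) + ⋯ + M(mₛ) ≤ M`. -/
noncomputable def mayFil (s : ℤ) (t : ZMod (2 * (2 ^ n - 1))) (M : ℤ) :
    Submodule (ZMod 2) (Cobar n) :=
  Submodule.span (ZMod 2) (barWord n ''
    {L | IsBarWord n L ∧ (L.length : ℤ) = s ∧ (L.map (expoDeg n)).sum = t ∧
      ((L.map (expoMay n)).sum : ℤ) ≤ M})

/-- The page `E_r^{s,t,M}` of the May spectral sequence of `S(n,n)`. -/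
noncomputable abbrev MayE (r s : ℤ) (t : ZMod (2 * (2 ^ n - 1))) (M : ℤ) : Type :=
  SpecE (cobarD n) (fun s M => mayFil n s t M) r s M

/-- The differential `d_r : E_r^{s,t,M} → E_r^{s+1,t,M-r}` of the May spectral sequence. -/
noncomputable def mayD [NeZero n] (r s : ℤ) (t : ZMod (2 * (2 ^ n - 1))) (M : ℤ) :
    MayE n r s t M →ₗ[ZMod 2] MayE n r (s + 1) t (M - r) :=
  specD (cobarD n) (fun s M => mayFil n s t M) (cobarD_comp_self n) r s M

/-- The limit page `E_∞^{s,t,M}` of the May spectral sequence. -/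
noncomputable abbrev MayEInf (s : ℤ) (t : ZMod (2 * (2 ^ n - 1))) (M : ℤ) : Type :=
  SpecEInf (cobarD n) (fun s M => mayFil n s t M) s M

/-- The cocycles of `C^{s,t}`. -/
noncomputable def cocycles (s : ℤ) (t : ZMod (2 * (2 ^ n - 1))) : Submodule (ZMod 2) (Cobar n) :=
  cobarPart n s t ⊓ LinearMap.ker (cobarD n)

/-- The cohomology `H^{s,t} S(n,n) = Ext^{s,t}_{S(n,n)}(F₂, F₂)`, computed by the cobar complex. -/
noncomputable abbrev Coh (s : ℤ) (t : ZMod (2 * (2 ^ n - 1))) : Type :=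
  cocycles n s t ⧸ ((cobarPart n (s - 1) t).map (cobarD n)).submoduleOf (cocycles n s t)

/-- The quotient map from cocycles to cohomology. -/
noncomputable def cohMk (s : ℤ) (t : ZMod (2 * (2 ^ n - 1))) :
    cocycles n s t →ₗ[ZMod 2] Coh n s t :=
  Submodule.mkQ _

/-- The subspace of `H^{s,t} S(n,n)` of the classes that are represented by a cocycle of May
filtration `≤ M`. -/
noncomputable def cohFil (s : ℤ) (t : ZMod (2 * (2 ^ n - 1))) (M : ℤ) :
    Submodule (ZMod 2) (Coh n s t) :=
  ((mayFil n s t M).submoduleOf (cocycles n s t)).map (cohMk n s t)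

/-- The cochain `h_{s,j} = [tₛ^(2^j)]`. -/
noncomputable def hElt (s j : ℕ) : Cobar n := bar n (tGen n s ^ 2 ^ j)

/-- The cochain `ρ_{2n} = ∑ⱼ h_{2n,j}`, the sum over `0 ≤ j < n`. -/
noncomputable def rhoElt : Cobar n := ∑ j ∈ Finset.range n, hElt n (2 * n) j

/-- Exponents of the monomial basis of
`E[h_{s,j} | n < s < 2n] ⊗ E[h_{n,j} (j ≠ 0), ρ_{2n}] ⊗ P[h_{n,0}]`. The number `exp a j` is the
exponent of `h_{n+a,j}` for `0 ≤ a, j < n`, and `rho` is the exponent of `ρ_{2n}`; all of them are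
at most `1`, except for the exponent of `h_{n,0}`. -/
structure MonExp where
  exp : Fin n → Fin n → ℕ
  rho : ℕ
  exp_le : ∀ a j : Fin n, ¬((a : ℕ) = 0 ∧ (j : ℕ) = 0) → exp a j ≤ 1
  rho_le : rho ≤ 1

variable {n}

/-- The product `∏ h_{n+a,j}^{exp a j} · ρ_{2n}^{rho}` in the cobar complex, the factors
`h_{n+a,j}` in lexicographic order of `(a, j)`. -/
noncomputable def MonExp.elt (x : MonExp n) : Cobar n :=
  (List.ofFn fun a : Fin n =>
    (List.ofFn fun j : Fin n => hElt n (n + a) j ^ x.exp a j).prod).prod * rhoElt n ^ x.rho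

/-- The cohomological degree of the monomial. -/
def MonExp.homDeg (x : MonExp n) : ℕ := (∑ a, ∑ j, x.exp a j) + x.rho

/-- The inner degree of the monomial, where `|h_{s,j}| = 2(2^s - 1) 2^j` and
`|ρ_{2n}| = 2(2^{2n} - 1)`, modulo `2(2^n - 1)`. -/
def MonExp.innerDeg (x : MonExp n) : ZMod (2 * (2 ^ n - 1)) :=
  (∑ a : Fin n, ∑ j : Fin n, (x.exp a j : ZMod (2 * (2 ^ n - 1))) *
    (2 * (2 ^ (n + (a : ℕ)) - 1) * 2 ^ (j : ℕ))) + x.rho * (2 * (2 ^ (2 * n) - 1))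

/-- The May filtration of the monomial. -/
def MonExp.mayDeg (x : MonExp n) : ℕ :=
  (∑ a : Fin n, ∑ j : Fin n, x.exp a j * mayWeight n (n + a)) + x.rho * mayWeight n (2 * n)

end may

end MoravaMay

/-!
The argument replaces the spectral sequence by two leading-term computations in the cobar complex,
each of them an algebraic Morse matching (`Matching`) on an explicit basis.

The products of distinct generators `t_s^(2^j)`, `n ≤ s`, `0 ≤ j < n`, form a basis of `S(n,n)`
(`linearIndependent_setElt`, `span_setElt`), so that words of nonempty finite sets of generators
form a basis of the cobar complex (`wordBasis`), adapted to the May filtration (`mayFil_eq`).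

Up to lower weight the coproduct of such a product is the one for primitive generators
(`comul_setElt_sub_mem`). Hence the weight-preserving part of the differential is the cobar
differential of an exterior algebra on primitive generators, whose cohomology is the polynomial
algebra on the `h_{s,j}`, `n ≤ s` (`exists_extD_eq`). This is where the estimates of the coproduct
enter: the terms of `Δ(t_s)` other than `t_s ⊗ 1` and `1 ⊗ t_s` have smaller weight, which is proved
by following the `2`-adic valuations of the coefficients of the integral coproduct polynomials as a
function of the weight (`growsBy_redCoprod_sub`).

Next, the terms of `Δ(t_s^(2^j))` whose weight drops by exactly one are the first carry
`t_{s-n}^(2^(j-1)) ⊗ t_{s-n}^(2^(j-1))`, for `s ≥ 2n`, and for `s = 2n` also `t_n^(2^j) ⊗ t_n^(2^j)`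
(`redCoprod_even`, `redComul_genElt_succ_mem`). On the polynomial algebra they induce the derivation
`polyD` with `h_{s,j} ↦ h_{s-n,j-1}²` for `s > 2n` and `h_{2n,j} ↦ h_{n,j}² + h_{n,j-1}²`. This is a
Koszul-type differential, and a second matching, which pairs a monomial that contains `h_{s+n}` to
an odd power with one that contains the square of `h_s`, shows that its cohomology has the asserted
monomials as a basis (`exists_polyD_eq`, `eq_zero_of_eq_polyD`). The class `ρ_{2n}` spans the kernel
of the cyclic difference `h_{2n,j} ↦ h_{n,j}² + h_{n,j-1}²`, and its cokernel, spanned by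
`h_{n,0}²`, accounts for the polynomial factor.

The monomials are represented by products of genuine cocycles, since `t_s` is primitive for `s < 2n`
and so is `∑ t_{2n}^(2^j)`. Every `E_2`-class therefore comes from a permanent cocycle
(`exists_eq_linearCombination_add`), and all `d_r` with `r ≥ 2` vanish. Descending along the
filtration, which is bounded below, gives the spanning part of the theorem, and the independence of
the monomials modulo boundaries (`eq_zero_of_linearCombination_eq`) gives the rest. A boundary of
weight `M` is always the boundary of a cochain of weight `M + 1` (`exists_cobarD_eq`); this is the
collapse in elementary terms.
-/

namespace MoravaMay

/-! ### Matchings on a basis -/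

section Morse

open Finsupp Module

variable {k X E : Type*} [CommRing k] [AddCommGroup E] [Module k E]

/-- An acyclic matching for an endomorphism `d`, with respect to a basis: a bijection from the set `src`
of sources to the set `tgt` of targets such that the image of a source under `d` contains its target
with coefficient one, and otherwise only targets that precede it in the well-founded relation `rel`.
The remaining basis elements are unrestricted; a basis element that is neither a source nor a target
is critical. -/
structure Matching (b : Basis X k E) (d : E →ₗ[k] E) where
  src : Set X
  tgt : Set X
  toFun : X → X
  rel : X → X → Prop
  wf : WellFounded rel
  trans : ∀ {x y z}, rel x y → rel y z → rel x z
  mapsTo : ∀ u ∈ src, toFun u ∈ tgt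
  injOn : Set.InjOn toFun src
  surjOn : ∀ v ∈ tgt, ∃ u ∈ src, toFun u = v
  lead : ∀ u ∈ src, b.repr (d (b u)) (toFun u) = 1
  lower : ∀ u ∈ src, ∀ v ∈ tgt, b.repr (d (b u)) v ≠ 0 → v = toFun u ∨ rel v (toFun u)

variable {b : Basis X k E} {d : E →ₗ[k] E}

theorem Matching.rel_irrefl (μ : Matching b d) (x : X) : ¬ μ.rel x x :=
  fun h => μ.wf.irrefl.irrefl x h

/-- Elimination of the targets from a single basis vector. The weight `wt` is assumed to change by `sh`
under `d`, and the correcting vector is then supported on sources of the expected weight. -/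
theorem Matching.exists_sub_basis {ι : Type*} (μ : Matching b d) (wt : X → ι) (sh : ι → ι)
    (hwt : ∀ u x, b.repr (d (b u)) x ≠ 0 → wt u = sh (wt x)) (v : X) :
    ∃ z ∈ Submodule.span k (b '' (μ.src ∩ {u | wt u = sh (wt v)})),
      ∀ v' ∈ μ.tgt, b.repr (b v - d z) v' = 0 := by
  classical
  induction v using μ.wf.induction with
  | _ v ih =>
  by_cases hv : v ∈ μ.tgt
  swap
  · refine ⟨0, Submodule.zero_mem _, fun v' hv' => ?_⟩
    rw [map_zero, sub_zero, b.repr_self, Finsupp.single_apply, if_neg]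
    rintro rfl
    exact hv hv'
  obtain ⟨u, hu, rfl⟩ := μ.surjOn v hv
  have hne : Nontrivial k ∨ Subsingleton k := (subsingleton_or_nontrivial k).symm
  rcases hne with hne | hsub
  swap
  · exact ⟨0, Submodule.zero_mem _, fun _ _ => Subsingleton.elim _ _⟩
  -- the remaining basis vectors in the boundary of `b u` are treated by induction
  choose! g hg hg' using ih
  set c := b.repr (d (b u)) with hc
  have hwu : wt u = sh (wt (μ.toFun u)) := hwt _ _ (by rw [μ.lead u hu]; exact one_ne_zero)
  let T := c.support.filter fun v' => v' ∈ μ.tgt ∧ v' ≠ μ.toFun u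
  have hT : ∀ v' ∈ T, μ.rel v' (μ.toFun u) := by
    intro v' hv'
    rw [Finset.mem_filter, Finsupp.mem_support_iff] at hv'
    exact (μ.lower u hu v' hv'.2.1 hv'.1).resolve_left hv'.2.2
  refine ⟨b u - ∑ v' ∈ T, c v' • g v', ?_, fun w hw => ?_⟩
  · refine Submodule.sub_mem _ (Submodule.subset_span ⟨u, ⟨hu, hwu⟩, rfl⟩)
      (Submodule.sum_mem _ fun v' hv' => Submodule.smul_mem _ _ ?_)
    have h1 := hg v' (hT v' hv')
    have h2 : wt u = sh (wt v') := hwt _ _ (by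
      rw [Finset.mem_filter, Finsupp.mem_support_iff] at hv'
      exact hv'.1)
    rwa [← h2, hwu] at h1
  · have h1 : ∀ v' ∈ T, b.repr (d (g v')) w = Finsupp.single v' 1 w := by
      intro v' hv'
      have := hg' v' (hT v' hv') w hw
      rw [map_sub, b.repr_self, Finsupp.sub_apply, sub_eq_zero] at this
      exact this.symm
    have h2 : b.repr (d (∑ v' ∈ T, c v' • g v')) w = if w ∈ T then c w else 0 := by
      simp only [map_sum, map_smul, Finsupp.finsetSum_apply, Finsupp.smul_apply, smul_eq_mul]
      rw [Finset.sum_congr rfl fun v' hv' => by rw [h1 v' hv']]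
      simp [Finsupp.single_apply]
    rw [map_sub, map_sub d, map_sub b.repr, Finsupp.sub_apply, Finsupp.sub_apply, h2, ← hc,
      b.repr_self, Finsupp.single_apply]
    by_cases hw1 : μ.toFun u = w
    · subst hw1
      rw [if_pos rfl, if_neg (by simp [T]), hc, μ.lead u hu]
      ring
    · rw [if_neg hw1]
      by_cases hw2 : w ∈ T
      · rw [if_pos hw2]; ring
      · rw [if_neg hw2]
        have : c w = 0 := by
          by_contra h
          exact hw2 (by
            rw [Finset.mem_filter, Finsupp.mem_support_iff]
            exact ⟨h, hw, fun h => hw1 h.symm⟩)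
        rw [this]; ring

/-- Every vector can be changed by a boundary so that no target remains. -/
theorem Matching.exists_sub {ι : Type*} (μ : Matching b d) (wt : X → ι) (sh : ι → ι)
    (hwt : ∀ u x, b.repr (d (b u)) x ≠ 0 → wt u = sh (wt x)) (S : Set ι) (x : E)
    (hx : x ∈ Submodule.span k (b '' {v | wt v ∈ S})) :
    ∃ z ∈ Submodule.span k (b '' (μ.src ∩ {u | wt u ∈ sh '' S})),
      ∀ v ∈ μ.tgt, b.repr (x - d z) v = 0 := by
  induction hx using Submodule.span_induction with
  | mem x hx =>
    obtain ⟨v, hv, rfl⟩ := hx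
    obtain ⟨z, hz, h⟩ := μ.exists_sub_basis wt sh hwt v
    refine ⟨z, Submodule.span_mono (Set.image_mono ?_) hz, h⟩
    exact Set.inter_subset_inter_right _ fun u hu => ⟨wt v, hv, Eq.symm hu⟩
  | zero => exact ⟨0, Submodule.zero_mem _, by simp⟩
  | add x y _ _ hx hy =>
    obtain ⟨z, hz, h⟩ := hx
    obtain ⟨z', hz', h'⟩ := hy
    refine ⟨z + z', Submodule.add_mem _ hz hz', fun v hv => ?_⟩
    have e : x + y - d (z + z') = (x - d z) + (y - d z') := by rw [map_add]; abel
    rw [e, map_add, Finsupp.add_apply, h v hv, h' v hv, add_zero]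
  | smul a x _ hx =>
    obtain ⟨z, hz, h⟩ := hx
    refine ⟨a • z, Submodule.smul_mem _ _ hz, fun v hv => ?_⟩
    rw [map_smul, ← smul_sub, map_smul, Finsupp.smul_apply, h v hv, smul_zero]

/-- A combination of sources whose boundary contains no target vanishes. -/
theorem Matching.eq_zero (μ : Matching b d) (x : E) (hx : x ∈ Submodule.span k (b '' μ.src))
    (h : ∀ v ∈ μ.tgt, b.repr (d x) v = 0) : x = 0 := by
  classical
  by_contra hne
  have hs := (b.mem_span_image).1 hx
  set c := b.repr x with hc
  have hcs : c.support.Nonempty := by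
    rw [Finsupp.support_nonempty_iff, hc]
    simpa using hne
  -- a source in the support whose target is maximal
  obtain ⟨u, hu, hmax⟩ : ∃ u ∈ c.support, ∀ u' ∈ c.support, ¬ μ.rel (μ.toFun u) (μ.toFun u') := by
    let r : X → X → Prop := fun u u' => μ.rel (μ.toFun u') (μ.toFun u)
    have : IsTrans X r := ⟨fun a b c h h' => μ.trans h' h⟩
    have : Std.Irrefl r := ⟨fun a => μ.rel_irrefl _⟩
    have : IsStrictOrder X r := {}
    have hwf : Set.WellFoundedOn (↑c.support : Set X) r := Finset.wellFoundedOn _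
    obtain ⟨u, -, hmin⟩ := WellFounded.has_min hwf Set.univ ⟨⟨_, hcs.choose_spec⟩, trivial⟩
    exact ⟨u, u.2, fun u' hu' => hmin ⟨u', hu'⟩ trivial⟩
  have hxe : x = ∑ u' ∈ c.support, c u' • b u' := by
    rw [hc]; exact (b.linearCombination_repr x).symm
  have h1 := h _ (μ.mapsTo u (hs hu))
  rw [hxe, map_sum, map_sum, Finsupp.finsetSum_apply, Finset.sum_eq_single u] at h1
  · rw [map_smul, map_smul, Finsupp.smul_apply, μ.lead u (hs hu), smul_eq_mul, mul_one] at h1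
    exact Finsupp.mem_support_iff.1 hu h1
  · intro u' hu' hne'
    rw [map_smul, map_smul, Finsupp.smul_apply]
    by_cases h0 : b.repr (d (b u')) (μ.toFun u) = 0
    · rw [h0, smul_zero]
    · rcases μ.lower u' (hs hu') _ (μ.mapsTo u (hs hu)) h0 with h2 | h2
      · exact absurd (μ.injOn (hs hu) (hs hu') h2) hne'.symm
      · exact absurd h2 (hmax u' hu')
  · intro h; exact absurd hu h

end Morse

/-! ### The cobar complex of an exterior algebra on primitive generators -/

section Words

open Finsupp Module

/-- The letters of the cobar words of an exterior coalgebra: nonempty finite sets of generators. -/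
abbrev Letter (I : Type*) : Type _ := {A : Finset I // A.Nonempty}

/-- The letter of a single generator. -/
def Letter.sing {I : Type*} (a : I) : Letter I := ⟨{a}, Finset.singleton_nonempty a⟩

theorem Letter.sing_injective {I : Type*} : Function.Injective (Letter.sing : I → Letter I) := fun a b h => by
  simpa [Letter.sing] using h

variable {I : Type*} [LinearOrder I]

/-- The largest generator in a letter. -/
def Letter.top (A : Letter I) : I := A.1.max' A.2

@[simp] theorem Letter.top_sing (a : I) : (Letter.sing a).top = a := by
  simp [Letter.top, Letter.sing]

/-- One letter of a word is split into two disjoint letters. -/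
inductive Split : List (Letter I) → List (Letter I) → Prop
  | here (A B C : Letter I) (w : List (Letter I)) (h : B.1 ∪ C.1 = A.1) (hd : Disjoint B.1 C.1) :
      Split (A :: w) (B :: C :: w)
  | cons (A : Letter I) {u v : List (Letter I)} (h : Split u v) : Split (A :: u) (A :: v)

/-- The matching of cobar words: after a weakly increasing sequence of single generators, the first
longer letter whose largest generator `a` continues the sequence is split into `a` and the rest. In
`WordMatch p u v` the word `v` is the target of `u`, and all these generators are at least `p`. -/
inductive WordMatch : WithBot I → List (Letter I) → List (Letter I) → Prop
  | here (p : WithBot I) (A B : Letter I) (w : List (Letter I)) (hp : p ≤ A.top)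
      (hB : B.1 = A.1.erase A.top) : WordMatch p (A :: w) (Letter.sing A.top :: B :: w)
  | cons (p : WithBot I) (a : I) (hp : p ≤ a) {u v : List (Letter I)} (h : WordMatch a u v) :
      WordMatch p (Letter.sing a :: u) (Letter.sing a :: v)

/-- The critical words: weakly increasing sequences of single generators (at least `p`). -/
inductive WordCrit : WithBot I → List (Letter I) → Prop
  | nil (p : WithBot I) : WordCrit p []
  | cons (p : WithBot I) (a : I) (hp : p ≤ a) {w : List (Letter I)} (h : WordCrit a w) :
      WordCrit p (Letter.sing a :: w)

theorem Letter.eq_sing_or (A : Letter I) :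
    A = Letter.sing A.top ∨ ∃ B : Letter I, B.1 = A.1.erase A.top := by
  rcases (A.1.erase A.top).eq_empty_or_nonempty with h | h
  · left
    refine Subtype.ext (Finset.Subset.antisymm ?_ ?_)
    · intro x hx
      by_contra hne
      have : x ∈ A.1.erase A.top :=
        Finset.mem_erase.2 ⟨fun h => hne (by simp [Letter.sing, h]), hx⟩
      simp [h] at this
    · intro x hx
      simp only [Letter.sing, Finset.mem_singleton] at hx
      rw [hx]
      exact Finset.max'_mem _ _
  · exact Or.inr ⟨⟨_, h⟩, rfl⟩

theorem Letter.top_lt {A B : Letter I} (h : B.1 = A.1.erase A.top) : B.top < A.top := by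
  have h1 : B.top ∈ A.1.erase A.top := h ▸ Finset.max'_mem _ _
  exact lt_of_le_of_ne (Finset.le_max' _ _ (Finset.mem_of_mem_erase h1)) (Finset.ne_of_mem_erase h1)

theorem Letter.ne_sing {A B : Letter I} (h : B.1 = A.1.erase A.top) (a : I) :
    A ≠ Letter.sing a := by
  rintro rfl
  have := B.2
  rw [h, Letter.top_sing] at this
  simp [Letter.sing] at this

/-- A word whose first letter does not fall below `p` is critical, a source or a target. -/
theorem word_cases (w : List (Letter I)) : ∀ p : WithBot I,
    (∃ (A : Letter I) (w' : _), w = A :: w' ∧ (A.top : WithBot I) < p) ∨ WordCrit p w ∨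
      (∃ v, WordMatch p w v) ∨ ∃ u, WordMatch p u w := by
  induction w with
  | nil => exact fun p => Or.inr (Or.inl (.nil p))
  | cons A w ih =>
    intro p
    rcases lt_or_ge (A.top : WithBot I) p with h | h
    · exact Or.inl ⟨A, w, rfl, h⟩
    right
    rcases A.eq_sing_or with hA | ⟨B, hB⟩
    · rw [hA]
      rcases ih A.top with ⟨B, w', rfl, hB⟩ | h1 | ⟨v, h1⟩ | ⟨u, h1⟩
      · right; right
        have hlt : B.top < A.top := WithBot.coe_lt_coe.1 hB
        have hn : A.top ∉ B.1 := fun hm => absurd (Finset.le_max' _ _ hm) (not_le.2 hlt)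
        let C : Letter I := ⟨insert A.top B.1, Finset.insert_nonempty _ _⟩
        have hC : C.top = A.top := by
          have : C.top = max A.top B.top := Finset.max'_insert _ _ B.2
          rw [this, max_eq_left hlt.le]
        have := WordMatch.here p C B w' (by rwa [hC]) (by
          rw [hC]; exact (Finset.erase_insert hn).symm)
        rw [hC] at this
        exact ⟨_, this⟩
      · exact Or.inl (.cons p _ h h1)
      · exact Or.inr (Or.inl ⟨_, .cons p _ h h1⟩)
      · exact Or.inr (Or.inr ⟨_, .cons p _ h h1⟩)
    · exact Or.inr (Or.inl ⟨_, .here p A B w h hB⟩)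

theorem WordMatch.head {p : WithBot I} {u v : List (Letter I)} (h : WordMatch p u v) :
    ∃ (a : I) (w : _), v = Letter.sing a :: w ∧ p ≤ a := by
  cases h with
  | here p A B w hp hB => exact ⟨_, _, rfl, hp⟩
  | cons p a hp h => exact ⟨_, _, rfl, hp⟩

theorem WordMatch.length_eq {p : WithBot I} {u v : List (Letter I)} (h : WordMatch p u v) :
    v.length = u.length + 1 := by
  induction h with
  | here => simp
  | cons p a hp h ih => simp [ih]

theorem Split.length_eq {u v : List (Letter I)} (h : Split u v) :
    v.length = u.length + 1 := by
  induction h with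
  | here => simp
  | cons p h ih => simp [ih]

theorem WordMatch.right_unique {p : WithBot I} {u v v' : List (Letter I)} (h : WordMatch p u v)
    (h' : WordMatch p u v') : v = v' := by
  induction h generalizing v' with
  | here p A B w hp hB =>
    generalize hu : A :: w = u at h'
    cases h' with
    | here p A' B' w' hp' hB' =>
      obtain ⟨rfl, rfl⟩ := List.cons_eq_cons.1 hu
      rw [Subtype.ext (hB.trans hB'.symm)]
    | cons p a hp' h =>
      exact absurd (List.cons_eq_cons.1 hu).1 (Letter.ne_sing hB a)
  | @cons p a hp u v h ih =>
    generalize hu : Letter.sing a :: u = u' at h'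
    cases h' with
    | here p A' B' w' hp' hB' =>
      exact absurd (List.cons_eq_cons.1 hu).1.symm (Letter.ne_sing hB' a)
    | cons p a' hp' h' =>
      obtain ⟨h1, rfl⟩ := List.cons_eq_cons.1 hu
      obtain rfl := Letter.sing_injective h1
      rw [ih h']

theorem WordMatch.left_unique {p : WithBot I} {u u' v : List (Letter I)} (h : WordMatch p u v)
    (h' : WordMatch p u' v) : u = u' := by
  induction h generalizing u' with
  | here p A B w hp hB =>
    generalize hv : Letter.sing A.top :: B :: w = v at h'
    cases h' with
    | here p A' B' w' hp' hB' =>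
      obtain ⟨h1, h2⟩ := List.cons_eq_cons.1 hv
      obtain ⟨rfl, rfl⟩ := List.cons_eq_cons.1 h2
      have h1 := Letter.sing_injective h1
      congr 1
      refine Subtype.ext ?_
      rw [← Finset.insert_erase (Finset.max'_mem A.1 A.2),
        ← Finset.insert_erase (Finset.max'_mem A'.1 A'.2)]
      change insert A.top (A.1.erase A.top) = insert A'.top (A'.1.erase A'.top)
      rw [← hB, ← hB', h1]
    | cons p a hp' h =>
      obtain ⟨h1, rfl⟩ := List.cons_eq_cons.1 hv
      obtain rfl := Letter.sing_injective h1
      obtain ⟨b, w', hw, hb⟩ := h.head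
      obtain ⟨rfl, rfl⟩ := List.cons_eq_cons.1 hw
      have := Letter.top_lt hB
      rw [Letter.top_sing] at this
      exact absurd (WithBot.coe_le_coe.1 hb) (not_le.2 this)
  | @cons p a hp u v h ih =>
    generalize hu : Letter.sing a :: v = u' at h'
    cases h' with
    | here p A' B' w' hp' hB' =>
      obtain ⟨h1, rfl⟩ := List.cons_eq_cons.1 hu
      obtain rfl := Letter.sing_injective h1
      obtain ⟨b, w', hw, hb⟩ := h.head
      obtain ⟨rfl, rfl⟩ := List.cons_eq_cons.1 hw
      have := Letter.top_lt hB'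
      rw [Letter.top_sing] at this
      exact absurd (WithBot.coe_le_coe.1 hb) (not_le.2 this)
    | cons p a' hp' h' =>
      obtain ⟨h1, rfl⟩ := List.cons_eq_cons.1 hu
      obtain rfl := Letter.sing_injective h1
      rw [ih h']

/-- The shortlex order of the words, read through the largest generators of their letters. -/
def wordRel (v v' : List (Letter I)) : Prop :=
  List.Shortlex (· < ·) (v.map Letter.top) (v'.map Letter.top)

/-- Acyclicity: the targets obtained by splitting a source precede its own target. -/
theorem Split.lower {p : WithBot I} {u v x u' : List (Letter I)} (h : WordMatch p u v)
    (hs : Split u x) (h' : WordMatch p u' x) : x = v ∨ wordRel x v := by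
  induction h generalizing x u' with
  | here p A B w hp hB =>
    generalize hu : A :: w = u at hs
    cases hs with
    | here A' C D w' hU hd =>
      obtain ⟨rfl, rfl⟩ := List.cons_eq_cons.1 hu
      obtain ⟨a, w', hw, ha⟩ := h'.head
      obtain ⟨rfl, rfl⟩ := List.cons_eq_cons.1 hw
      by_cases h1 : A.top = a
      · subst h1
        left
        congr 2
        refine Subtype.ext ?_
        rw [hB, ← hU]
        have : A.top ∉ D.1 := fun h => Finset.disjoint_left.1 hd (by simp [Letter.sing]) h
        ext y
        simp only [Letter.sing, Finset.mem_erase, Finset.mem_union, Finset.mem_singleton]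
        constructor
        · intro hy; exact ⟨fun h => this (h ▸ hy), Or.inr hy⟩
        · rintro ⟨h1, h2 | h2⟩
          · exact absurd h2 h1
          · exact h2
      · right
        have h2 : a ≤ A.top := Finset.le_max' _ _ (by rw [← hU]; simp [Letter.sing])
        refine List.Shortlex.of_lex (by simp) (List.Lex.rel ?_)
        rw [Letter.top_sing, Letter.top_sing]
        exact lt_of_le_of_ne h2 (Ne.symm h1)
    | cons A' hs' =>
      obtain ⟨rfl, rfl⟩ := List.cons_eq_cons.1 hu
      obtain ⟨a, w', hw, ha⟩ := h'.head
      exact absurd (List.cons_eq_cons.1 hw).1 (Letter.ne_sing hB a)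
  | @cons p a hp u v h ih =>
    generalize hu : Letter.sing a :: u = u0 at hs
    cases hs with
    | here A' C D w' hU hd =>
      obtain ⟨rfl, rfl⟩ := List.cons_eq_cons.1 hu
      exfalso
      obtain ⟨c, hc⟩ := C.2
      obtain ⟨e, he⟩ := D.2
      have h1 : c ∈ (Letter.sing a).1 := by rw [← hU]; exact Finset.mem_union_left _ hc
      have h2 : e ∈ (Letter.sing a).1 := by rw [← hU]; exact Finset.mem_union_right _ he
      simp only [Letter.sing, Finset.mem_singleton] at h1 h2
      subst h1 h2
      exact Finset.disjoint_left.1 hd hc he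
    | @cons A' u1 x hs' =>
      obtain ⟨rfl, rfl⟩ := List.cons_eq_cons.1 hu
      generalize hx : Letter.sing a :: x = y at h'
      cases h' with
      | here p A' B' w' hp' hB' =>
        obtain ⟨h1, rfl⟩ := List.cons_eq_cons.1 hx
        obtain rfl := Letter.sing_injective h1
        obtain ⟨b, w', rfl, hb⟩ := h.head
        right
        have hl := hs'.length_eq
        have hl' := h.length_eq
        refine List.Shortlex.of_lex (by simp at hl hl' ⊢; omega) (List.Lex.cons (List.Lex.rel ?_))
        rw [Letter.top_sing]
        exact (Letter.top_lt hB').trans_le (WithBot.coe_le_coe.1 hb)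
      | cons p a' hp' h' =>
        obtain ⟨h1, rfl⟩ := List.cons_eq_cons.1 hx
        obtain rfl := Letter.sing_injective h1
        rcases ih hs' h' with rfl | h2
        · exact Or.inl rfl
        · exact Or.inr (List.Shortlex.cons h2)

/-- The boundary of a word: the sum of all words obtained by splitting a letter. -/
noncomputable def wordD : List (Letter I) → (List (Letter I) →₀ ZMod 2)
  | [] => 0
  | A :: w => (∑ B ∈ A.1.powerset, if h : B.Nonempty ∧ (A.1 \ B).Nonempty then
      Finsupp.single ((⟨B, h.1⟩ : Letter I) :: (⟨A.1 \ B, h.2⟩ : Letter I) :: w) 1 else 0) +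
      Finsupp.lmapDomain (ZMod 2) (ZMod 2) (fun v => A :: v) (wordD w)

theorem lmapDomain_cons_apply (A B : Letter I) (v : List (Letter I))
    (f : List (Letter I) →₀ ZMod 2) :
    Finsupp.lmapDomain (ZMod 2) (ZMod 2) (fun v => A :: v) f (B :: v) = if A = B then f v else 0 := by
  rw [Finsupp.lmapDomain_apply]
  split_ifs with h
  · subst h
    exact Finsupp.mapDomain_apply (List.cons_injective) f v
  · refine Finsupp.mapDomain_of_notMem_range _ _ ?_
    rintro ⟨x, hx⟩
    exact h (List.cons_eq_cons.1 hx).1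

theorem split_of_wordD {u x : List (Letter I)} (h : wordD u x ≠ 0) : Split u x := by
  induction u generalizing x with
  | nil => simp [wordD] at h
  | cons A w ih =>
    rw [wordD, Finsupp.add_apply] at h
    by_cases h1 : (Finsupp.lmapDomain (ZMod 2) (ZMod 2) (fun v => A :: v) (wordD w)) x = 0
    · rw [h1, add_zero, Finsupp.finsetSum_apply] at h
      obtain ⟨B, hB, hne⟩ := Finset.exists_ne_zero_of_sum_ne_zero h
      split_ifs at hne with hn
      · rw [Finsupp.single_apply] at hne
        split_ifs at hne with hx
        · subst hx
          exact .here _ _ _ _ (Finset.union_sdiff_of_subset (Finset.mem_powerset.1 hB))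
            Finset.disjoint_sdiff
        · exact absurd rfl hne
      · simp at hne
    · have h2 : x ∈ Set.range (fun v => A :: v) := by
        by_contra hx
        exact h1 (Finsupp.mapDomain_of_notMem_range _ _ hx)
      obtain ⟨v, rfl⟩ := h2
      change (Finsupp.lmapDomain (ZMod 2) (ZMod 2) (fun v => A :: v) (wordD w)) (A :: v) ≠ 0 at h1
      rw [lmapDomain_cons_apply, if_pos rfl] at h1
      exact .cons A (ih h1)

theorem WordMatch.wordD_eq {p : WithBot I} {u v : List (Letter I)} (h : WordMatch p u v) :
    wordD u v = 1 := by
  induction h with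
  | here p A B w hp hB =>
    have hmem : A.top ∈ A.1 := Finset.max'_mem _ _
    have hsd : A.1 \ {A.top} = B.1 := by rw [hB, Finset.sdiff_singleton_eq_erase]
    rw [wordD, Finsupp.add_apply, lmapDomain_cons_apply, if_neg (Letter.ne_sing hB _), add_zero,
      Finsupp.finsetSum_apply, Finset.sum_eq_single {A.top}]
    · rw [dif_pos ⟨Finset.singleton_nonempty _, hsd ▸ B.2⟩]
      rw [Finsupp.single_apply, if_pos]
      congr 2
      exact Subtype.ext hsd
    · intro C _ hne
      split_ifs with h
      · rw [Finsupp.single_apply, if_neg]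
        intro he
        exact hne (congrArg Subtype.val (List.cons_eq_cons.1 he).1)
      · rfl
    · intro hn
      exact absurd (Finset.mem_powerset.2 (Finset.singleton_subset_iff.2 hmem)) hn
  | @cons p a hp u v h ih =>
    rw [wordD, Finsupp.add_apply, lmapDomain_cons_apply, if_pos rfl, ih, Finsupp.finsetSum_apply,
      Finset.sum_eq_zero, zero_add]
    intro B hB
    rw [dif_neg]
    · rfl
    rintro ⟨⟨b, hb⟩, ⟨c, hc⟩⟩
    have h1 := Finset.mem_powerset.1 hB hb
    have h2 := (Finset.mem_sdiff.1 hc)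
    simp only [Letter.sing, Finset.mem_singleton] at h1 h2
    exact h2.2 (by rw [h2.1, ← h1]; exact hb)

/-- The differential of the cobar complex of the primitively generated exterior algebra. -/
noncomputable def extD : (List (Letter I) →₀ ZMod 2) →ₗ[ZMod 2] (List (Letter I) →₀ ZMod 2) :=
  Finsupp.linearCombination (ZMod 2) wordD

@[simp] theorem extD_single (w : List (Letter I)) : extD (Finsupp.single w 1) = wordD w := by
  simp [extD]

/-- Prefixing a letter to a word; the empty set acts as zero. -/
noncomputable def consLin (B : Finset I) :
    (List (Letter I) →₀ ZMod 2) →ₗ[ZMod 2] (List (Letter I) →₀ ZMod 2) := by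
  classical
  exact if h : B.Nonempty then
    Finsupp.lmapDomain (ZMod 2) (ZMod 2) fun v => (⟨B, h⟩ : Letter I) :: v else 0

theorem consLin_letter (A : Letter I) :
    consLin A.1 = Finsupp.lmapDomain (ZMod 2) (ZMod 2) fun v => A :: v := by
  rw [consLin, dif_pos A.2]

theorem wordD_cons (A : Letter I) (w : List (Letter I)) :
    wordD (A :: w) = ∑ B ∈ A.1.powerset, consLin B (consLin (A.1 \ B) (Finsupp.single w 1)) +
      consLin A.1 (wordD w) := by
  rw [wordD, consLin_letter]
  congr 1
  refine Finset.sum_congr rfl fun B _ => ?_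
  by_cases h1 : B.Nonempty
  · by_cases h2 : (A.1 \ B).Nonempty
    · rw [dif_pos ⟨h1, h2⟩, consLin, consLin, dif_pos h1, dif_pos h2]
      simp
    · rw [dif_neg (fun h => h2 h.2), consLin, consLin, dif_neg h2]
      simp
  · rw [dif_neg (fun h => h1 h.1), consLin, dif_neg h1]
    simp

theorem extD_consLin (A : Finset I) (f : List (Letter I) →₀ ZMod 2) :
    extD (consLin A f) = ∑ B ∈ A.powerset, consLin B (consLin (A \ B) f) + consLin A (extD f) := by
  by_cases hA : A.Nonempty
  · induction f using Finsupp.induction_linear with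
    | zero => simp
    | add f g hf hg =>
      simp only [map_add, hf, hg, Finset.sum_add_distrib]
      abel
    | single w a =>
      obtain ⟨a, rfl⟩ : ∃ b : ZMod 2, a = b • 1 := ⟨a, by simp⟩
      simp only [← Finsupp.smul_single, map_smul, ← Finset.smul_sum, ← smul_add, extD_single]
      congr 1
      rw [← wordD_cons ⟨A, hA⟩ w, ← extD_single, consLin_letter ⟨A, hA⟩]
      simp
  · rw [Finset.not_nonempty_iff_eq_empty] at hA
    subst hA
    simp [consLin]

theorem extD_extD (z : List (Letter I) →₀ ZMod 2) : extD (extD z) = 0 := by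
  have h2 : ∀ y : List (Letter I) →₀ ZMod 2, y + y = 0 := fun y => by
    rw [← two_smul (ZMod 2), show (2 : ZMod 2) = 0 from rfl, zero_smul]
  suffices h : ∀ w : List (Letter I), extD (wordD w) = 0 by
    induction z using Finsupp.induction_linear with
    | zero => simp
    | add f g hf hg => rw [map_add, map_add, hf, hg, add_zero]
    | single w a =>
      rw [extD, Finsupp.linearCombination_single, map_smul, ← extD, h, smul_zero]
  intro w
  induction w with
  | nil => simp [wordD]
  | cons A w ih =>
    rw [wordD_cons, map_add, extD_consLin, ih, map_zero, add_zero, map_sum]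
    simp only [extD_consLin, extD_single, map_add, map_sum, Finset.sum_add_distrib]
    -- the two ways to cut a letter into three agree
    have h3 : ∑ B ∈ A.1.powerset, ∑ C ∈ B.powerset, consLin C (consLin (B \ C)
        (consLin (A.1 \ B) (Finsupp.single w 1))) = ∑ B ∈ A.1.powerset, ∑ C ∈ (A.1 \ B).powerset,
        consLin B (consLin C (consLin ((A.1 \ B) \ C) (Finsupp.single w 1))) := by
      rw [Finset.sum_sigma', Finset.sum_sigma']
      refine Finset.sum_bij' (fun a _ => ⟨a.2, a.1 \ a.2⟩) (fun a _ => ⟨a.1 ∪ a.2, a.1⟩)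
        ?_ ?_ ?_ ?_ ?_
      · rintro ⟨B, C⟩ h
        simp only [Finset.mem_sigma, Finset.mem_powerset] at h ⊢
        exact ⟨h.2.trans h.1, Finset.sdiff_subset_sdiff h.1 le_rfl⟩
      · rintro ⟨B, C⟩ h
        simp only [Finset.mem_sigma, Finset.mem_powerset] at h ⊢
        exact ⟨Finset.union_subset h.1 (h.2.trans Finset.sdiff_subset), Finset.subset_union_left⟩
      · rintro ⟨B, C⟩ h
        simp only [Finset.mem_sigma, Finset.mem_powerset] at h ⊢
        rw [Finset.union_sdiff_of_subset h.2]
      · rintro ⟨B, C⟩ h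
        simp only [Finset.mem_sigma, Finset.mem_powerset] at h ⊢
        rw [Finset.union_sdiff_cancel_left (Finset.disjoint_of_subset_right h.2 Finset.disjoint_sdiff)]
      · rintro ⟨B, C⟩ h
        simp only [Finset.mem_sigma, Finset.mem_powerset] at h ⊢
        rw [sdiff_sdiff_left, Finset.sup_eq_union, Finset.union_sdiff_of_subset h.2]
    rw [h3, ← add_assoc, h2, zero_add, h2]

/-- The matching `WordMatch` is acyclic for the differential `extD`. -/
noncomputable def wordMatching [WellFoundedLT I] :
    Matching (Finsupp.basisSingleOne (R := ZMod 2) (ι := List (Letter I))) extD where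
  src := {u | ∃ v, WordMatch ⊥ u v}
  tgt := {v | ∃ u, WordMatch ⊥ u v}
  toFun u := by classical exact if h : ∃ v, WordMatch ⊥ u v then h.choose else u
  rel := wordRel
  wf := InvImage.wf _ (List.Shortlex.wf wellFounded_lt)
  trans := by
    intro x y z hxy hyz
    unfold wordRel at *
    rw [List.shortlex_def] at *
    rcases hxy with h | ⟨h1, h2⟩ <;> rcases hyz with h' | ⟨h1', h2'⟩
    · exact Or.inl (h.trans h')
    · exact Or.inl (h1' ▸ h)
    · exact Or.inl (h1 ▸ h')
    · refine Or.inr ⟨h1.trans h1', ?_⟩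
      exact lt_trans (show x.map Letter.top < y.map Letter.top from h2) h2'
  mapsTo := by
    rintro u ⟨v, h⟩
    have h' : ∃ v, WordMatch ⊥ u v := ⟨v, h⟩
    rw [dif_pos h']
    exact ⟨u, h'.choose_spec⟩
  injOn := by
    intro u hu u' hu' he
    have hu1 : ∃ v, WordMatch ⊥ u v := hu
    have hu1' : ∃ v, WordMatch ⊥ u' v := hu'
    simp only [dif_pos hu1, dif_pos hu1'] at he
    exact hu.choose_spec.left_unique (he ▸ hu'.choose_spec)
  surjOn := by
    rintro v ⟨u, h⟩
    have h' : ∃ v, WordMatch ⊥ u v := ⟨v, h⟩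
    refine ⟨u, h', ?_⟩
    rw [dif_pos h']
    exact h'.choose_spec.right_unique h
  lead := by
    intro u hu
    have hu1 : ∃ v, WordMatch ⊥ u v := hu
    rw [dif_pos hu1]
    simpa using hu1.choose_spec.wordD_eq
  lower := by
    rintro u hu v ⟨u', h'⟩ hne
    have hu1 : ∃ v, WordMatch ⊥ u v := hu
    rw [dif_pos hu1]
    exact Split.lower hu1.choose_spec (split_of_wordD (by simpa using hne)) h'

open MvPolynomial in
/-- The value of a letter in the polynomial algebra: letters with more than one generator are sent to
zero. -/
noncomputable def letterVal (A : Letter I) : MvPolynomial I (ZMod 2) :=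
  if A.1.card = 1 then X A.top else 0

/-- The value of a word in the polynomial algebra: the product of the values of its letters. -/
noncomputable def wordVal (w : List (Letter I)) : MvPolynomial I (ZMod 2) :=
  (w.map letterVal).prod

theorem letterVal_sing (a : I) : letterVal (Letter.sing a) = MvPolynomial.X a := by
  rw [letterVal, if_pos (by simp [Letter.sing]), Letter.top_sing]

theorem letterVal_eq_zero {A B : Letter I} (h : B.1 = A.1.erase A.top) : letterVal A = 0 := by
  rw [letterVal, if_neg]
  intro h1
  have h2 : B.1.card = 0 := by
    have h3 : A.top ∈ A.1 := Finset.max'_mem A.1 A.2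
    rw [h, Finset.card_erase_of_mem h3, h1]
  exact B.2.ne_empty (Finset.card_eq_zero.1 h2)

theorem linearCombination_lmapDomain_cons (A : Letter I) (f : List (Letter I) →₀ ZMod 2) :
    Finsupp.linearCombination (ZMod 2) wordVal
      (Finsupp.lmapDomain (ZMod 2) (ZMod 2) (fun v => A :: v) f) =
      letterVal A * Finsupp.linearCombination (ZMod 2) wordVal f := by
  induction f using Finsupp.induction_linear with
  | zero => simp
  | add f g hf hg => rw [map_add, map_add, hf, hg, map_add, mul_add]
  | single w a => simp [wordVal]

theorem wordVal_wordD (w : List (Letter I)) :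
    Finsupp.linearCombination (ZMod 2) wordVal (wordD w) = 0 := by
  induction w with
  | nil => simp [wordD]
  | cons A w ih =>
    rw [wordD, map_add, linearCombination_lmapDomain_cons, ih, mul_zero, add_zero, map_sum]
    -- complementary splittings cancel in the commutative algebra
    refine Finset.sum_involution (fun B _ => A.1 \ B) ?_ ?_ ?_ ?_
    · intro B hB
      have hB' := Finset.mem_powerset.1 hB
      have e : A.1 \ (A.1 \ B) = B := Finset.sdiff_sdiff_eq_self hB'
      by_cases h : B.Nonempty ∧ (A.1 \ B).Nonempty
      · have h' : (A.1 \ B).Nonempty ∧ (A.1 \ (A.1 \ B)).Nonempty := ⟨h.2, by rw [e]; exact h.1⟩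
        have e' : (⟨A.1 \ (A.1 \ B), h'.2⟩ : Letter I) = ⟨B, h.1⟩ := Subtype.ext e
        rw [dif_pos h, dif_pos h', e']
        simp only [Finsupp.linearCombination_single, one_smul, wordVal, List.map_cons,
          List.prod_cons]
        rw [mul_left_comm, CharTwo.add_self_eq_zero]
      · have h' : ¬ ((A.1 \ B).Nonempty ∧ (A.1 \ (A.1 \ B)).Nonempty) := by
          rw [e]; exact fun h' => h h'.symm
        rw [dif_neg h, dif_neg h', map_zero, add_zero]
    · intro B hB hne he
      by_cases h : B.Nonempty ∧ (A.1 \ B).Nonempty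
      · obtain ⟨b, hb⟩ := h.1
        have h2 := hb
        rw [← he] at h2
        exact (Finset.mem_sdiff.1 h2).2 hb
      · rw [dif_neg h, map_zero] at hne
        exact hne rfl
    · exact fun B _ => Finset.mem_powerset.2 Finset.sdiff_subset
    · intro B hB
      exact Finset.sdiff_sdiff_eq_self (Finset.mem_powerset.1 hB)

theorem WordMatch.wordVal_eq {p : WithBot I} {u v : List (Letter I)} (h : WordMatch p u v) :
    wordVal u = 0 := by
  induction h with
  | here p A B w hp hB => simp [wordVal, letterVal_eq_zero hB]
  | cons p a hp h ih =>
    rw [wordVal, List.map_cons, List.prod_cons]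
    rw [wordVal] at ih
    rw [ih, mul_zero]

theorem WordCrit.sorted {p : WithBot I} {w : List (Letter I)} (h : WordCrit p w) :
    ∃ l : List I, w = l.map Letter.sing ∧ l.Pairwise (· ≤ ·) ∧ ∀ a ∈ l, p ≤ a := by
  induction h with
  | nil p => exact ⟨[], by simp⟩
  | cons p a hp h ih =>
    obtain ⟨l, rfl, hl, hb⟩ := ih
    refine ⟨a :: l, rfl, List.pairwise_cons.2 ⟨fun b hb' => WithBot.coe_le_coe.1 (hb b hb'), hl⟩, ?_⟩
    intro b hb'
    rcases List.mem_cons.1 hb' with rfl | h'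
    · exact hp
    · exact hp.trans (hb b h')

theorem wordVal_map_sing (l : List I) : wordVal (l.map Letter.sing) =
    MvPolynomial.monomial (Multiset.toFinsupp (l : Multiset I)) 1 := by
  induction l with
  | nil => simp [wordVal]
  | cons a l ih =>
    rw [List.map_cons, wordVal, List.map_cons, List.prod_cons, ← wordVal, ih, letterVal_sing,
      ← Multiset.cons_coe, ← Multiset.singleton_add, map_add, Multiset.toFinsupp_singleton,
      MvPolynomial.X, MvPolynomial.monomial_mul, one_mul]

theorem WordCrit.eq_of_wordVal {w w' : List (Letter I)} (h : WordCrit ⊥ w) (h' : WordCrit ⊥ w')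
    (he : wordVal w = wordVal w') : w = w' := by
  obtain ⟨l, rfl, hl, -⟩ := h.sorted
  obtain ⟨l', rfl, hl', -⟩ := h'.sorted
  rw [wordVal_map_sing, wordVal_map_sing] at he
  have h1 := MvPolynomial.monomial_left_injective (one_ne_zero (α := ZMod 2)) he
  have h2 : (l : Multiset I) = l' := Multiset.toFinsupp.injective h1
  rw [List.Perm.eq_of_pairwise' hl hl' (Multiset.coe_eq_coe.1 h2)]

theorem Split.sum_eq {M : Type*} [AddCommMonoid M] (f : I → M) {u v : List (Letter I)}
    (h : Split u v) : (u.map fun A => ∑ i ∈ A.1, f i).sum = (v.map fun A => ∑ i ∈ A.1, f i).sum := by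
  induction h with
  | here A B C w h hd =>
    simp only [List.map_cons, List.sum_cons]
    rw [← h, Finset.sum_union hd, add_assoc]
  | cons A h ih => simp only [List.map_cons, List.sum_cons, ih]

/-- The cobar complex of an exterior algebra on primitive generators has the polynomial algebra as
its cohomology: a cocycle whose value in the polynomial algebra vanishes is a boundary. The
boundary can be found in the same weights. -/
theorem exists_extD_eq [WellFoundedLT I] {M : Type*} [AddCommMonoid M] (f : I → M) (S : Set M)
    (x : List (Letter I) →₀ ZMod 2) (hd : extD x = 0)
    (hv : Finsupp.linearCombination (ZMod 2) wordVal x = 0)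
    (hx : ∀ w ∈ x.support, (w.map fun A => ∑ i ∈ A.1, f i).sum ∈ S) :
    ∃ z, extD z = x ∧ ∀ w ∈ z.support, (w.map fun A => ∑ i ∈ A.1, f i).sum ∈ S := by
  obtain ⟨z, hz, h⟩ := (wordMatching (I := I)).exists_sub
    (fun w => (w.map fun A => ∑ i ∈ A.1, f i).sum) id
    (fun u v h => (split_of_wordD (by simpa using h)).sum_eq f) S x (by
      rw [Basis.mem_span_image]
      exact fun w hw => hx w (by simpa using hw))
  rw [Basis.mem_span_image] at hz
  refine ⟨z, ?_, fun w hw => by simpa using (hz (by simpa using hw)).2⟩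
  have hzero : x - extD z = 0 := by
    refine (wordMatching (I := I)).eq_zero _ ?_ ?_
    · rw [Basis.mem_span_image]
      intro w hw
      have hw' : (x - extD z) w ≠ 0 := by simpa using hw
      rcases word_cases w ⊥ with ⟨A, w', _, hlt⟩ | hc | hs | ht
      · exact absurd hlt not_lt_bot
      · -- a critical word is detected by its value in the polynomial algebra
        exfalso
        have hval : Finsupp.linearCombination (ZMod 2) wordVal (x - extD z) = 0 := by
          rw [map_sub, hv, zero_sub, neg_eq_zero, extD]
          have h0 : (Finsupp.linearCombination (ZMod 2) wordVal).comp
              (Finsupp.linearCombination (ZMod 2) (wordD (I := I))) = 0 := by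
            ext w : 2
            simp [wordVal_wordD]
          exact DFunLike.congr_fun h0 z
        obtain ⟨l, rfl, -⟩ := hc.sorted
        have h1 := congrArg (MvPolynomial.coeff (Multiset.toFinsupp (l : Multiset I))) hval
        rw [Finsupp.linearCombination_apply, Finsupp.sum, MvPolynomial.coeff_sum,
          Finset.sum_eq_single (l.map Letter.sing)] at h1
        · rw [MvPolynomial.coeff_smul, wordVal_map_sing, MvPolynomial.coeff_monomial, if_pos rfl] at h1
          exact hw' (by simpa using h1)
        · intro w' hw1 hne
          have hw1' := Finsupp.mem_support_iff.1 hw1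
          rw [MvPolynomial.coeff_smul]
          rcases word_cases w' ⊥ with ⟨A, w'', _, hlt⟩ | hc' | ⟨v, hs⟩ | ht
          · exact absurd hlt not_lt_bot
          · obtain ⟨l', rfl, -⟩ := hc'.sorted
            rw [wordVal_map_sing, MvPolynomial.coeff_monomial, if_neg, smul_zero]
            intro he
            refine hne (hc'.eq_of_wordVal hc ?_)
            rw [wordVal_map_sing, wordVal_map_sing, he]
          · rw [hs.wordVal_eq, MvPolynomial.coeff_zero, smul_zero]
          · exact absurd (by simpa using h w' ht) hw1'
        · intro hn
          exact absurd (Finsupp.mem_support_iff.2 hw') hn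
      · exact hs
      · exact absurd (by simpa using h w ht) hw'
    · intro v _
      simp [map_sub, hd, extD_extD]
  exact (sub_eq_zero.1 hzero).symm

end Words

/-! ### May weights -/

section Weights

variable {n : ℕ}

theorem mayWeight_of_lt {s : ℕ} (hs : s < 2 * n) : mayWeight n s = 2 * s - 1 := by
  rw [mayWeight, if_pos (Or.inr hs)]

theorem le_mayWeight (s : ℕ) : 2 * s - 1 ≤ mayWeight n s := by
  rw [mayWeight]
  split_ifs
  · exact le_rfl
  · exact le_max_left _ _

theorem mayWeight_add {s : ℕ} (hn : 0 < n) (hs : n ≤ s) :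
    mayWeight n (s + n) = 2 * mayWeight n s + 1 := by
  have := le_mayWeight (n := n) s
  rw [mayWeight, if_neg (by omega), Nat.add_sub_cancel, max_eq_right (by omega)]

theorem mayWeight_pos {s : ℕ} (hn : 0 < n) (hs : n ≤ s) : 1 ≤ mayWeight n s := by
  have := le_mayWeight (n := n) s
  omega

theorem mayWeight_two_mul (hn : 0 < n) : mayWeight n (2 * n) = 4 * n - 1 := by
  rw [two_mul, mayWeight_add hn le_rfl, mayWeight_of_lt (by omega)]
  omega

/-- The May weight is superadditive with a gap of at least one, which is attained only for the
summand `t_n ⊗ t_n` of the coproduct of `t_{2n}`. -/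
theorem mayWeight_add_le (hn : 0 < n) {j k : ℕ} (hj : n ≤ j) (hk : n ≤ k) :
    mayWeight n j + mayWeight n k + 1 ≤ mayWeight n (j + k) ∧
      (2 * n < j + k → mayWeight n j + mayWeight n k + 2 ≤ mayWeight n (j + k)) := by
  induction h : j + k using Nat.strong_induction_on generalizing j k with
  | _ m ih =>
  subst h
  have e0 : mayWeight n (j + k) = 2 * mayWeight n (j + k - n) + 1 := by
    rw [← mayWeight_add hn (by omega), Nat.sub_add_cancel (by omega)]
  rcases lt_or_ge k (2 * n) with hk2 | hk2
  · rcases lt_or_ge j (2 * n) with hj2 | hj2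
    · rw [mayWeight_of_lt hj2, mayWeight_of_lt hk2, e0]
      have := le_mayWeight (n := n) (j + k - n)
      omega
    · have h1 := (ih (j - n + k) (by omega) (j := j - n) (k := k) (by omega) hk rfl).1
      have e1 : mayWeight n j = 2 * mayWeight n (j - n) + 1 := by
        rw [← mayWeight_add hn (by omega), Nat.sub_add_cancel (by omega)]
      rw [show j + k - n = j - n + k by omega] at e0
      have := mayWeight_pos hn hk
      omega
  · have h1 := (ih (j + (k - n)) (by omega) (j := j) (k := k - n) hj (by omega) rfl).1
    have e1 : mayWeight n k = 2 * mayWeight n (k - n) + 1 := by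
      rw [← mayWeight_add hn (by omega), Nat.sub_add_cancel (by omega)]
    rw [show j + k - n = j + (k - n) by omega] at e0
    have := mayWeight_pos hn hj
    omega

end Weights

/-! ### The generators `t_s^(2^j)` -/

section Generators

/-- The generators `t_s^(2^j)` with `s = lev ≥ n` and `j = frob`, taken modulo `n` because
`t_s^(2^n) = t_s`. -/
@[ext] structure Gen (n : ℕ) where
  lev : ℕ
  le : n ≤ lev
  frob : ZMod n

variable {n : ℕ}

/-- The generator `t_n`. -/
def Gen.base (n : ℕ) : Gen n := ⟨n, le_rfl, 0⟩

/-- A numbering of the generators: first by `s`, and for given `s` by decreasing `j`. -/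
def Gen.enc (i : Gen n) : ℕ := i.lev * n - i.frob.val

variable [NeZero n]

theorem Gen.enc_injective : Function.Injective (Gen.enc : Gen n → ℕ) := by
  intro i i' h
  have h1 := ZMod.val_lt i.frob
  have h2 := ZMod.val_lt i'.frob
  have h3 : n ≤ i.lev := i.le
  have h4 : n ≤ i'.lev := i'.le
  have key : ∀ a b : Gen n, a.enc = b.enc → a.lev ≤ b.lev := by
    intro a b hab
    by_contra hlt
    have ha := ZMod.val_lt a.frob
    have hb := ZMod.val_lt b.frob
    have h5 : (b.lev + 1) * n ≤ a.lev * n := Nat.mul_le_mul_right n (by omega)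
    have h6 : 1 * n ≤ b.lev * n := Nat.mul_le_mul_right n (by have := b.le; omega)
    rw [add_mul, one_mul] at h5
    simp only [Gen.enc] at hab
    omega
  have h5 := le_antisymm (key i i' h) (key i' i h.symm)
  refine Gen.ext h5 (ZMod.val_injective n ?_)
  simp only [Gen.enc, h5] at h
  have h6 : 1 * n ≤ i'.lev * n := Nat.mul_le_mul_right n (by omega)
  omega

/-- The order of the generators by their numbers. -/
noncomputable instance : LinearOrder (Gen n) := LinearOrder.lift' Gen.enc Gen.enc_injective

theorem Gen.le_iff {i i' : Gen n} : i ≤ i' ↔ i.enc ≤ i'.enc := Iff.rfl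

theorem Gen.lt_iff {i i' : Gen n} : i < i' ↔ i.enc < i'.enc := Iff.rfl

instance : WellFoundedLT (Gen n) := ⟨InvImage.wf Gen.enc wellFounded_lt⟩

/-- The May weight of a generator. -/
def Gen.wt (i : Gen n) : ℕ := mayWeight n i.lev

/-- The generator whose boundary contains the square of `i`, see `genD_succ`. -/
def Gen.succ (i : Gen n) : Gen n :=
  ⟨i.lev + n, le_add_left le_rfl, if i.lev = n then i.frob else i.frob + 1⟩

/-- The inverse of the Frobenius on the generators. -/
def Gen.rot (i : Gen n) : Gen n := ⟨i.lev, i.le, i.frob - 1⟩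

theorem Gen.succ_injective : Function.Injective (Gen.succ : Gen n → Gen n) := by
  intro i i' h
  have h1 := congrArg Gen.lev h
  have h2 := congrArg Gen.frob h
  simp only [Gen.succ] at h1 h2
  have h3 : i.lev = i'.lev := by omega
  rw [h3] at h2
  refine Gen.ext h3 ?_
  split_ifs at h2
  · exact h2
  · exact add_right_cancel h2

theorem Gen.succ_ne (i : Gen n) : i.succ ≠ i := by
  intro h
  have h1 := congrArg Gen.lev h
  have := NeZero.pos n
  simp only [Gen.succ] at h1
  omega

theorem Gen.wt_succ (i : Gen n) : i.succ.wt = 2 * i.wt + 1 := mayWeight_add (NeZero.pos n) i.le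

theorem Gen.exists_succ_eq (b : Gen n) (h : 2 * n ≤ b.lev) : ∃ i : Gen n, i.succ = b := by
  by_cases h1 : b.lev = 2 * n
  · exact ⟨⟨n, le_rfl, b.frob⟩, Gen.ext (by simp [succ, h1]; ring) (by simp [succ])⟩
  · refine ⟨⟨b.lev - n, by omega, b.frob - 1⟩, Gen.ext (by simp [succ]; omega) ?_⟩
    simp only [succ]
    rw [if_neg (by omega), sub_add_cancel]

end Generators

/-! ### The first differential on the polynomial algebra -/

section Koszul

open MvPolynomial Finsupp

variable {n : ℕ} [NeZero n]

open Classical in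
/-- The differential of the generators on the first page of the May spectral sequence: the squares of
`i` and, if `i` has level `n`, of `i.rot` for the generator `i.succ`, and zero for generators that are
not successors. -/
noncomputable def genD (b : Gen n) : MvPolynomial (Gen n) (ZMod 2) :=
  if h : ∃ i : Gen n, i.succ = b then
    X h.choose ^ 2 + if h.choose.lev = n then X h.choose.rot ^ 2 else 0 else 0

theorem genD_succ (i : Gen n) :
    genD i.succ = X i ^ 2 + if i.lev = n then X i.rot ^ 2 else 0 := by
  have h : ∃ i' : Gen n, i'.succ = i.succ := ⟨i, rfl⟩
  rw [genD, dif_pos h, Gen.succ_injective h.choose_spec]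

theorem genD_of_lt {b : Gen n} (h : b.lev < 2 * n) : genD b = 0 := by
  rw [genD, dif_neg]
  rintro ⟨i, rfl⟩
  have := i.le
  simp only [Gen.succ] at h
  omega

/-- The first differential of the May spectral sequence: the derivation of the polynomial algebra on
the `h_{s,j}`. -/
noncomputable def polyD : Derivation (ZMod 2) (MvPolynomial (Gen n) (ZMod 2))
    (MvPolynomial (Gen n) (ZMod 2)) :=
  mkDerivation (ZMod 2) genD

theorem polyD_monomial (μ : Gen n →₀ ℕ) :
    polyD (monomial μ 1) = ∑ b ∈ μ.support, monomial (μ - single b 1) ((μ b : ℕ) : ZMod 2) * genD b := by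
  have := mkDerivation_monomial (R := ZMod 2) (A := MvPolynomial (Gen n) (ZMod 2)) genD μ 1
  rw [polyD, this, one_smul]
  rfl

/-- The exponents that occur in the boundary of a monomial: an odd exponent of `i.succ` is lowered,
and the square of `i` or of `i.rot` is multiplied on. -/
theorem exists_of_coeff_polyD {μ v : Gen n →₀ ℕ} (h : coeff v (polyD (monomial μ 1)) ≠ 0) :
    ∃ i : Gen n, Odd (μ i.succ) ∧ (v + single i.succ 1 = μ + single i 2 ∨
      (i.lev = n ∧ v + single i.succ 1 = μ + single i.rot 2)) := by
  rw [polyD_monomial, coeff_sum] at h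
  obtain ⟨b, hb, hne⟩ := Finset.exists_ne_zero_of_sum_ne_zero h
  have hodd : Odd (μ b) := by
    by_contra hn
    rw [Nat.not_odd_iff_even] at hn
    rw [(ZMod.natCast_eq_zero_iff_even).2 hn, map_zero, zero_mul, coeff_zero] at hne
    exact hne rfl
  have hsub : μ - single b 1 + single b 1 = μ := by
    refine tsub_add_cancel_of_le ?_
    rw [Finsupp.single_le_iff]
    exact Nat.one_le_iff_ne_zero.2 (Finsupp.mem_support_iff.1 hb)
  by_cases hs : ∃ i : Gen n, i.succ = b
  · obtain ⟨i, rfl⟩ := hs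
    refine ⟨i, hodd, ?_⟩
    rw [genD_succ, mul_add, coeff_add] at hne
    by_cases h1 : coeff v (monomial (μ - single i.succ 1) ((μ i.succ : ℕ) : ZMod 2) * X i ^ 2) = 0
    · rw [h1, zero_add] at hne
      split_ifs at hne with hl
      · rw [X_pow_eq_monomial, monomial_mul, coeff_monomial] at hne
        split_ifs at hne with he
        · refine Or.inr ⟨hl, ?_⟩
          rw [← he, add_right_comm, hsub]
        · exact absurd rfl hne
      · simp at hne
    · rw [X_pow_eq_monomial, monomial_mul, coeff_monomial] at h1
      split_ifs at h1 with he
      · refine Or.inl ?_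
        rw [← he, add_right_comm, hsub]
      · exact absurd rfl h1
  · rw [genD, dif_neg hs, mul_zero, coeff_zero] at hne
    exact absurd rfl hne

/-- The generators `i ≠ t_n` that occur in a monomial at least to the second power, or whose successor
occurs to an odd power. -/
def Active (μ : Gen n →₀ ℕ) (i : Gen n) : Prop :=
  i ≠ Gen.base n ∧ (2 ≤ μ i ∨ Odd (μ i.succ))

/-- The largest active generator. -/
def IsTop (μ : Gen n →₀ ℕ) (i : Gen n) : Prop :=
  Active μ i ∧ ∀ i', Active μ i' → i' ≤ i

theorem IsTop.unique {μ : Gen n →₀ ℕ} {i i' : Gen n} (h : IsTop μ i) (h' : IsTop μ i') : i = i' :=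
  le_antisymm (h'.2 _ h.1) (h.2 _ h'.1)

theorem exists_isTop {μ : Gen n →₀ ℕ} {i : Gen n} (h : Active μ i) : ∃ i, IsTop μ i := by
  have hfin : {i | Active μ i}.Finite := by
    refine ((Finset.finite_toSet μ.support).union
      ((Finset.finite_toSet μ.support).preimage Gen.succ_injective.injOn)).subset ?_
    rintro i ⟨-, h | h⟩
    · refine Or.inl (Finsupp.mem_support_iff.2 (by omega))
    · refine Or.inr (Finsupp.mem_support_iff.2 fun h0 => ?_)
      rw [h0] at h
      simp at h
  obtain ⟨i0, h0, hmax⟩ := hfin.exists_maximalFor id _ ⟨i, h⟩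
  exact ⟨i0, h0, fun i' hi' => (le_total i' i0).elim id fun hle => hmax hi' hle⟩

/-- The matching of monomials: for the largest active generator `i`, a factor `i.succ` of odd exponent
is replaced by the square of `i`. -/
def MonoMatch (i : Gen n) (μ v : Gen n →₀ ℕ) : Prop :=
  IsTop μ i ∧ Odd (μ i.succ) ∧ v + single i.succ 1 = μ + single i 2

theorem add_single_apply {μ v : Gen n →₀ ℕ} {i j : Gen n}
    (h : v + single i.succ 1 = μ + single j 2) (x : Gen n) :
    v x + (if i.succ = x then 1 else 0) = μ x + if j = x then 2 else 0 := by
  have := DFunLike.congr_fun h x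
  simpa [Finsupp.single_apply] using this

theorem MonoMatch.isTop {i : Gen n} {μ v : Gen n →₀ ℕ} (h : MonoMatch i μ v) :
    IsTop v i ∧ Even (v i.succ) := by
  obtain ⟨⟨h1, h2⟩, hodd, he⟩ := h
  have key := add_single_apply he
  have hi := key i
  rw [if_neg (Gen.succ_ne i), if_pos rfl] at hi
  have his := key i.succ
  rw [if_pos rfl, if_neg (Gen.succ_ne i).symm] at his
  refine ⟨⟨⟨h1.1, Or.inl (by omega)⟩, fun x hx => ?_⟩, ?_⟩
  · by_cases hxi : x = i
    · exact hxi.le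
    refine h2 x ⟨hx.1, ?_⟩
    rcases hx.2 with h | h
    · left
      have := key x
      rw [if_neg (Ne.symm hxi)] at this
      split_ifs at this with hs
      · omega
      · omega
    · right
      have := key x.succ
      rw [if_neg (fun h => hxi (Gen.succ_injective h).symm)] at this
      split_ifs at this
      · rw [Nat.odd_iff] at h ⊢; omega
      · rw [Nat.odd_iff] at h ⊢; omega
  · rw [Nat.even_iff]
    rw [Nat.odd_iff] at hodd
    omega

theorem exists_monoMatch_of_odd {i : Gen n} {μ : Gen n →₀ ℕ} (h : IsTop μ i)
    (ho : Odd (μ i.succ)) : ∃ v, MonoMatch i μ v := by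
  refine ⟨μ + single i 2 - single i.succ 1, h, ho, tsub_add_cancel_of_le ?_⟩
  rw [Finsupp.single_le_iff, Finsupp.add_apply]
  have := ho.pos
  omega

theorem exists_monoMatch_of_even {i : Gen n} {v : Gen n →₀ ℕ} (h : IsTop v i)
    (he : Even (v i.succ)) : ∃ μ, MonoMatch i μ v := by
  have h2 : 2 ≤ v i := h.1.2.resolve_right (Nat.not_odd_iff_even.2 he)
  have hle : single i 2 ≤ v + single i.succ 1 := by
    rw [Finsupp.single_le_iff, Finsupp.add_apply]
    omega
  have hE : v + single i.succ 1 - single i 2 + single i 2 = v + single i.succ 1 :=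
    tsub_add_cancel_of_le hle
  set μ := v + single i.succ 1 - single i 2 with hμ
  have key := add_single_apply hE.symm
  have his := key i.succ
  rw [if_pos rfl, if_neg (Gen.succ_ne i).symm] at his
  have ho : Odd (μ i.succ) := by
    rw [Nat.odd_iff]
    rw [Nat.even_iff] at he
    omega
  refine ⟨μ, ⟨⟨h.1.1, Or.inr ho⟩, fun x hx => ?_⟩, ho, hE.symm⟩
  by_cases hxi : x = i
  · exact hxi.le
  refine h.2 x ⟨hx.1, ?_⟩
  rcases hx.2 with h' | h'
  · left
    have := key x
    rw [if_neg (Ne.symm hxi)] at this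
    split_ifs at this with hs
    · subst hs
      rw [Nat.even_iff] at he
      omega
    · omega
  · right
    have := key x.succ
    rw [if_neg (fun h => hxi (Gen.succ_injective h).symm)] at this
    split_ifs at this
    · rw [Nat.odd_iff] at h' ⊢; omega
    · rw [Nat.odd_iff] at h' ⊢; omega

theorem MonoMatch.right_unique {i i' : Gen n} {μ v v' : Gen n →₀ ℕ} (h : MonoMatch i μ v)
    (h' : MonoMatch i' μ v') : v = v' := by
  obtain rfl := h.1.unique h'.1
  exact add_right_cancel (h.2.2.trans h'.2.2.symm)

theorem MonoMatch.left_unique {i i' : Gen n} {μ μ' v : Gen n →₀ ℕ} (h : MonoMatch i μ v)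
    (h' : MonoMatch i' μ' v) : μ = μ' := by
  obtain rfl := h.isTop.1.unique h'.isTop.1
  exact add_right_cancel (h.2.2.symm.trans h'.2.2)

theorem MonoMatch.coeff_eq {i : Gen n} {μ v : Gen n →₀ ℕ} (h : MonoMatch i μ v) :
    coeff v (polyD (monomial μ 1)) = 1 := by
  obtain ⟨htop, hodd, he⟩ := h
  have hmem : i.succ ∈ μ.support := Finsupp.mem_support_iff.2 hodd.pos.ne'
  have hsub : ∀ b ∈ μ.support, μ - single b 1 + single b 1 = μ := fun b hb => by
    refine tsub_add_cancel_of_le ?_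
    rw [Finsupp.single_le_iff]
    exact Nat.one_le_iff_ne_zero.2 (Finsupp.mem_support_iff.1 hb)
  have hv := add_single_apply he i.succ
  rw [if_pos rfl, if_neg (Gen.succ_ne i).symm] at hv
  -- a term with the same exponents lowers the same generator
  have hb : ∀ (b x : Gen n), b ∈ μ.support → Odd (μ b) → μ - single b 1 + single x 2 = v →
      b = i.succ := by
    intro b x hb ho hbv
    by_contra hne
    have h1 : v + single b 1 = μ + single x 2 := by
      rw [← hbv, add_right_comm, hsub b hb]
    have h2 := DFunLike.congr_fun h1 i.succ
    simp only [Finsupp.add_apply, Finsupp.single_apply, if_neg hne] at h2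
    rw [Nat.odd_iff] at hodd
    split_ifs at h2 <;> omega
  rw [polyD_monomial, coeff_sum, Finset.sum_eq_single i.succ]
  · have hc : ((μ i.succ : ℕ) : ZMod 2) = 1 := (ZMod.natCast_eq_one_iff_odd).2 hodd
    rw [genD_succ, mul_add, coeff_add, hc, X_pow_eq_monomial, monomial_mul, coeff_monomial, if_pos]
    · rw [one_mul, add_eq_left]
      split_ifs with hl
      · rw [X_pow_eq_monomial, monomial_mul, coeff_monomial, if_neg]
        intro h1
        have h2 : v + single i.succ 1 = μ + single i.rot 2 := by
          rw [← h1, add_right_comm, hsub _ hmem]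
        rw [he] at h2
        have h3 := Finsupp.single_left_injective (two_ne_zero) (add_left_cancel h2)
        have h4 : i.frob = i.frob - 1 := congrArg Gen.frob h3
        have h5 : (1 : ZMod n) = 0 := by rw [eq_sub_iff_add_eq, add_eq_left] at h4; exact h4
        refine htop.1.1 (Gen.ext hl ?_)
        change i.frob = 0
        rw [← mul_one i.frob, h5, mul_zero]
      · rw [mul_zero, coeff_zero]
    · exact add_right_cancel ((by rw [add_right_comm, hsub _ hmem] :
        μ - single i.succ 1 + single i 2 + single i.succ 1 = μ + single i 2).trans he.symm)
  · intro b hbm hne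
    by_cases ho : Odd (μ b)
    · by_cases hs : ∃ x : Gen n, x.succ = b
      · obtain ⟨x, rfl⟩ := hs
        rw [genD_succ, mul_add, coeff_add, X_pow_eq_monomial, monomial_mul, coeff_monomial,
          if_neg (fun h => hne (hb _ _ hbm ho h)), zero_add]
        split_ifs
        · rw [X_pow_eq_monomial, monomial_mul, coeff_monomial,
            if_neg (fun h => hne (hb _ _ hbm ho h))]
        · rw [mul_zero, coeff_zero]
      · rw [genD, dif_neg hs, mul_zero, coeff_zero]
    · rw [Nat.not_odd_iff_even] at ho
      rw [(ZMod.natCast_eq_zero_iff_even).2 ho, map_zero, zero_mul, coeff_zero]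
  · exact fun h => absurd hmem h

/-- The moment of the exponents of the `t_n^(2^j)`. It orders the monomials: the second term of the
differential of `t_{2n}^(2^j)` has the smaller moment. -/
def moment (μ : Gen n →₀ ℕ) : ℕ := ∑ j : ZMod n, j.val * μ ⟨n, le_rfl, j⟩

theorem moment_add_single (μ : Gen n →₀ ℕ) (i : Gen n) (k : ℕ) :
    moment (μ + single i k) = moment μ + if i.lev = n then k * i.frob.val else 0 := by
  simp only [moment, Finsupp.add_apply, mul_add, Finset.sum_add_distrib]
  congr 1
  split_ifs with h
  · rw [Finset.sum_eq_single i.frob]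
    · have h1 : i = ⟨n, le_rfl, i.frob⟩ := Gen.ext h rfl
      rw [Finsupp.single_apply, if_pos h1, mul_comm]
    · intro j _ hj
      rw [Finsupp.single_apply, if_neg, mul_zero]
      rintro rfl
      exact hj rfl
    · simp
  · refine Finset.sum_eq_zero fun j _ => ?_
    rw [Finsupp.single_apply, if_neg, mul_zero]
    rintro rfl
    exact h rfl

/-- Acyclicity: the targets in the boundary of a source precede its own target. -/
theorem MonoMatch.lower {i i' : Gen n} {μ v v' μ' : Gen n →₀ ℕ} (h : MonoMatch i μ v)
    (hv : coeff v' (polyD (monomial μ 1)) ≠ 0) (h' : MonoMatch i' μ' v') :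
    v' = v ∨ moment v' < moment v := by
  obtain ⟨x, hodd, hx⟩ := exists_of_coeff_polyD hv
  obtain ⟨htop, ho, he⟩ := h
  -- if `i` stays the largest active generator, with odd exponent of its successor, then the
  -- monomial is not a target
  have hcontra : Odd (v' i.succ) → (∀ y, Active v' y → y ≤ i) → False := by
    intro h1 h2
    have h3 : IsTop v' i := ⟨⟨htop.1.1, Or.inr h1⟩, h2⟩
    have h4 := h'.isTop
    rw [h4.1.unique h3] at h4
    exact Nat.not_odd_iff_even.2 h4.2 h1
  have hact : ∀ y : Gen n, v' + single x.succ 1 = μ + single y 2 →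
      ∀ z, Active v' z → Active μ z ∨ z = y := by
    intro y hy z hz
    have key := add_single_apply hy
    by_cases hzy : z = y
    · exact Or.inr hzy
    refine Or.inl ⟨hz.1, ?_⟩
    rcases hz.2 with h1 | h1
    · left
      have := key z
      rw [if_neg (Ne.symm hzy)] at this
      omega
    · right
      have := key z.succ
      by_cases hxz : x = z
      · exact hxz ▸ hodd
      rw [if_neg (fun h => hxz (Gen.succ_injective h))] at this
      rw [Nat.odd_iff] at h1 ⊢
      split_ifs at this <;> omega
  have hpar : ∀ y : Gen n, v' + single x.succ 1 = μ + single y 2 → x ≠ i → Odd (v' i.succ) := by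
    intro y hy hne
    have := add_single_apply hy i.succ
    rw [if_neg (fun h => hne (Gen.succ_injective h))] at this
    rw [Nat.odd_iff] at ho ⊢
    split_ifs at this <;> omega
  have hxact : x = Gen.base n ∨ x ≤ i :=
    or_iff_not_imp_left.2 fun h => htop.2 x ⟨h, Or.inr hodd⟩
  have hmin : ∀ y : Gen n, n * n ≤ y.enc + (n - 1) := by
    intro y
    have h1 := ZMod.val_lt y.frob
    have h2 : n * n ≤ y.lev * n := Nat.mul_le_mul_right n y.le
    rw [Gen.enc]
    omega
  rcases hx with hx | ⟨hl, hx⟩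
  · by_cases hxi : x = i
    · subst hxi
      exact Or.inl (add_right_cancel (hx.trans he.symm))
    · exfalso
      refine hcontra (hpar _ hx hxi) fun y hy => ?_
      rcases hact _ hx y hy with h1 | rfl
      · exact htop.2 y h1
      · exact hxact.resolve_left hy.1
  · by_cases hxi : x = i
    · subst hxi
      right
      have hx0 : x.frob ≠ 0 := fun h0 => htop.1.1 (Gen.ext hl h0)
      have h1 := congrArg moment hx
      have h2 := congrArg moment he
      rw [moment_add_single, moment_add_single] at h1 h2
      have h3 : x.rot.lev = n := hl
      have h4 : x.rot.frob.val + 1 = x.frob.val := by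
        have h5 : (1 : ℕ) ≤ x.frob.val :=
          Nat.one_le_iff_ne_zero.2 fun h => hx0 ((ZMod.val_eq_zero _).1 h)
        have h6 : x.rot.frob = ((x.frob.val - 1 : ℕ) : ZMod n) := by
          rw [Nat.cast_sub h5, ZMod.natCast_val, ZMod.cast_id]
          simp [Gen.rot]
        rw [h6, ZMod.val_natCast, Nat.mod_eq_of_lt (by have := ZMod.val_lt x.frob; omega)]
        omega
      rw [if_pos h3] at h1
      rw [if_pos hl] at h2
      split_ifs at h1 h2 <;> omega
    · exfalso
      refine hcontra (hpar _ hx hxi) fun y hy => ?_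
      rcases hact _ hx y hy with h1 | rfl
      · exact htop.2 y h1
      · rw [Gen.le_iff]
        have hrl : x.rot.lev = n := hl
        by_cases hb : x = Gen.base n
        · -- the inverse Frobenius of `t_n` is the smallest generator
          have h1 := hmin i
          have h2 : x.rot.frob.val = n - 1 := by
            have h3 : x.rot.frob = ((n - 1 : ℕ) : ZMod n) := by
              rw [Nat.cast_sub (NeZero.pos n), hb]
              simp [Gen.rot, Gen.base]
            rw [h3, ZMod.val_natCast, Nat.mod_eq_of_lt (by have := NeZero.pos n; omega)]
          rw [Gen.enc, hrl, h2]
          omega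
        · have hlt : x < i := lt_of_le_of_ne (hxact.resolve_left hb) hxi
          rw [Gen.lt_iff] at hlt
          have h5 : (1 : ℕ) ≤ x.frob.val := by
            exact Nat.one_le_iff_ne_zero.2 fun h => hb (Gen.ext hl ((ZMod.val_eq_zero _).1 h))
          have h6 : x.rot.frob = ((x.frob.val - 1 : ℕ) : ZMod n) := by
            rw [Nat.cast_sub h5, ZMod.natCast_val, ZMod.cast_id]
            simp [Gen.rot]
          have h7 : x.rot.frob.val = x.frob.val - 1 := by
            rw [h6, ZMod.val_natCast, Nat.mod_eq_of_lt (by have := ZMod.val_lt x.frob; omega)]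
          have h8 : x.enc = n * n - x.frob.val := by rw [Gen.enc, hl]
          rw [Gen.enc, hrl, h7]
          have h9 := ZMod.val_lt x.frob
          have h10 : n ≤ n * n := Nat.le_mul_self n
          omega

/-- The weight of a monomial. -/
noncomputable def monoWt (μ : Gen n →₀ ℕ) : ℕ := μ.sum fun i k => k * i.wt

theorem monoWt_add (μ v : Gen n →₀ ℕ) : monoWt (μ + v) = monoWt μ + monoWt v :=
  Finsupp.sum_add_index' (by simp) (by intros; ring)

theorem monoWt_single (i : Gen n) (k : ℕ) : monoWt (single i k) = k * i.wt :=
  Finsupp.sum_single_index (by simp)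

/-- The differential lowers the weight by one. -/
theorem monoWt_of_coeff_polyD {μ v : Gen n →₀ ℕ} (h : coeff v (polyD (monomial μ 1)) ≠ 0) :
    monoWt μ = monoWt v + 1 := by
  obtain ⟨i, -, hi | ⟨-, hi⟩⟩ := exists_of_coeff_polyD h
  · have := congrArg monoWt hi
    rw [monoWt_add, monoWt_add, monoWt_single, monoWt_single, Gen.wt_succ] at this
    omega
  · have := congrArg monoWt hi
    rw [monoWt_add, monoWt_add, monoWt_single, monoWt_single, Gen.wt_succ,
      show i.rot.wt = i.wt from rfl] at this
    omega

/-- The matching of the monomials for the differential `polyD`. -/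
noncomputable def monoMatching : Matching (basisMonomials (Gen n) (ZMod 2))
    (polyD (n := n)).toLinearMap where
  src := {u | ∃ v i, MonoMatch i u v}
  tgt := {v | ∃ u i, MonoMatch i u v}
  toFun u := by classical exact if h : ∃ v i, MonoMatch i u v then h.choose else u
  rel v v' := moment v < moment v'
  wf := InvImage.wf _ wellFounded_lt
  trans := lt_trans
  mapsTo := by
    rintro u h
    have h' : ∃ v i, MonoMatch i u v := h
    rw [dif_pos h']
    exact ⟨u, h'.choose_spec⟩
  injOn := by
    intro u hu u' hu' he
    have hu1 : ∃ v i, MonoMatch i u v := hu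
    have hu1' : ∃ v i, MonoMatch i u' v := hu'
    simp only [dif_pos hu1, dif_pos hu1'] at he
    obtain ⟨i, h⟩ := hu1.choose_spec
    obtain ⟨i', h'⟩ := hu1'.choose_spec
    exact h.left_unique (he ▸ h')
  surjOn := by
    rintro v ⟨u, i, h⟩
    have h' : ∃ v i, MonoMatch i u v := ⟨v, i, h⟩
    refine ⟨u, h', ?_⟩
    rw [dif_pos h']
    exact h'.choose_spec.choose_spec.right_unique h
  lead := by
    intro u hu
    have hu1 : ∃ v i, MonoMatch i u v := hu
    rw [dif_pos hu1]
    exact hu1.choose_spec.choose_spec.coeff_eq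
  lower := by
    rintro u hu v ⟨u', i', h'⟩ hne
    have hu1 : ∃ v i, MonoMatch i u v := hu
    rw [dif_pos hu1]
    exact hu1.choose_spec.choose_spec.lower hne h'

/-- The critical monomials, which have no active generator. They are the square-free monomials in the
`h_{s,j}` (`n ≤ s < 2n`) and `h_{2n,0}`, times powers of `h_{n,0}`. -/
def MonoCrit (μ : Gen n →₀ ℕ) : Prop := ∀ i, ¬ Active μ i

theorem mono_cases (μ : Gen n →₀ ℕ) :
    MonoCrit μ ∨ μ ∈ (monoMatching (n := n)).src ∨ μ ∈ (monoMatching (n := n)).tgt := by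
  by_cases h : MonoCrit μ
  · exact Or.inl h
  · right
    simp only [MonoCrit, not_forall, not_not] at h
    obtain ⟨i, h⟩ := h
    obtain ⟨i, h⟩ := exists_isTop h
    rcases Nat.even_or_odd (μ i.succ) with he | ho
    · obtain ⟨u, hu⟩ := exists_monoMatch_of_even h he
      exact Or.inr ⟨u, i, hu⟩
    · obtain ⟨v, hv⟩ := exists_monoMatch_of_odd h ho
      exact Or.inl ⟨v, i, hv⟩

theorem MonoCrit.notMem_src {μ : Gen n →₀ ℕ} (h : MonoCrit μ) : μ ∉ (monoMatching (n := n)).src := by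
  rintro ⟨v, i, hi⟩
  exact h i hi.1.1

theorem MonoCrit.notMem_tgt {μ : Gen n →₀ ℕ} (h : MonoCrit μ) : μ ∉ (monoMatching (n := n)).tgt := by
  rintro ⟨v, i, hi⟩
  exact h i hi.isTop.1.1

theorem notMem_tgt_of_mem_src {μ : Gen n →₀ ℕ} (h : μ ∈ (monoMatching (n := n)).src) :
    μ ∉ (monoMatching (n := n)).tgt := by
  obtain ⟨v, i, hi⟩ := h
  rintro ⟨v', i', hi'⟩
  have h1 := hi'.isTop
  rw [h1.1.unique hi.1] at h1
  exact Nat.not_odd_iff_even.2 h1.2 hi.2.1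

variable (n) in
/-- The polynomial `∑ⱼ h_{2n,j}` that represents `ρ_{2n}`. -/
noncomputable def rhoPoly : MvPolynomial (Gen n) (ZMod 2) :=
  ∑ j : ZMod n, X (Gen.succ ⟨n, le_rfl, j⟩)

theorem polyD_X (i : Gen n) : polyD (X i) = genD i := mkDerivation_X _ _ _

theorem polyD_rhoPoly : polyD (rhoPoly n) = 0 := by
  have h : ∀ j : ZMod n, polyD (X (Gen.succ ⟨n, le_rfl, j⟩)) =
      (X ⟨n, le_rfl, j⟩ ^ 2 + X ⟨n, le_rfl, j - 1⟩ ^ 2 : MvPolynomial (Gen n) (ZMod 2)) := by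
    intro j
    rw [polyD_X, genD_succ, if_pos rfl]
    rfl
  have h2 := (Equiv.subRight (1 : ZMod n)).sum_comp fun j =>
    (X ⟨n, le_rfl, j⟩ ^ 2 : MvPolynomial (Gen n) (ZMod 2))
  simp only [Equiv.subRight_apply] at h2
  rw [rhoPoly, map_sum, Finset.sum_congr rfl fun j _ => h j, Finset.sum_add_distrib, h2,
    CharTwo.add_self_eq_zero]

/-- The cocycle whose leading monomial is the critical monomial `μ`: the generator
`h_{2n,0}` is replaced by `ρ_{2n}`. -/
noncomputable def critPoly (μ : Gen n →₀ ℕ) : MvPolynomial (Gen n) (ZMod 2) :=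
  monomial (μ.erase (Gen.base n).succ) 1 * rhoPoly n ^ μ (Gen.base n).succ

theorem MonoCrit.le_one {μ : Gen n →₀ ℕ} (h : MonoCrit μ) {i : Gen n} (hi : i ≠ Gen.base n) :
    μ i ≤ 1 := by
  by_contra h1
  exact h i ⟨hi, Or.inl (by omega)⟩

theorem MonoCrit.eq_zero {μ : Gen n →₀ ℕ} (h : MonoCrit μ) {i : Gen n} (hi : i ≠ Gen.base n) :
    μ i.succ = 0 := by
  have h1 : i.succ ≠ Gen.base n := by
    intro h
    have h2 := congrArg Gen.lev h
    have h3 := i.le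
    have := NeZero.pos n
    simp only [Gen.succ, Gen.base] at h2
    omega
  have h2 := h.le_one h1
  have h3 : ¬ Odd (μ i.succ) := fun ho => h i ⟨hi, Or.inr ho⟩
  rw [Nat.odd_iff] at h3
  omega

theorem MonoCrit.critPoly_sub_mem {μ : Gen n →₀ ℕ} (h : MonoCrit μ) :
    critPoly μ - monomial μ 1 ∈
      Submodule.span (ZMod 2) (basisMonomials (Gen n) (ZMod 2) '' (monoMatching (n := n)).src) := by
  set b := (Gen.base n).succ with hb
  have hbb : b ≠ Gen.base n := Gen.succ_ne _
  have h1 := h.le_one hbb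
  rcases Nat.le_one_iff_eq_zero_or_eq_one.1 h1 with h0 | h0
  · have he : μ.erase b = μ := by
      rw [Finsupp.erase_of_notMem_support]
      simpa using h0
    rw [critPoly, ← hb, h0, he, pow_zero, mul_one, sub_self]
    exact Submodule.zero_mem _
  · have hμ : μ.erase b + single b 1 = μ := by
      rw [← h0]
      exact Finsupp.erase_add_single b μ
    have he : critPoly μ - monomial μ 1 = ∑ j ∈ Finset.univ.erase (0 : ZMod n),
        monomial (μ.erase b + single (Gen.succ ⟨n, le_rfl, j⟩) 1) 1 := by
      rw [critPoly, ← hb, h0, pow_one, rhoPoly, Finset.mul_sum,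
        ← Finset.add_sum_erase _ _ (Finset.mem_univ (0 : ZMod n))]
      have h3 : (monomial (μ.erase b) 1 * X (Gen.succ ⟨n, le_rfl, 0⟩) :
          MvPolynomial (Gen n) (ZMod 2)) = monomial μ 1 := by
        rw [X, monomial_mul, mul_one]
        exact congrArg (fun v => monomial v 1) hμ
      rw [h3, add_sub_cancel_left]
      refine Finset.sum_congr rfl fun j _ => ?_
      rw [X, monomial_mul, mul_one]
    rw [he]
    refine Submodule.sum_mem _ fun j hj => Submodule.subset_span ?_
    have hj0 : (⟨n, le_rfl, j⟩ : Gen n) ≠ Gen.base n :=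
      fun h => Finset.ne_of_mem_erase hj (congrArg Gen.frob h)
    set g : Gen n := ⟨n, le_rfl, j⟩ with hg
    have hgb : g.succ ≠ b := fun h => hj0 (Gen.succ_injective h)
    have hodd : Odd ((μ.erase b + single g.succ 1 : Gen n →₀ ℕ) g.succ) := by
      rw [Finsupp.add_apply, Finsupp.erase_ne hgb, h.eq_zero hj0, Finsupp.single_eq_same]
      exact odd_one
    have htop : IsTop (μ.erase b + single g.succ 1) g := by
      refine ⟨⟨hj0, Or.inr hodd⟩, fun x hx => ?_⟩
      by_contra hne
      have hxg : x ≠ g := fun h => hne h.le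
      refine hne (False.elim ?_)
      rcases hx.2 with h4 | h4
      · have h5 := h.le_one hx.1
        rw [Finsupp.add_apply, Finsupp.single_apply, Finsupp.erase_apply] at h4
        split_ifs at h4 with h6 h7 h7
        · omega
        · omega
        · subst h7
          have := h.eq_zero hj0
          omega
        · omega
      · rw [Finsupp.add_apply, Finsupp.single_apply,
          if_neg (fun h => hxg (Gen.succ_injective h).symm), Finsupp.erase_apply, h.eq_zero hx.1] at h4
        simp at h4
    obtain ⟨v, hv⟩ := exists_monoMatch_of_odd htop hodd
    exact ⟨_, ⟨v, g, hv⟩, rfl⟩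

/-- A polynomial without targets is a combination of the critical cocycles, up to sources. -/
theorem span_compl_tgt_eq (x : MvPolynomial (Gen n) (ZMod 2))
    (h : ∀ v ∈ (monoMatching (n := n)).tgt, (basisMonomials (Gen n) (ZMod 2)).repr x v = 0) :
    ∃ c : (Gen n →₀ ℕ) →₀ ZMod 2,
      (∀ μ ∈ c.support, MonoCrit μ ∧ μ ∈ ((basisMonomials (Gen n) (ZMod 2)).repr x).support) ∧
      x - Finsupp.linearCombination (ZMod 2) critPoly c ∈
        Submodule.span (ZMod 2) (basisMonomials (Gen n) (ZMod 2) '' (monoMatching (n := n)).src) := by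
  classical
  set b := basisMonomials (Gen n) (ZMod 2)
  let c := (b.repr x).filter MonoCrit
  have hc : ∀ μ ∈ c.support, MonoCrit μ ∧ μ ∈ (b.repr x).support := by
    intro μ hμ
    rw [Finsupp.support_filter, Finset.mem_filter] at hμ
    exact hμ.symm
  refine ⟨c, hc, ?_⟩
  have e : x - Finsupp.linearCombination (ZMod 2) critPoly c =
      (x - Finsupp.linearCombination (ZMod 2) b c) -
        ∑ μ ∈ c.support, c μ • (critPoly μ - monomial μ 1) := by
    simp only [smul_sub, Finset.sum_sub_distrib]
    rw [Finsupp.linearCombination_apply, Finsupp.linearCombination_apply, Finsupp.sum, Finsupp.sum]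
    simp only [b, coe_basisMonomials]
    abel
  rw [e]
  refine Submodule.sub_mem _ ?_
    (Submodule.sum_mem _ fun μ hμ => Submodule.smul_mem _ _ (hc μ hμ).1.critPoly_sub_mem)
  rw [Module.Basis.mem_span_image]
  intro μ hμ
  rw [Finset.mem_coe, Finsupp.mem_support_iff, map_sub, Module.Basis.repr_linearCombination,
    Finsupp.sub_apply] at hμ
  rcases mono_cases μ with h1 | h1 | h1
  · exfalso
    rw [Finsupp.filter_apply_pos _ _ h1, sub_self] at hμ
    exact hμ rfl
  · exact h1
  · exfalso
    rw [Finsupp.filter_apply_neg _ _ (fun h' => h'.notMem_tgt h1), sub_zero] at hμ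
    exact hμ (h μ h1)

theorem polyD_critPoly {μ : Gen n →₀ ℕ} (h : MonoCrit μ) : polyD (critPoly μ) = 0 := by
  have h1 : polyD (rhoPoly n ^ μ (Gen.base n).succ) = 0 := by
    rw [Derivation.leibniz_pow, polyD_rhoPoly, smul_zero, smul_zero]
  rw [critPoly, Derivation.leibniz, h1, smul_zero, zero_add, polyD_monomial,
    Finset.sum_eq_zero, smul_zero]
  intro b hb
  have h2 : b ≠ (Gen.base n).succ ∧ μ b ≠ 0 := by
    rw [Finsupp.support_erase, Finset.mem_erase, Finsupp.mem_support_iff] at hb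
    exact hb
  by_cases hs : ∃ i : Gen n, i.succ = b
  · obtain ⟨i, rfl⟩ := hs
    exact absurd (h.eq_zero fun h => h2.1 (h ▸ rfl)) h2.2
  · rw [genD, dif_neg hs, mul_zero]

theorem polyD_linearCombination {c : (Gen n →₀ ℕ) →₀ ZMod 2} (hc : ∀ μ ∈ c.support, MonoCrit μ) :
    polyD (Finsupp.linearCombination (ZMod 2) critPoly c) = 0 := by
  rw [Finsupp.linearCombination_apply, Finsupp.sum, map_sum]
  refine Finset.sum_eq_zero fun μ hμ => ?_
  rw [Derivation.map_smul, polyD_critPoly (hc μ hμ), smul_zero]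

theorem polyD_polyD (x : MvPolynomial (Gen n) (ZMod 2)) : polyD (polyD x) = 0 := by
  have h0 : ∀ y : MvPolynomial (Gen n) (ZMod 2), polyD (y ^ 2) = 0 := by
    intro y
    rw [Derivation.leibniz_pow, ← Nat.cast_smul_eq_nsmul (ZMod 2),
      show ((2 : ℕ) : ZMod 2) = 0 from rfl, zero_smul]
  have hg : ∀ b : Gen n, polyD (genD b) = 0 := by
    intro b
    rw [genD]
    split_ifs <;> simp [h0]
  induction x using MvPolynomial.induction_on with
  | C a => simp [polyD]
  | add p q hp hq => rw [map_add, map_add, hp, hq, add_zero]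
  | mul_X p i hp =>
    rw [Derivation.leibniz, map_add, smul_eq_mul, smul_eq_mul, Derivation.leibniz,
      Derivation.leibniz, hp, polyD_X, hg, smul_zero, smul_zero, zero_add, zero_add]
    rw [smul_eq_mul, smul_eq_mul, mul_comm, CharTwo.add_self_eq_zero]

/-- The cohomology of the first page is spanned by the products of the classes `h_{s,j}`
(`n ≤ s < 2n`) and `ρ_{2n}`. -/
theorem exists_polyD_eq (S : Set ℕ) (x : MvPolynomial (Gen n) (ZMod 2)) (hx : polyD x = 0)
    (hS : ∀ μ ∈ x.support, monoWt μ ∈ S) :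
    ∃ (c : (Gen n →₀ ℕ) →₀ ZMod 2) (z : MvPolynomial (Gen n) (ZMod 2)),
      (∀ μ ∈ c.support, MonoCrit μ ∧ monoWt μ ∈ S) ∧
      (∀ μ ∈ z.support, ∃ M ∈ S, monoWt μ = M + 1) ∧
      x = Finsupp.linearCombination (ZMod 2) critPoly c + polyD z := by
  set b := basisMonomials (Gen n) (ZMod 2) with hb
  obtain ⟨z, hz, h⟩ := (monoMatching (n := n)).exists_sub monoWt (· + 1)
    (fun u v h => monoWt_of_coeff_polyD h) S x (by
      rw [Module.Basis.mem_span_image]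
      exact fun μ hμ => hS μ hμ)
  obtain ⟨c, hc, hm⟩ := span_compl_tgt_eq (x - polyD z) h
  rw [Module.Basis.mem_span_image] at hz
  have hzero := (monoMatching (n := n)).eq_zero _ hm (by
    intro v _
    change (basisMonomials (Gen n) (ZMod 2)).repr (polyD _) v = 0
    rw [map_sub polyD, map_sub polyD, hx, polyD_polyD,
      polyD_linearCombination fun μ hμ => (hc μ hμ).1]
    simp)
  refine ⟨c, z, fun μ hμ => ⟨(hc μ hμ).1, ?_⟩, fun μ hμ => ?_, ?_⟩
  · have h1 := (hc μ hμ).2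
    rw [Finsupp.mem_support_iff, map_sub, Finsupp.sub_apply] at h1
    by_cases h2 : (basisMonomials (Gen n) (ZMod 2)).repr x μ = 0
    · rw [h2, zero_sub, neg_ne_zero] at h1
      change coeff μ (polyD z) ≠ 0 at h1
      -- a monomial in the boundary of `z` has the weight of a monomial in `z`, lowered by one
      rw [← b.linearCombination_repr z, Finsupp.linearCombination_apply, Finsupp.sum, map_sum,
        coeff_sum] at h1
      obtain ⟨v, hv, hne⟩ := Finset.exists_ne_zero_of_sum_ne_zero h1
      rw [Derivation.map_smul, coeff_smul] at hne
      have h3 := monoWt_of_coeff_polyD (right_ne_zero_of_smul hne)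
      obtain ⟨M, hM, hM'⟩ := (hz hv).2
      have h4 : M + 1 = monoWt v := hM'
      have h5 : M = monoWt μ := by omega
      exact h5 ▸ hM
    · exact hS μ (Finsupp.mem_support_iff.2 h2)
  · obtain ⟨M, hM, hM'⟩ := (hz hμ).2
    exact ⟨M, hM, hM'.symm⟩
  · rw [sub_sub, sub_eq_zero] at hzero
    rw [hzero, add_comm]

/-- The products of the classes `h_{s,j}` (`n ≤ s < 2n`) and `ρ_{2n}` are linearly independent in the
cohomology of the first page. -/
theorem eq_zero_of_eq_polyD (c : (Gen n →₀ ℕ) →₀ ZMod 2) (hc : ∀ μ ∈ c.support, MonoCrit μ)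
    (z : MvPolynomial (Gen n) (ZMod 2))
    (h : Finsupp.linearCombination (ZMod 2) critPoly c = polyD z) : c = 0 := by
  set b := basisMonomials (Gen n) (ZMod 2) with hb
  have hlin : ∀ c : (Gen n →₀ ℕ) →₀ ZMod 2, (∀ μ ∈ c.support, MonoCrit μ) →
      Finsupp.linearCombination (ZMod 2) critPoly c - Finsupp.linearCombination (ZMod 2) b c ∈
        Submodule.span (ZMod 2) (b '' (monoMatching (n := n)).src) := by
    intro c hc
    rw [Finsupp.linearCombination_apply, Finsupp.linearCombination_apply, Finsupp.sum, Finsupp.sum,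
      ← Finset.sum_sub_distrib]
    refine Submodule.sum_mem _ fun μ hμ => ?_
    rw [← smul_sub]
    exact Submodule.smul_mem _ _ (hc μ hμ).critPoly_sub_mem
  have hcm := hlin c hc
  rw [Module.Basis.mem_span_image] at hcm
  obtain ⟨y, hy, h1⟩ := (monoMatching (n := n)).exists_sub monoWt (· + 1)
    (fun u v h => monoWt_of_coeff_polyD h) Set.univ z (by
      rw [Module.Basis.mem_span_image]
      exact fun _ _ => trivial)
  obtain ⟨c', hc', hm⟩ := span_compl_tgt_eq (z - polyD y) h1
  have hdz : polyD (z - polyD y - Finsupp.linearCombination (ZMod 2) critPoly c') = polyD z := by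
    rw [map_sub, map_sub, polyD_polyD, polyD_linearCombination fun μ hμ => (hc' μ hμ).1, sub_zero,
      sub_zero]
  have hzero := (monoMatching (n := n)).eq_zero _ hm (by
    intro v hv
    change b.repr (polyD _) v = 0
    rw [hdz, ← h]
    have h3 : b.repr (Finsupp.linearCombination (ZMod 2) critPoly c -
        Finsupp.linearCombination (ZMod 2) b c) v = 0 := by
      by_contra h0
      exact notMem_tgt_of_mem_src (hcm (Finsupp.mem_support_iff.2 h0)) hv
    rw [map_sub, Finsupp.sub_apply, Module.Basis.repr_linearCombination, sub_eq_zero] at h3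
    rw [h3]
    by_contra h0
    exact (hc v (Finsupp.mem_support_iff.2 h0)).notMem_tgt hv)
  rw [hzero, map_zero] at hdz
  rw [h, ← hdz, zero_sub, map_neg, Module.Basis.repr_linearCombination] at hcm
  refine Finsupp.support_eq_empty.1 (Finset.eq_empty_of_forall_notMem fun μ hμ => ?_)
  exact (hc μ hμ).notMem_src (hcm (by rwa [Finsupp.support_neg, Finset.mem_coe]))

end Koszul

/-! ### Binary digit sums -/

section DigitSum

/-- The number of ones in the binary expansion. -/
def digitSum (k : ℕ) : ℕ := (Nat.digits 2 k).sum

theorem digitSum_zero : digitSum 0 = 0 := by simp [digitSum]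

theorem digitSum_two_mul (k : ℕ) : digitSum (2 * k) = digitSum k := by
  rcases Nat.eq_zero_or_pos k with rfl | hk
  · simp [digitSum]
  · rw [digitSum, Nat.digits_def' (by norm_num) (by omega)]
    simp [digitSum]

theorem digitSum_two_mul_add_one (k : ℕ) : digitSum (2 * k + 1) = digitSum k + 1 := by
  rw [digitSum, Nat.digits_def' (by norm_num) (by omega)]
  have h1 : (2 * k + 1) % 2 = 1 := by omega
  have h2 : (2 * k + 1) / 2 = k := by omega
  rw [h1, h2, List.sum_cons, digitSum, add_comm]

theorem digitSum_add_le (a b : ℕ) : digitSum (a + b) ≤ digitSum a + digitSum b := by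
  induction h : a + b using Nat.strong_induction_on generalizing a b with
  | _ m ih =>
  subst h
  obtain ⟨a', ha | ha⟩ := Nat.even_or_odd' a <;> obtain ⟨b', hb | hb⟩ := Nat.even_or_odd' b <;>
    subst ha hb
  · rcases Nat.eq_zero_or_pos (a' + b') with h0 | h0
    · obtain ⟨rfl, rfl⟩ : a' = 0 ∧ b' = 0 := by omega
      simp [digitSum]
    rw [← mul_add, digitSum_two_mul, digitSum_two_mul, digitSum_two_mul]
    exact ih _ (by omega) a' b' rfl
  · rw [← add_assoc, ← mul_add, digitSum_two_mul, digitSum_two_mul_add_one,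
      digitSum_two_mul_add_one]
    have := ih _ (by omega) a' b' rfl
    omega
  · rw [show 2 * a' + 1 + 2 * b' = 2 * (a' + b') + 1 by ring, digitSum_two_mul,
      digitSum_two_mul_add_one, digitSum_two_mul_add_one]
    have := ih _ (by omega) a' b' rfl
    omega
  · rw [show 2 * a' + 1 + (2 * b' + 1) = 2 * (a' + b' + 1) by ring, digitSum_two_mul,
      digitSum_two_mul_add_one, digitSum_two_mul_add_one]
    have h1 := ih _ (by omega) a' (b' + 1) rfl
    have h2 := ih _ (by omega) b' 1 rfl
    have h3 : digitSum 1 = 1 := by simp [digitSum]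
    rw [← add_assoc] at h1
    omega

theorem digitSum_two_pow (j : ℕ) : digitSum (2 ^ j) = 1 := by
  induction j with
  | zero => simp [digitSum]
  | succ j ih => rw [pow_succ', digitSum_two_mul, ih]

theorem digitSum_eq_length (k : ℕ) : digitSum k = k.bitIndices.length := by
  induction k using Nat.binaryRec with
  | zero => simp [digitSum]
  | bit b k ih =>
    cases b
    · rw [Nat.bit_false_apply, digitSum_two_mul, Nat.bitIndices_two_mul, List.length_map, ih]
    · rw [Nat.bit_true_apply, digitSum_two_mul_add_one, Nat.bitIndices_two_mul_add_one,
        List.length_cons, List.length_map, ih]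

theorem digitSum_sum_two_pow (T : Finset ℕ) : digitSum (∑ j ∈ T, 2 ^ j) = T.card := by
  rw [digitSum_eq_length, ← Nat.bitIndices_nodup.dedup, ← List.card_toFinset,
    Finset.toFinset_bitIndices_sum_two_pow]

end DigitSum

/-! ### The monomial basis of `S(n,n)` -/

section Basis

open Finset

variable {n : ℕ} [NeZero n]

/-- The element `t_s^(2^j)`. -/
noncomputable def genElt (i : Gen n) : StabAlg n := tGen n i.lev ^ 2 ^ i.frob.val

/-- The product of a set of generators. -/
noncomputable def setElt (A : Finset (Gen n)) : StabAlg n := ∏ i ∈ A, genElt i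

/-- The Frobenius on the generators. -/
def Gen.fr (i : Gen n) : Gen n := ⟨i.lev, i.le, i.frob + 1⟩

theorem Gen.fr_injective : Function.Injective (Gen.fr : Gen n → Gen n) := by
  intro i i' h
  simpa [Gen.fr, Gen.ext_iff] using h

theorem tGen_of_le {s : ℕ} (hs : n ≤ s) : tGen n s = StabAlg.mk n (MvPolynomial.X ⟨s, hs⟩) := by
  have := NeZero.pos n
  rw [tGen, if_neg (by omega), dif_pos hs]

theorem pow_two_pow_mod {R : Type*} [Monoid R] {x : R} (hx : x ^ 2 ^ n = x) (j : ℕ) :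
    x ^ 2 ^ (j % n) = x ^ 2 ^ j := by
  have h : ∀ k, x ^ 2 ^ (n * k) = x := by
    intro k
    induction k with
    | zero => simp
    | succ k ih => rw [mul_add, mul_one, pow_add, pow_mul, ih, hx]
  conv_rhs => rw [← Nat.mod_add_div j n, add_comm, pow_add, pow_mul, h]

theorem tGen_pow (s : ℕ) (hs : n ≤ s) (j : ℕ) :
    tGen n s ^ 2 ^ j = genElt ⟨s, hs, (j : ZMod n)⟩ := by
  rw [genElt, ZMod.val_natCast, pow_two_pow_mod (stab_pow n _)]

theorem genElt_sq (i : Gen n) : genElt i ^ 2 = genElt i.fr := by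
  rw [genElt, ← pow_mul, ← pow_succ, tGen_pow _ i.le]
  congr 1
  exact Gen.ext rfl (by simp [Gen.fr])

/-- The exponents of a product of generators. -/
noncomputable def setExpo (A : Finset (Gen n)) : Expo n :=
  ∑ i ∈ A, Finsupp.single ⟨i.lev, i.le⟩ (2 ^ i.frob.val)

theorem tMonomial_add (e e' : Expo n) : tMonomial n (e + e') = tMonomial n e * tMonomial n e' :=
  Finsupp.prod_add_index' (by simp) (by intros; exact pow_add _ _ _)

theorem tMonomial_setExpo (A : Finset (Gen n)) : tMonomial n (setExpo A) = setElt A := by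
  induction A using Finset.induction_on with
  | empty => simp [setExpo, setElt, tMonomial]
  | insert i A hi ih =>
    rw [setElt, Finset.prod_insert hi, ← setElt, ← ih, setExpo, Finset.sum_insert hi, tMonomial_add,
      ← setExpo]
    congr 1
    exact Finsupp.prod_single_index (by simp)

/-- The Frobenius exponents `j` with `t_s^(2^j)` in a set of generators. -/
def bitSet (A : Finset (Gen n)) (s : ℕ) : Finset ℕ :=
  (A.filter fun i => i.lev = s).image fun i => i.frob.val

theorem val_injOn (A : Finset (Gen n)) (s : ℕ) :
    Set.InjOn (fun i : Gen n => i.frob.val) (A.filter fun i => i.lev = s : Finset (Gen n)) := by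
  intro i hi i' hi' h
  simp only [Finset.coe_filter, Set.mem_ofPred_eq] at hi hi'
  exact Gen.ext (hi.2.trans hi'.2.symm) (ZMod.val_injective n h)

theorem mem_bitSet {A : Finset (Gen n)} {i : Gen n} : i.frob.val ∈ bitSet A i.lev ↔ i ∈ A := by
  simp only [bitSet, Finset.mem_image, Finset.mem_filter]
  constructor
  · rintro ⟨i', ⟨h1, h2⟩, h3⟩
    rwa [Gen.ext h2 (ZMod.val_injective n h3)] at h1
  · exact fun h => ⟨i, ⟨h, rfl⟩, rfl⟩

theorem setExpo_apply (A : Finset (Gen n)) (s : {s : ℕ // n ≤ s}) :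
    setExpo A s = ∑ j ∈ bitSet A s, 2 ^ j := by
  rw [bitSet, Finset.sum_image (val_injOn A s), setExpo, Finsupp.finsetSum_apply, Finset.sum_filter]
  refine Finset.sum_congr rfl fun i _ => ?_
  rw [Finsupp.single_apply]
  congr 1
  exact propext Subtype.ext_iff

theorem setExpo_injective : Function.Injective (setExpo : Finset (Gen n) → Expo n) := by
  intro A B h
  ext i
  have h1 := DFunLike.congr_fun h ⟨i.lev, i.le⟩
  rw [setExpo_apply, setExpo_apply] at h1
  rw [← mem_bitSet, ← mem_bitSet, Finset.geomSum_injective le_rfl h1]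

theorem setExpo_lt (A : Finset (Gen n)) (s : {s : ℕ // n ≤ s}) : setExpo A s < 2 ^ n := by
  rw [setExpo_apply]
  refine Nat.geomSum_lt le_rfl fun j hj => ?_
  obtain ⟨i, -, rfl⟩ := Finset.mem_image.1 hj
  exact ZMod.val_lt _

theorem exists_setExpo_eq (e : Expo n) (he : ∀ s, e s < 2 ^ n) : ∃ A, setExpo A = e := by
  classical
  let A : Finset (Gen n) := e.support.biUnion fun s =>
    (e s).bitIndices.toFinset.image fun j : ℕ => (⟨s, s.2, (j : ZMod n)⟩ : Gen n)
  refine ⟨A, ?_⟩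
  ext s
  rw [setExpo_apply]
  conv_rhs => rw [← Finset.sum_toFinset_bitIndices_two_pow (e s)]
  congr 1
  have hj : ∀ j ∈ (e s).bitIndices.toFinset, ((j : ZMod n)).val = j := by
    intro j hj
    rw [ZMod.val_natCast, Nat.mod_eq_of_lt]
    have h1 : 2 ^ j ≤ e s := by
      rw [← Finset.sum_toFinset_bitIndices_two_pow (e s)]
      exact Finset.single_le_sum (f := fun j => 2 ^ j) (fun _ _ => Nat.zero_le _) hj
    exact (Nat.pow_lt_pow_iff_right (by norm_num)).1 (h1.trans_lt (he s))
  ext j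
  simp only [bitSet, Finset.mem_image, Finset.mem_filter, A, Finset.mem_biUnion]
  constructor
  · rintro ⟨i, ⟨⟨s', -, j', hj', rfl⟩, hs⟩, rfl⟩
    obtain rfl : s' = s := Subtype.ext hs
    change (j' : ZMod n).val ∈ _
    rwa [hj j' hj']
  · intro h
    refine ⟨⟨s, s.2, (j : ZMod n)⟩, ⟨⟨s, ?_, j, h, rfl⟩, rfl⟩, hj j h⟩
    rw [Finsupp.mem_support_iff]
    intro h0
    rw [h0] at h
    simp at h

/-- The weight of a set of generators. -/
def setWt (A : Finset (Gen n)) : ℕ := ∑ i ∈ A, i.wt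

/-- The inner degree of a generator. -/
def Gen.deg (i : Gen n) : ZMod (2 * (2 ^ n - 1)) :=
  2 ^ i.frob.val * (2 * (2 ^ i.lev - 1))

/-- The inner degree of a set of generators. -/
def setDeg (A : Finset (Gen n)) : ZMod (2 * (2 ^ n - 1)) := ∑ i ∈ A, i.deg

theorem expoMay_setExpo (A : Finset (Gen n)) : expoMay n (setExpo A) = setWt A := by
  rw [expoMay, Finsupp.sum]
  have h : ∀ s : {s : ℕ // n ≤ s}, (Nat.digits 2 (setExpo A s)).sum * mayWeight n s =
      ∑ i ∈ A.filter (fun i => i.lev = (s : ℕ)), i.wt := by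
    intro s
    have h1 := digitSum_sum_two_pow (bitSet A s)
    rw [digitSum, ← setExpo_apply] at h1
    rw [h1, bitSet, Finset.card_image_of_injOn (val_injOn A s), ← smul_eq_mul, ← Finset.sum_const]
    refine Finset.sum_congr rfl fun i hi => ?_
    rw [Gen.wt, (Finset.mem_filter.1 hi).2]
  rw [Finset.sum_congr rfl fun s _ => h s, setWt]
  have hmaps : ∀ i ∈ A, (⟨i.lev, i.le⟩ : {s : ℕ // n ≤ s}) ∈ (setExpo A).support := by
    intro i hi
    rw [Finsupp.mem_support_iff, setExpo_apply]
    intro h0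
    have := Finset.sum_eq_zero_iff.1 h0 _ (mem_bitSet.2 hi)
    simp at this
  rw [← Finset.sum_fiberwise_of_maps_to hmaps]
  refine Finset.sum_congr rfl fun s _ => Finset.sum_congr ?_ fun _ _ => rfl
  refine Finset.filter_congr fun i _ => ?_
  rw [Subtype.ext_iff]

theorem expoDeg_setExpo (A : Finset (Gen n)) : expoDeg n (setExpo A) = setDeg A := by
  induction A using Finset.induction_on with
  | empty => simp [setExpo, setDeg, expoDeg]
  | insert i A hi ih =>
    rw [setDeg, Finset.sum_insert hi, ← setDeg, ← ih, setExpo, Finset.sum_insert hi, ← setExpo,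
      expoDeg, Finsupp.sum_add_index' (by simp) (by intros; push_cast; ring)]
    congr 1
    rw [Finsupp.sum_single_index (by simp), Gen.deg]
    push_cast
    rfl

open MvPolynomial in
/-- A polynomial with exponents less than `2^n` that vanishes in `S(n,n)` is zero, because it vanishes
at all points over the field with `2^n` elements. -/
theorem eq_zero_of_mk_eq_zero (f : MvPolynomial {s : ℕ // n ≤ s} (ZMod 2))
    (hf : ∀ e ∈ f.support, ∀ s, e s < 2 ^ n) (h : StabAlg.mk n f = 0) : f = 0 := by
  classical
  let K := GaloisField 2 n
  have : Fintype K := Fintype.ofFinite K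
  have hcard : Fintype.card K = 2 ^ n := by
    rw [← Nat.card_eq_fintype_card]
    exact GaloisField.card 2 n (NeZero.ne n)
  have heval : ∀ a : {s : ℕ // n ≤ s} → K, aeval a f = 0 := by
    intro a
    let φ := StabAlg.lift n a fun s => by rw [← hcard]; exact FiniteField.pow_card _
    have h1 : φ.comp (StabAlg.mk n) = aeval a := MvPolynomial.algHom_ext fun s => by simp [φ]
    rw [← h1, AlgHom.comp_apply, h, map_zero]
  obtain ⟨T, q, rfl⟩ := exists_finset_rename f
  have hq : MvPolynomial.map (algebraMap (ZMod 2) K) q = 0 := by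
    refine eq_zero_of_eval_eq_zero _ K _ (fun v => ?_) ?_
    · have h1 := heval fun s => if hs : s ∈ T then v ⟨s, hs⟩ else 0
      rw [aeval_rename] at h1
      rw [eval_map, ← aeval_def]
      convert h1 using 3
      funext s
      simp
    · rw [mem_restrictDegree]
      intro e he s
      have h1 := support_map_subset _ _ he
      have h2 : Finsupp.mapDomain Subtype.val e ∈ (rename Subtype.val q).support := by
        rw [support_rename_of_injective Subtype.val_injective]
        exact Finset.mem_image_of_mem _ h1
      have h3 := hf _ h2 s
      rw [Finsupp.mapDomain_apply Subtype.val_injective] at h3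
      rw [hcard]
      omega
  have := MvPolynomial.map_injective _ (algebraMap (ZMod 2) K).injective
    (hq.trans (map_zero _).symm)
  rw [this, map_zero]

theorem linearIndependent_setElt : LinearIndependent (ZMod 2) (setElt (n := n)) := by
  rw [linearIndependent_iff]
  intro c hc
  let f : MvPolynomial {s : ℕ // n ≤ s} (ZMod 2) :=
    c.sum fun A a => MvPolynomial.monomial (setExpo A) a
  have hcoeff : ∀ e, f.coeff e = c.sum fun A a => if setExpo A = e then a else 0 := by
    intro e
    simp only [f, Finsupp.sum, MvPolynomial.coeff_sum, MvPolynomial.coeff_monomial]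
  have hmk : ∀ e, StabAlg.mk n (MvPolynomial.monomial e 1) = tMonomial n e := by
    intro e
    rw [MvPolynomial.monomial_eq, map_one, one_mul, tMonomial, Finsupp.prod, Finsupp.prod, map_prod]
    refine Finset.prod_congr rfl fun s _ => ?_
    rw [map_pow, tGen_of_le s.2]
  have hf : f = 0 := by
    refine eq_zero_of_mk_eq_zero f (fun e he s => ?_) ?_
    · rw [MvPolynomial.mem_support_iff, hcoeff] at he
      obtain ⟨A, -, hA⟩ := Finset.exists_ne_zero_of_sum_ne_zero he
      simp only at hA
      split_ifs at hA with h
      · rw [← h]; exact setExpo_lt A s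
      · exact absurd rfl hA
    · rw [← hc, Finsupp.linearCombination_apply]
      simp only [f, Finsupp.sum, map_sum]
      refine Finset.sum_congr rfl fun A _ => ?_
      rw [← mul_one (c A), ← smul_eq_mul, ← MvPolynomial.smul_monomial, map_smul, hmk,
        tMonomial_setExpo, smul_eq_mul, mul_one]
  ext A
  have h1 := hcoeff (setExpo A)
  rw [hf, MvPolynomial.coeff_zero, Finsupp.sum, Finset.sum_eq_single A] at h1
  · rw [if_pos rfl] at h1
    exact h1.symm
  · intro B _ hB
    rw [if_neg fun h => hB (setExpo_injective h)]
  · intro hA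
    rw [if_pos rfl]
    exact Finsupp.notMem_support_iff.1 hA

/-- The span of the products of generators of weight at most `m` and inner degree `t`. -/
noncomputable def stabFil (n : ℕ) [NeZero n] (m : ℕ) (t : ZMod (2 * (2 ^ n - 1))) :
    Submodule (ZMod 2) (StabAlg n) :=
  Submodule.span (ZMod 2) (setElt '' {A | setWt A ≤ m ∧ setDeg A = t})

theorem stabFil_mono {m m' : ℕ} (h : m ≤ m') (t : ZMod (2 * (2 ^ n - 1))) :
    stabFil n m t ≤ stabFil n m' t :=
  Submodule.span_mono (Set.image_mono fun _ hA => ⟨hA.1.trans h, hA.2⟩)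

theorem setElt_mem {A : Finset (Gen n)} {m : ℕ} {t : ZMod (2 * (2 ^ n - 1))} (h : setWt A ≤ m)
    (ht : setDeg A = t) : setElt A ∈ stabFil n m t :=
  Submodule.subset_span ⟨A, ⟨h, ht⟩, rfl⟩

theorem two_mul_two_pow : (2 * 2 ^ n : ZMod (2 * (2 ^ n - 1))) = 2 := by
  have h1 : ((2 * (2 ^ n - 1) : ℕ) : ZMod (2 * (2 ^ n - 1))) = 0 := ZMod.natCast_self _
  rw [Nat.cast_mul, Nat.cast_sub Nat.one_le_two_pow] at h1
  push_cast at h1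
  linear_combination h1

theorem two_mul_two_pow_mod (j : ℕ) :
    (2 * 2 ^ (j % n) : ZMod (2 * (2 ^ n - 1))) = 2 * 2 ^ j := by
  have h : ∀ k, (2 * 2 ^ (n * k) : ZMod (2 * (2 ^ n - 1))) = 2 := by
    intro k
    induction k with
    | zero => simp
    | succ k ih =>
      rw [mul_add, mul_one, pow_add, ← mul_assoc, ih, two_mul_two_pow]
  conv_rhs => rw [← Nat.mod_add_div j n, add_comm, pow_add, ← mul_assoc, h]

/-- The inner degree of `t_s^(2^j)` for an arbitrary exponent `j`. -/
theorem Gen.deg_natCast (s : ℕ) (hs : n ≤ s) (j : ℕ) :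
    (⟨s, hs, (j : ZMod n)⟩ : Gen n).deg = 2 ^ j * (2 * (2 ^ s - 1)) := by
  rw [Gen.deg, ZMod.val_natCast]
  linear_combination (2 ^ s - 1) * two_mul_two_pow_mod (n := n) j

theorem Gen.deg_fr (i : Gen n) : i.fr.deg = 2 * i.deg := by
  have h := Gen.deg_natCast i.lev i.le (i.frob.val + 1)
  have h1 : (⟨i.lev, i.le, ((i.frob.val + 1 : ℕ) : ZMod n)⟩ : Gen n) = i.fr :=
    Gen.ext rfl (by simp [Gen.fr])
  rw [h1] at h
  rw [h, Gen.deg, pow_succ]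
  ring

theorem genElt_mul_mem (i : Gen n) (A : Finset (Gen n)) :
    genElt i * setElt A ∈ stabFil n (i.wt + setWt A) (i.deg + setDeg A) := by
  induction h : A.card generalizing i A with
  | zero =>
    obtain rfl := Finset.card_eq_zero.1 h
    have h1 : setElt {i} = genElt i * setElt ∅ := by simp [setElt]
    rw [← h1]
    exact setElt_mem (by simp [setWt]) (by simp [setDeg])
  | succ c ih =>
    by_cases hi : i ∈ A
    · -- the square of a generator is its Frobenius, whose weight is smaller
      have h1 : genElt i * setElt A = genElt i.fr * setElt (A.erase i) := by
        rw [← genElt_sq, sq, mul_assoc, setElt, ← Finset.mul_prod_erase A _ hi, setElt]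
      have h2 := ih i.fr (A.erase i) (by rw [Finset.card_erase_of_mem hi]; omega)
      rw [h1]
      have h3 : setWt A = i.wt + setWt (A.erase i) := (Finset.add_sum_erase A _ hi).symm
      have h4 : setDeg A = i.deg + setDeg (A.erase i) := (Finset.add_sum_erase A _ hi).symm
      rw [h3, h4, ← add_assoc i.deg, ← two_mul, ← Gen.deg_fr]
      refine stabFil_mono ?_ _ h2
      rw [show i.fr.wt = i.wt from rfl]
      omega
    · have h1 : setElt (insert i A) = genElt i * setElt A := Finset.prod_insert hi
      rw [← h1]
      exact setElt_mem (by rw [setWt, Finset.sum_insert hi, setWt])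
        (by rw [setDeg, Finset.sum_insert hi, setDeg])

theorem genElt_mul_mem' (i : Gen n) {x : StabAlg n} {m : ℕ} {t : ZMod (2 * (2 ^ n - 1))}
    (hx : x ∈ stabFil n m t) : genElt i * x ∈ stabFil n (i.wt + m) (i.deg + t) := by
  induction hx using Submodule.span_induction with
  | mem x hx =>
    obtain ⟨A, ⟨h, rfl⟩, rfl⟩ := hx
    exact stabFil_mono (by omega) _ (genElt_mul_mem i A)
  | zero => rw [mul_zero]; exact Submodule.zero_mem _
  | add x y _ _ hx hy => rw [mul_add]; exact Submodule.add_mem _ hx hy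
  | smul a x _ hx => rw [mul_smul_comm]; exact Submodule.smul_mem _ _ hx

theorem setElt_mul_mem (A : Finset (Gen n)) {x : StabAlg n} {m : ℕ} {t : ZMod (2 * (2 ^ n - 1))}
    (hx : x ∈ stabFil n m t) : setElt A * x ∈ stabFil n (setWt A + m) (setDeg A + t) := by
  induction A using Finset.induction_on with
  | empty => simpa [setElt, setWt, setDeg] using hx
  | insert i A hi ih =>
    rw [setElt, Finset.prod_insert hi, ← setElt, mul_assoc, setWt, Finset.sum_insert hi, ← setWt,
      setDeg, Finset.sum_insert hi, ← setDeg, add_assoc, add_assoc]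
    exact genElt_mul_mem' i ih

theorem stabFil_mul {x y : StabAlg n} {m m' : ℕ} {t t' : ZMod (2 * (2 ^ n - 1))}
    (hx : x ∈ stabFil n m t) (hy : y ∈ stabFil n m' t') : x * y ∈ stabFil n (m + m') (t + t') := by
  induction hx using Submodule.span_induction with
  | mem x hx =>
    obtain ⟨A, ⟨h, rfl⟩, rfl⟩ := hx
    exact stabFil_mono (by omega) _ (setElt_mul_mem A hy)
  | zero => rw [zero_mul]; exact Submodule.zero_mem _
  | add x y _ _ hx hy => rw [add_mul]; exact Submodule.add_mem _ hx hy
  | smul a x _ hx => rw [smul_mul_assoc]; exact Submodule.smul_mem _ _ hx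

theorem one_mem_stabFil : (1 : StabAlg n) ∈ stabFil n 0 0 := by
  have : setElt (∅ : Finset (Gen n)) = 1 := by simp [setElt]
  rw [← this]
  exact setElt_mem (by simp [setWt]) (by simp [setDeg])

theorem genElt_mem (i : Gen n) : genElt i ∈ stabFil n i.wt i.deg := by
  simpa using genElt_mul_mem' i one_mem_stabFil

/-- The weight of a power of a generator is governed by the binary digits of the exponent. -/
theorem genElt_pow_mem (i : Gen n) (k : ℕ) :
    genElt i ^ k ∈ stabFil n (digitSum k * i.wt) (k * i.deg) := by
  induction k using Nat.strong_induction_on generalizing i with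
  | _ k ih =>
  rcases Nat.eq_zero_or_pos k with rfl | hk
  · simpa [digitSum] using one_mem_stabFil
  obtain ⟨k', rfl | rfl⟩ := Nat.even_or_odd' k
  · rw [pow_mul, genElt_sq, digitSum_two_mul]
    have h := ih k' (by omega) i.fr
    rw [Gen.deg_fr] at h
    rw [show ((2 * k' : ℕ) : ZMod (2 * (2 ^ n - 1))) * i.deg = k' * (2 * i.deg) by
      push_cast; ring]
    exact h
  · rw [pow_succ', pow_mul, genElt_sq, digitSum_two_mul_add_one]
    have h := genElt_mul_mem' i (ih k' (by omega) i.fr)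
    rw [Gen.deg_fr] at h
    rw [show ((2 * k' + 1 : ℕ) : ZMod (2 * (2 ^ n - 1))) * i.deg = i.deg + k' * (2 * i.deg) by
      push_cast; ring, add_mul, one_mul, add_comm _ i.wt]
    exact h

theorem span_setElt : Submodule.span (ZMod 2) (Set.range (setElt (n := n))) = ⊤ := by
  have hle : ∀ m t, stabFil n m t ≤ Submodule.span (ZMod 2) (Set.range (setElt (n := n))) :=
    fun m t => Submodule.span_mono (Set.image_subset_range _ _)
  have hmul : ∀ x y : StabAlg n, x ∈ Submodule.span (ZMod 2) (Set.range (setElt (n := n))) →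
      y ∈ Submodule.span (ZMod 2) (Set.range (setElt (n := n))) →
      x * y ∈ Submodule.span (ZMod 2) (Set.range (setElt (n := n))) := by
    intro x y hx hy
    have h := Submodule.mul_mem_mul hx hy
    rw [Submodule.span_mul_span] at h
    refine Submodule.span_le.2 ?_ h
    rintro _ ⟨_, ⟨A, rfl⟩, _, ⟨B, rfl⟩, rfl⟩
    exact hle _ _ (stabFil_mul (setElt_mem le_rfl rfl) (setElt_mem le_rfl rfl))
  rw [eq_top_iff]
  rintro x -
  obtain ⟨f, rfl⟩ : ∃ f, StabAlg.mk n f = x := Ideal.Quotient.mk_surjective x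
  induction f using MvPolynomial.induction_on with
  | C a =>
    have h1 : StabAlg.mk n (MvPolynomial.C a) = a • 1 := by
      rw [← MvPolynomial.algebraMap_eq, AlgHom.commutes, Algebra.algebraMap_eq_smul_one]
    rw [h1]
    exact Submodule.smul_mem _ _ (hle _ _ one_mem_stabFil)
  | add p q hp hq => rw [map_add]; exact Submodule.add_mem _ hp hq
  | mul_X p s hp =>
    rw [map_mul]
    refine hmul _ _ hp ?_
    have h1 : genElt (⟨s, s.2, 0⟩ : Gen n) = StabAlg.mk n (MvPolynomial.X s) := by
      rw [genElt, tGen_of_le s.2]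
      simp
    rw [← h1]
    exact hle _ _ (genElt_mem _)

end Basis

/-! ### Valuations of coefficients as a function of the weight -/

section Valuation

open MvPolynomial

variable {σ : Type*}

/-- The coefficient at every monomial of weight `w` is divisible by `2^(v w)`. -/
def HasVal (W : (σ →₀ ℕ) → ℕ) (v : ℕ → ℕ) (f : MvPolynomial σ ℤ) : Prop :=
  ∀ e, (2 : ℤ) ^ v (W e) ∣ coeff e f

variable {W : (σ →₀ ℕ) → ℕ} {v v' v'' : ℕ → ℕ} {f g : MvPolynomial σ ℤ}

theorem HasVal.add (hf : HasVal W v f) (hg : HasVal W v g) : HasVal W v (f + g) := fun e => by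
  rw [coeff_add]; exact dvd_add (hf e) (hg e)

theorem HasVal.sum {ι : Type*} {T : Finset ι} {f : ι → MvPolynomial σ ℤ}
    (hf : ∀ i ∈ T, HasVal W v (f i)) : HasVal W v (∑ i ∈ T, f i) := fun e => by
  rw [coeff_sum]; exact Finset.dvd_sum fun i hi => hf i hi e

theorem HasVal.mul (hW : ∀ a b, W (a + b) ≤ W a + W b)
    (h : ∀ a b w, w ≤ a + b → v'' w ≤ v a + v' b) (hf : HasVal W v f) (hg : HasVal W v' g) :
    HasVal W v'' (f * g) := fun e => by
  classical
  rw [coeff_mul]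
  refine Finset.dvd_sum fun x hx => ?_
  rw [← Finset.HasAntidiagonal.mem_antidiagonal.1 hx]
  refine (pow_dvd_pow 2 (h _ _ _ (hW x.1 x.2))).trans ?_
  rw [pow_add]
  exact mul_dvd_mul (hf _) (hg _)

theorem HasVal.two_pow_mul (k : ℕ) (h : ∀ w, v' w ≤ v w + k) (hf : HasVal W v f) :
    HasVal W v' (2 ^ k * f) := fun e => by
  have h1 : (2 ^ k * f : MvPolynomial σ ℤ) = C (2 ^ k) * f := by simp
  rw [h1, coeff_C_mul]
  refine (pow_dvd_pow 2 (h _)).trans ?_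
  rw [pow_add, mul_comm]
  exact mul_dvd_mul_left _ (hf e)

theorem HasVal.monomial {e : σ →₀ ℕ} {c : ℤ} (h : (2 : ℤ) ^ v (W e) ∣ c) :
    HasVal W v (monomial e c) := fun e' => by
  classical
  rw [coeff_monomial]
  split_ifs with he
  · rwa [← he]
  · exact dvd_zero _

/-- The valuation of a square: the cross terms occur twice, and the squares of monomials have the
same weight as the monomials. -/
theorem HasVal.sq (hW : ∀ a b, W (a + b) ≤ W a + W b) (hW2 : ∀ a, W (a + a) = W a)
    (h : ∀ a b w, w ≤ a + b → v' w ≤ v a + v b + 1) (h2 : ∀ w, v' w ≤ v w + v w)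
    (hf : HasVal W v f) : HasVal W v' (f ^ 2) := by
  classical
  have key : ∀ T : Finset (σ →₀ ℕ), HasVal W v' ((∑ e ∈ T, MvPolynomial.monomial e (coeff e f)) ^ 2) := by
    intro T
    induction T using Finset.induction_on with
    | empty =>
      intro e
      simp
    | insert e T he ih =>
      rw [Finset.sum_insert he]
      have e1 : ∀ a b : MvPolynomial σ ℤ, (a + b) ^ 2 = a * a + 2 ^ 1 * (a * b) + b ^ 2 := by
        intro a b; ring
      rw [e1]
      refine (HasVal.add ?_ ?_).add ih
      · rw [monomial_mul]
        refine HasVal.monomial ?_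
        rw [hW2]
        refine (pow_dvd_pow 2 (h2 _)).trans ?_
        rw [pow_add]
        exact mul_dvd_mul (hf e) (hf e)
      · have hm : HasVal W (fun w => v' w - 1) (MvPolynomial.monomial e (coeff e f) *
            ∑ e ∈ T, MvPolynomial.monomial e (coeff e f)) :=
          HasVal.mul hW (v := v) (v' := v) (fun a b w hw => by have := h a b w hw; omega)
            (HasVal.monomial (hf e)) (HasVal.sum fun e _ => HasVal.monomial (hf e))
        exact hm.two_pow_mul 1 fun w => by omega
  have := key f.support
  rwa [← as_sum f] at this

/-- The coefficients at monomials of weight more than `2^l a` are divisible by `2^(l+1)`. -/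
def GrowsBy (W : (σ →₀ ℕ) → ℕ) (a : ℕ) (f : MvPolynomial σ ℤ) : Prop :=
  ∀ e l, 2 ^ l * a < W e → (2 : ℤ) ^ (l + 1) ∣ coeff e f

/-- The least `l` with `w ≤ 2^l a`. -/
noncomputable def logQuot (a w : ℕ) : ℕ := Nat.clog 2 (w ⌈/⌉ a)

theorem logQuot_le_iff {a w l : ℕ} (ha : 0 < a) : logQuot a w ≤ l ↔ w ≤ 2 ^ l * a := by
  rw [logQuot, Nat.clog_le_iff_le_pow (by norm_num), ceilDiv_le_iff_le_mul ha, mul_comm]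

theorem growsBy_iff {a : ℕ} (ha : 0 < a) : GrowsBy W a f ↔ HasVal W (logQuot a) f := by
  constructor
  · intro h e
    rcases Nat.eq_zero_or_pos (logQuot a (W e)) with h0 | h0
    · rw [h0, pow_zero]; exact one_dvd _
    · have h1 : ¬ logQuot a (W e) ≤ logQuot a (W e) - 1 := by omega
      rw [logQuot_le_iff ha, not_le] at h1
      have := h e _ h1
      rwa [Nat.sub_add_cancel h0] at this
  · intro h e l hl
    rw [← not_le, ← logQuot_le_iff ha] at hl
    exact (pow_dvd_pow 2 (by omega)).trans (h e)

theorem GrowsBy.mono {a b : ℕ} (h : a ≤ b) (hf : GrowsBy W a f) : GrowsBy W b f :=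
  fun e l hl => hf e l ((Nat.mul_le_mul_left _ h).trans_lt hl)

theorem GrowsBy.add {a : ℕ} (hf : GrowsBy W a f) (hg : GrowsBy W a g) : GrowsBy W a (f + g) :=
  fun e l hl => by rw [coeff_add]; exact dvd_add (hf e l hl) (hg e l hl)

theorem GrowsBy.sub {a : ℕ} (hf : GrowsBy W a f) (hg : GrowsBy W a g) : GrowsBy W a (f - g) :=
  fun e l hl => by rw [coeff_sub]; exact dvd_sub (hf e l hl) (hg e l hl)

theorem GrowsBy.sum {ι : Type*} {T : Finset ι} {f : ι → MvPolynomial σ ℤ} {a : ℕ}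
    (hf : ∀ i ∈ T, GrowsBy W a (f i)) : GrowsBy W a (∑ i ∈ T, f i) := fun e l hl => by
  rw [coeff_sum]; exact Finset.dvd_sum fun i hi => hf i hi e l hl

theorem GrowsBy.monomial {e : σ →₀ ℕ} {c : ℤ} {a : ℕ} (h : W e ≤ a) :
    GrowsBy W a (monomial e c) := fun e' l hl => by
  classical
  rw [coeff_monomial, if_neg]
  · exact dvd_zero _
  · rintro rfl
    have : 1 * a ≤ 2 ^ l * a := Nat.mul_le_mul_right _ Nat.one_le_two_pow
    omega

/-- Growth is preserved by raising to `2^k`-th powers, even though the degrees grow. -/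
theorem GrowsBy.pow (hW : ∀ a b, W (a + b) ≤ W a + W b) (hW2 : ∀ a, W (a + a) = W a) {a : ℕ}
    (ha : 0 < a) (hf : GrowsBy W a f) (k : ℕ) : GrowsBy W a (f ^ 2 ^ k) := by
  induction k with
  | zero => simpa using hf
  | succ k ih =>
    rw [pow_succ, pow_mul]
    rw [growsBy_iff ha] at ih ⊢
    refine ih.sq hW hW2 (fun x y w hw => ?_) fun w => Nat.le_add_left _ _
    rw [logQuot_le_iff ha]
    have hx : x ≤ 2 ^ logQuot a x * a := (logQuot_le_iff ha).1 le_rfl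
    have hy : y ≤ 2 ^ logQuot a y * a := (logQuot_le_iff ha).1 le_rfl
    have h1 : 2 ^ logQuot a x ≤ 2 ^ (logQuot a x + logQuot a y) :=
      Nat.pow_le_pow_right (by norm_num) (by omega)
    have h2 : 2 ^ logQuot a y ≤ 2 ^ (logQuot a x + logQuot a y) :=
      Nat.pow_le_pow_right (by norm_num) (by omega)
    rw [pow_succ, mul_two, add_mul]
    have h3 := Nat.mul_le_mul_right a h1
    have h4 := Nat.mul_le_mul_right a h2
    omega

/-- Divisibility by `2` from weight `M` on, and by `4` from weight `2 M` on. -/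
def stepVal (M w : ℕ) : ℕ := if w < M then 0 else if w < 2 * M then 1 else 2

/-- The powers of `X + Y + g`, where `X` and `Y` have weight `M` and `g` has smaller weight: modulo
`4` and terms of weight less than `2 M`, only the powers of `X` and `Y` and the first carry remain. -/
theorem hasVal_add_pow (hW : ∀ a b, W (a + b) ≤ W a + W b) (hW2 : ∀ a, W (a + a) = W a) {M : ℕ}
    {i j : σ} (hi : ∀ k, W (Finsupp.single i (2 ^ k)) ≤ M)
    (hj : ∀ k, W (Finsupp.single j (2 ^ k)) ≤ M)
    (hg : HasVal W (stepVal M) g) (k : ℕ) :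
    HasVal W (stepVal M) ((X i + X j + g) ^ 2 ^ (k + 1) - X i ^ 2 ^ (k + 1) - X j ^ 2 ^ (k + 1)
      - 2 * (X i * X j) ^ 2 ^ k) := by
  have hsq : ∀ h : MvPolynomial σ ℤ, HasVal W (stepVal M) h → HasVal W (stepVal M) (h ^ 2) := by
    intro h hh
    refine hh.sq hW hW2 (fun a b w hw => ?_) fun w => Nat.le_add_left _ _
    unfold stepVal
    split_ifs <;> omega
  have hlin : ∀ (h : MvPolynomial σ ℤ) (k : ℕ), HasVal W (stepVal M) h →
      HasVal W (stepVal M) (2 ^ 1 * (h * (X i ^ 2 ^ k + X j ^ 2 ^ k))) := by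
    intro h k hh
    have hx : HasVal W (fun w => if w ≤ M then 0 else 2)
        (X i ^ 2 ^ k + X j ^ 2 ^ k : MvPolynomial σ ℤ) := by
      rw [X_pow_eq_monomial, X_pow_eq_monomial]
      refine HasVal.add (HasVal.monomial ?_) (HasVal.monomial ?_)
      · rw [if_pos (hi k), pow_zero]
      · rw [if_pos (hj k), pow_zero]
    have := HasVal.mul (v'' := fun w => stepVal M w - 1) hW (fun a b w hw => by
      unfold stepVal
      split_ifs <;> omega) hh hx
    exact this.two_pow_mul 1 fun w => by omega
  have hfour : ∀ h : MvPolynomial σ ℤ, HasVal W (stepVal M) (2 ^ 2 * h) := by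
    intro h
    refine HasVal.two_pow_mul (v := fun _ => 0) 2 (fun w => ?_) fun e => by simp
    unfold stepVal
    split_ifs <;> omega
  induction k with
  | zero =>
    have e : (X i + X j + g) ^ 2 ^ (0 + 1) - X i ^ 2 ^ (0 + 1) - X j ^ 2 ^ (0 + 1)
      - 2 * (X i * X j) ^ 2 ^ 0 = 2 ^ 1 * (g * (X i ^ 2 ^ 0 + X j ^ 2 ^ 0)) + g ^ 2 := by ring
    rw [e]
    exact (hlin g 0 hg).add (hsq g hg)
  | succ k ih =>
    set h := (X i + X j + g) ^ 2 ^ (k + 1) - X i ^ 2 ^ (k + 1) - X j ^ 2 ^ (k + 1)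
      - 2 * (X i * X j) ^ 2 ^ k with hh
    have e1 : (X i + X j + g) ^ 2 ^ (k + 1) = h + X i ^ 2 ^ (k + 1) + X j ^ 2 ^ (k + 1)
      + 2 * (X i * X j) ^ 2 ^ k := by rw [hh]; ring
    have e2 : ∀ x : MvPolynomial σ ℤ, x ^ 2 ^ (k + 1 + 1) = (x ^ 2 ^ (k + 1)) ^ 2 := by
      intro x; rw [← pow_mul, ← pow_succ]
    have e3 : ((X i * X j : MvPolynomial σ ℤ) ^ 2 ^ k) ^ 2 = X i ^ 2 ^ (k + 1) * X j ^ 2 ^ (k + 1) := by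
      rw [← pow_mul, ← pow_succ, mul_pow]
    have e : (X i + X j + g) ^ 2 ^ (k + 1 + 1) - X i ^ 2 ^ (k + 1 + 1) - X j ^ 2 ^ (k + 1 + 1)
      - 2 * (X i * X j) ^ 2 ^ (k + 1) = h ^ 2 + 2 ^ 1 * (h * (X i ^ 2 ^ (k + 1) + X j ^ 2 ^ (k + 1)))
        + 2 ^ 2 * (((X i * X j) ^ 2 ^ k) ^ 2 + (X i ^ 2 ^ (k + 1) + X j ^ 2 ^ (k + 1)) *
          (X i * X j) ^ 2 ^ k + h * (X i * X j) ^ 2 ^ k) := by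
      rw [e2, e2, e2, e1, mul_pow (X i) (X j) (2 ^ (k + 1))]
      ring
    rw [e]
    exact ((hsq h ih).add (hlin h _ ih)).add (hfour _)

end Valuation

/-! ### Estimates of the coproduct polynomials -/

section CoproductPolynomials

open MvPolynomial

/-- The variables of the coproduct polynomials after the substitution `t₀ ↦ 1` and `tⱼ ↦ 0` for
`0 < j < n`; here `f` is one of the two injections into `ℕ ⊕ ℕ`. -/
noncomputable def redVar (n : ℕ) (f : ℕ → ℕ ⊕ ℕ) (j : ℕ) : MvPolynomial (ℕ ⊕ ℕ) ℤ :=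
  if j = 0 then 1 else if n ≤ j then X (f j) else 0

/-- The integral polynomial for `Δ(tₛ)` after the substitution `t₀ ↦ 1` and `tⱼ ↦ 0` for
`0 < j < n`. -/
noncomputable def redCoprod (n s : ℕ) : MvPolynomial (ℕ ⊕ ℕ) ℤ :=
  coprodEval n (redVar n Sum.inl) (redVar n Sum.inr) s

/-- The sum `∑ tⱼ^(2^k) ⊗ tₗ^(2^(k + j))` over `j + l = s`. -/
noncomputable def redSum (n s k : ℕ) : MvPolynomial (ℕ ⊕ ℕ) ℤ :=
  ∑ jl ∈ Finset.HasAntidiagonal.antidiagonal s,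
    redVar n Sum.inl jl.1 ^ 2 ^ k * redVar n Sum.inr jl.2 ^ 2 ^ (k + jl.1)

/-- The May weight of a monomial in the `tⱼ ⊗ 1` and `1 ⊗ tₖ`. -/
noncomputable def pairWt (n : ℕ) (e : ℕ ⊕ ℕ →₀ ℕ) : ℕ :=
  e.sum fun i k => digitSum k * mayWeight n (Sum.elim id id i)

/-- The inner degree of `tⱼ ⊗ 1` and `1 ⊗ tⱼ`. -/
def pairDeg (n : ℕ) (i : ℕ ⊕ ℕ) : ZMod (2 * (2 ^ n - 1)) := 2 * (2 ^ Sum.elim id id i - 1)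

variable {n : ℕ}

theorem pairWt_single (i : ℕ ⊕ ℕ) (k : ℕ) :
    pairWt n (Finsupp.single i k) = digitSum k * mayWeight n (Sum.elim id id i) :=
  Finsupp.sum_single_index (by simp [digitSum_zero])

theorem pairWt_add_le (a b : ℕ ⊕ ℕ →₀ ℕ) : pairWt n (a + b) ≤ pairWt n a + pairWt n b := by
  classical
  have h : ∀ c : ℕ ⊕ ℕ →₀ ℕ, c.support ⊆ a.support ∪ b.support → pairWt n c =
      ∑ i ∈ a.support ∪ b.support, digitSum (c i) * mayWeight n (Sum.elim id id i) :=
    fun c hc => Finsupp.sum_of_support_subset _ hc _ (by simp [digitSum_zero])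
  rw [h (a + b) Finsupp.support_add, h a Finset.subset_union_left, h b Finset.subset_union_right,
    ← Finset.sum_add_distrib]
  refine Finset.sum_le_sum fun i _ => ?_
  rw [← add_mul]
  exact Nat.mul_le_mul_right _ (digitSum_add_le _ _)

theorem pairWt_add_self (a : ℕ ⊕ ℕ →₀ ℕ) : pairWt n (a + a) = pairWt n a := by
  rw [← two_smul ℕ a, pairWt, Finsupp.sum_smul_index (by simp [digitSum_zero])]
  simp only [digitSum_two_mul]
  rfl

theorem redCoprod_ghost (hn : 0 < n) (s : ℕ) :
    ∑ i ∈ Finset.range (s / n + 1), 2 ^ (s / n - i) * redCoprod n (s - n * i) ^ 2 ^ (n * i) =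
      ∑ i ∈ Finset.range (s / n + 1), 2 ^ (s / n - i) * redSum n (s - n * i) (n * i) := by
  have h := congrArg (eval₂Hom (Int.castRingHom _)
    (Sum.elim (redVar n Sum.inl) (redVar n Sum.inr))) (coprodPoly_ghost n hn s)
  simp only [coprodSum, map_sum, map_mul, map_pow, map_ofNat, eval₂Hom_X', Sum.elim_inl,
    Sum.elim_inr] at h
  exact h

/-- The recursion for `redCoprod`, solved for the leading term. -/
theorem redCoprod_rec (hn : 0 < n) {s : ℕ} : 2 ^ (s / n) * (redCoprod n s - redSum n s 0) =
    ∑ i ∈ Finset.range (s / n), 2 ^ (s / n - (i + 1)) *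
      (redSum n (s - n * (i + 1)) (n * (i + 1)) -
        redCoprod n (s - n * (i + 1)) ^ 2 ^ (n * (i + 1))) := by
  have h := redCoprod_ghost hn s
  rw [Finset.sum_range_succ', Finset.sum_range_succ'] at h
  simp only [mul_zero, Nat.sub_zero, pow_zero, pow_one] at h
  simp only [mul_sub, Finset.sum_sub_distrib]
  linear_combination h

theorem redVar_zero (f : ℕ → ℕ ⊕ ℕ) : redVar n f 0 = 1 := if_pos rfl

theorem redVar_of_le (hn : 0 < n) (f : ℕ → ℕ ⊕ ℕ) {j : ℕ} (hj : n ≤ j) : redVar n f j = X (f j) := by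
  rw [redVar, if_neg (by omega), if_pos hj]

theorem redVar_of_lt (f : ℕ → ℕ ⊕ ℕ) {j : ℕ} (h0 : 0 < j) (hj : j < n) : redVar n f j = 0 := by
  rw [redVar, if_neg (by omega), if_neg (by omega)]

theorem redSum_zero (k : ℕ) : redSum n 0 k = 1 := by
  simp [redSum, redVar_zero]

theorem redSum_of_lt {s : ℕ} (h0 : 0 < s) (hs : s < n) (k : ℕ) : redSum n s k = 0 := by
  refine Finset.sum_eq_zero fun jl hjl => ?_
  rw [Finset.HasAntidiagonal.mem_antidiagonal] at hjl
  rcases Nat.eq_zero_or_pos jl.1 with h1 | h1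
  · rw [redVar_of_lt Sum.inr (j := jl.2) (by omega) (by omega), zero_pow (by positivity), mul_zero]
  · rw [redVar_of_lt Sum.inl (j := jl.1) (by omega) (by omega), zero_pow (by positivity), zero_mul]

theorem redCoprod_of_lt {s : ℕ} (hs : s < n) : redCoprod n s = redSum n s 0 := by
  have h := redCoprod_rec (n := n) (by omega) (s := s)
  rw [Nat.div_eq_of_lt hs] at h
  simpa [sub_eq_zero] using h

/-- The terms with `j, l ≥ n` in `redSum`. -/
theorem redSum_eq (hn : 0 < n) {s : ℕ} (hs : n ≤ s) (k : ℕ) :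
    redSum n s k = X (Sum.inl s) ^ 2 ^ k + X (Sum.inr s) ^ 2 ^ k +
      ∑ jl ∈ (Finset.HasAntidiagonal.antidiagonal s).filter (fun jl => n ≤ jl.1 ∧ n ≤ jl.2),
        X (Sum.inl jl.1) ^ 2 ^ k * X (Sum.inr jl.2) ^ 2 ^ (k + jl.1) := by
  have h : ∀ jl ∈ Finset.HasAntidiagonal.antidiagonal s,
      redVar n Sum.inl jl.1 ^ 2 ^ k * redVar n Sum.inr jl.2 ^ 2 ^ (k + jl.1) =
      (if jl = (s, 0) then X (Sum.inl s) ^ 2 ^ k else 0) +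
      (if jl = (0, s) then X (Sum.inr s) ^ 2 ^ k else 0) +
      (if n ≤ jl.1 ∧ n ≤ jl.2 then X (Sum.inl jl.1) ^ 2 ^ k * X (Sum.inr jl.2) ^ 2 ^ (k + jl.1)
        else 0) := by
    rintro ⟨j, l⟩ hjl
    rw [Finset.HasAntidiagonal.mem_antidiagonal] at hjl
    simp only at hjl
    simp only [Prod.mk.injEq]
    rcases Nat.eq_zero_or_pos j with rfl | hj
    · rw [zero_add] at hjl
      subst hjl
      rw [if_neg (by omega), if_pos (by omega), if_neg (by omega), redVar_zero,
        redVar_of_le hn _ hs]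
      simp
    rcases Nat.eq_zero_or_pos l with rfl | hl
    · rw [add_zero] at hjl
      subst hjl
      rw [if_pos (by omega), if_neg (by omega), if_neg (by omega), redVar_zero,
        redVar_of_le hn _ hs]
      simp
    rw [if_neg (by omega), if_neg (by omega)]
    rcases lt_or_ge j n with hj' | hj'
    · rw [if_neg (by omega), redVar_of_lt _ hj hj', zero_pow (by positivity)]
      simp
    rcases lt_or_ge l n with hl' | hl'
    · rw [if_neg (by omega), redVar_of_lt _ hl hl', zero_pow (by positivity)]
      simp
    rw [if_pos ⟨hj', hl'⟩, redVar_of_le hn _ hj', redVar_of_le hn _ hl']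
    simp
  rw [redSum, Finset.sum_congr rfl h, Finset.sum_add_distrib, Finset.sum_add_distrib,
    Finset.sum_ite_eq', Finset.sum_ite_eq', if_pos (by simp), if_pos (by simp), ← Finset.sum_filter]

theorem growsBy_X_mul_X {a j l p q : ℕ} (h : mayWeight n j + mayWeight n l ≤ a) :
    GrowsBy (pairWt n) a (X (Sum.inl j) ^ 2 ^ p * X (Sum.inr l) ^ 2 ^ q) := by
  rw [X_pow_eq_monomial, X_pow_eq_monomial, monomial_mul]
  refine GrowsBy.monomial ((pairWt_add_le _ _).trans ?_)
  simpa [pairWt_single, digitSum_two_pow] using h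

theorem growsBy_X_pow {a : ℕ} {i : ℕ ⊕ ℕ} {p : ℕ} (h : mayWeight n (Sum.elim id id i) ≤ a) :
    GrowsBy (pairWt n) a (X i ^ 2 ^ p) := by
  rw [X_pow_eq_monomial]
  refine GrowsBy.monomial ?_
  simpa [pairWt_single, digitSum_two_pow] using h

theorem growsBy_redSum_sub (hn : 0 < n) {s : ℕ} (hs : n ≤ s) (k : ℕ) :
    GrowsBy (pairWt n) (mayWeight n s - 1)
      (redSum n s k - X (Sum.inl s) ^ 2 ^ k - X (Sum.inr s) ^ 2 ^ k) := by
  rw [redSum_eq hn hs, show ∀ a b c : MvPolynomial (ℕ ⊕ ℕ) ℤ, a + b + c - a - b = c by intros; ring]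
  refine GrowsBy.sum fun jl hjl => growsBy_X_mul_X ?_
  obtain ⟨h1, h2, h3⟩ := Finset.mem_filter.1 hjl
  have h4 := (mayWeight_add_le hn h2 h3).1
  rw [Finset.HasAntidiagonal.mem_antidiagonal.1 h1] at h4
  omega

theorem growsBy_redSum (hn : 0 < n) {s : ℕ} (hs : n ≤ s) (k : ℕ) :
    GrowsBy (pairWt n) (mayWeight n s) (redSum n s k) := by
  have h := ((growsBy_redSum_sub hn hs k).mono (Nat.sub_le _ _)).add
    ((growsBy_X_pow (i := Sum.inl s) (p := k) le_rfl).add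
      (growsBy_X_pow (i := Sum.inr s) (p := k) le_rfl))
  convert h using 1
  ring

theorem mayWeight_sub_mul (hn : 0 < n) {s : ℕ} : ∀ i : ℕ, n ≤ s - n * i → 
    mayWeight n s + 1 = 2 ^ i * (mayWeight n (s - n * i) + 1)
  | 0, _ => by simp
  | i + 1, h => by
    rw [mul_add, mul_one] at h ⊢
    rw [mayWeight_sub_mul hn i (by omega)]
    have h1 := mayWeight_add hn h
    rw [show s - (n * i + n) + n = s - n * i by omega] at h1
    rw [h1, pow_succ]
    ring_nf

theorem dvd_of_two_pow_mul {m l : ℕ} {c : ℤ} (h : (2 : ℤ) ^ (m + l) ∣ 2 ^ m * c) :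
    (2 : ℤ) ^ l ∣ c := by
  rw [pow_add] at h
  exact (mul_dvd_mul_iff_left (by positivity)).1 h

theorem coeff_two_pow_mul (k : ℕ) (f : MvPolynomial (ℕ ⊕ ℕ) ℤ) (e : ℕ ⊕ ℕ →₀ ℕ) :
    coeff e (2 ^ k * f) = 2 ^ k * coeff e f := by
  have h1 : (2 ^ k * f : MvPolynomial (ℕ ⊕ ℕ) ℤ) = C (2 ^ k) * f := by simp
  rw [h1, coeff_C_mul]

/-- The terms of the recursion vanish unless `s - n i ≥ n`. -/
theorem redSum_sub_pow_of_lt {s : ℕ} (hs : s < n) (k : ℕ) :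
    redSum n s k - redCoprod n s ^ 2 ^ k = 0 := by
  rw [redCoprod_of_lt hs, sub_eq_zero]
  rcases Nat.eq_zero_or_pos s with rfl | h0
  · rw [redSum_zero, redSum_zero, one_pow]
  · rw [redSum_of_lt h0 hs, redSum_of_lt h0 hs, zero_pow (by positivity)]

/-- The terms of `Δ(tₛ)` other than `tₛ ⊗ 1` and `1 ⊗ tₛ` have smaller weight, up to terms whose
weight grows with the power of `2` in their coefficient. -/
theorem growsBy_redCoprod_sub (hn : 0 < n) : ∀ {s : ℕ}, n ≤ s →
    GrowsBy (pairWt n) (mayWeight n s - 1) (redCoprod n s - X (Sum.inl s) - X (Sum.inr s)) := by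
  intro s
  induction s using Nat.strong_induction_on with
  | _ s ih =>
  intro hs
  have h1 : GrowsBy (pairWt n) (mayWeight n s - 1) (redCoprod n s - redSum n s 0) := by
    intro e l hl
    refine dvd_of_two_pow_mul (m := s / n) ?_
    rw [← coeff_two_pow_mul, redCoprod_rec hn, coeff_sum]
    refine Finset.dvd_sum fun i hi => ?_
    have hi' := Finset.mem_range.1 hi
    rw [coeff_two_pow_mul]
    rcases lt_or_ge (s - n * (i + 1)) n with h | h
    · rw [redSum_sub_pow_of_lt h]
      simp
    have hw := mayWeight_sub_mul hn (i + 1) h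
    have hpos := mayWeight_pos hn h
    have hlt : s - n * (i + 1) < s := by
      have : 0 < n * (i + 1) := by positivity
      omega
    have hg := (ih _ hlt h).mono (Nat.sub_le _ _)
    have hg' : GrowsBy (pairWt n) (mayWeight n (s - n * (i + 1))) (redCoprod n (s - n * (i + 1))) := by
      have h' := hg.add ((growsBy_X_pow (i := Sum.inl (s - n * (i + 1))) (p := 0) le_rfl).add
        (growsBy_X_pow (i := Sum.inr (s - n * (i + 1))) (p := 0) le_rfl))
      convert h' using 1
      ring
    -- division by `2^⌊s/n⌋` costs `i + 1` factors of `2`, which the doubling of the May weights under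
    -- `s ↦ s + n` makes up for
    have hd := ((growsBy_redSum hn h (n * (i + 1))).sub
      (hg'.pow pairWt_add_le pairWt_add_self hpos (n * (i + 1)))) e (l + (i + 1)) (by
        refine lt_of_le_of_lt ?_ hl
        rw [pow_add, mul_assoc]
        refine Nat.mul_le_mul_left _ ?_
        have : 2 ≤ 2 ^ (i + 1) := by rw [pow_succ]; have := Nat.one_le_two_pow (n := i); omega
        rw [mul_add] at hw
        omega)
    refine Dvd.dvd.trans ?_ (mul_dvd_mul_left (2 ^ (s / n - (i + 1))) hd)
    rw [← pow_add]
    exact pow_dvd_pow 2 (by omega)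
  have h2 := h1.add (growsBy_redSum_sub hn hs 0)
  convert h2 using 1
  ring

theorem redCoprod_of_lt_two_mul (hn : 0 < n) {s : ℕ} (hs : n ≤ s) (hs2 : s < 2 * n) :
    redCoprod n s = X (Sum.inl s) + X (Sum.inr s) := by
  have h := redCoprod_rec hn (s := s)
  have h1 : s / n = 1 := by
    rw [Nat.div_eq_iff hn]
    omega
  rw [h1] at h
  simp only [Finset.range_one, Finset.sum_singleton] at h
  rw [redSum_sub_pow_of_lt (by omega), mul_zero] at h
  have h2 : redCoprod n s - redSum n s 0 = 0 := by
    rcases mul_eq_zero.1 h with h | h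
    · norm_num at h
    · exact h
  rw [sub_eq_zero.1 h2, redSum_eq hn hs, Finset.filter_eq_empty_iff.2, Finset.sum_empty]
  · simp
  · intro jl hjl h3
    rw [Finset.HasAntidiagonal.mem_antidiagonal] at hjl
    omega

theorem redSum_sub_even (hn : 0 < n) {s : ℕ} (hs : 2 * n ≤ s) (e : ℕ ⊕ ℕ →₀ ℕ)
    (he : mayWeight n s - 1 ≤ pairWt n e) :
    coeff e (redSum n s 0 - X (Sum.inl s) - X (Sum.inr s) -
      (if s = 2 * n then X (Sum.inl n) * X (Sum.inr n) ^ 2 ^ n else 0)) = 0 := by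
  rw [redSum_eq hn (by omega)]
  simp only [pow_zero, pow_one, zero_add]
  rw [show ∀ a b c d : MvPolynomial (ℕ ⊕ ℕ) ℤ, a + b + c - a - b - d = c - d by intros; ring]
  split_ifs with h2
  · subst h2
    have : (Finset.HasAntidiagonal.antidiagonal (2 * n)).filter (fun jl => n ≤ jl.1 ∧ n ≤ jl.2) = {(n, n)} := by
      ext ⟨j, l⟩
      rw [Finset.mem_filter, Finset.HasAntidiagonal.mem_antidiagonal, Finset.mem_singleton,
        Prod.mk.injEq]
      simp only
      omega
    rw [this, Finset.sum_singleton, sub_self, coeff_zero]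
  · rw [sub_zero, coeff_sum]
    refine Finset.sum_eq_zero fun jl hjl => ?_
    obtain ⟨h1, h3, h4⟩ := Finset.mem_filter.1 hjl
    rw [Finset.HasAntidiagonal.mem_antidiagonal] at h1
    have h5 := (mayWeight_add_le hn h3 h4).2 (by omega)
    rw [h1] at h5
    have h6 : (X (Sum.inl jl.1) * X (Sum.inr jl.2) ^ 2 ^ jl.1 : MvPolynomial (ℕ ⊕ ℕ) ℤ) =
        monomial (Finsupp.single (Sum.inl jl.1) 1 + Finsupp.single (Sum.inr jl.2) (2 ^ jl.1)) 1 := by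
      rw [X_pow_eq_monomial, X, monomial_mul, mul_one]
    rw [h6, coeff_monomial, if_neg]
    rintro rfl
    have h7 := he.trans (pairWt_add_le _ _)
    rw [pairWt_single, pairWt_single, digitSum_two_pow, ← pow_zero 2, digitSum_two_pow] at h7
    simp only [one_mul, Sum.elim_inl, Sum.elim_inr, id] at h7
    omega

/-- The terms of weight `M(tₛ) - 1` of the coproduct of `tₛ`, modulo `2`: for `s = 2 n` the term
`tₙ ⊗ tₙ^(2^n)`, and the first carry `(t_{s-n} ⊗ t_{s-n})^(2^(n-1))`. -/
theorem redCoprod_even (hn : 0 < n) {s : ℕ} (hs : 2 * n ≤ s) (e : ℕ ⊕ ℕ →₀ ℕ)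
    (he : mayWeight n s - 1 ≤ pairWt n e) :
    2 ∣ coeff e (redCoprod n s - X (Sum.inl s) - X (Sum.inr s) -
      (if s = 2 * n then X (Sum.inl n) * X (Sum.inr n) ^ 2 ^ n else 0) +
      (X (Sum.inl (s - n)) * X (Sum.inr (s - n))) ^ 2 ^ (n - 1)) := by
  set c : MvPolynomial (ℕ ⊕ ℕ) ℤ := (X (Sum.inl (s - n)) * X (Sum.inr (s - n))) ^ 2 ^ (n - 1)
    with hc
  have key : (2 : ℤ) ^ 1 ∣ coeff e (redCoprod n s - redSum n s 0 + c) := by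
    refine dvd_of_two_pow_mul (m := s / n) ?_
    have hm : 1 ≤ s / n := (Nat.one_le_div_iff hn).2 (by omega)
    have hw1 := mayWeight_add hn (s := s - n) (by omega)
    rw [Nat.sub_add_cancel (by omega)] at hw1
    have hpos1 := mayWeight_pos hn (s := s - n) (by omega)
    obtain ⟨m, hm'⟩ : ∃ m, s / n = m + 1 := ⟨s / n - 1, by omega⟩
    rw [← coeff_two_pow_mul, mul_add, redCoprod_rec hn, hm', Finset.sum_range_succ', coeff_add, coeff_add,
      add_assoc (coeff e _), coeff_sum, ← coeff_add]
    refine dvd_add (Finset.dvd_sum fun i hi => ?_) ?_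
    · have hi' := Finset.mem_range.1 hi
      rw [coeff_two_pow_mul]
      rcases lt_or_ge (s - n * (i + 1 + 1)) n with h | h
      · rw [redSum_sub_pow_of_lt h]
        simp
      have hw := mayWeight_sub_mul hn (i + 1 + 1) h
      have hpos := mayWeight_pos hn h
      have hg' : GrowsBy (pairWt n) (mayWeight n (s - n * (i + 1 + 1)))
          (redCoprod n (s - n * (i + 1 + 1))) := by
        have h' := ((growsBy_redCoprod_sub hn h).mono (Nat.sub_le _ _)).add
          ((growsBy_X_pow (i := Sum.inl (s - n * (i + 1 + 1))) (p := 0) le_rfl).add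
          (growsBy_X_pow (i := Sum.inr (s - n * (i + 1 + 1))) (p := 0) le_rfl))
        convert h' using 1
        ring
      have hd := ((growsBy_redSum hn h (n * (i + 1 + 1))).sub
        (hg'.pow pairWt_add_le pairWt_add_self hpos (n * (i + 1 + 1)))) e (i + 1 + 1) (by
          refine lt_of_lt_of_le ?_ he
          have : 4 ≤ 2 ^ (i + 1 + 1) := by
            rw [pow_succ, pow_succ]; have := Nat.one_le_two_pow (n := i); omega
          rw [mul_add] at hw
          omega)
      refine Dvd.dvd.trans ?_ (mul_dvd_mul_left (2 ^ (m + 1 - (i + 1 + 1))) hd)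
      rw [← pow_add]
      exact pow_dvd_pow 2 (by omega)
    · obtain ⟨g, hg⟩ : ∃ g, redCoprod n (s - n) = X (Sum.inl (s - n)) + X (Sum.inr (s - n)) + g :=
        ⟨redCoprod n (s - n) - X (Sum.inl (s - n)) - X (Sum.inr (s - n)), by ring⟩
      have hgg := growsBy_redCoprod_sub hn (s := s - n) (by omega)
      rw [hg, show ∀ a b c : MvPolynomial (ℕ ⊕ ℕ) ℤ, a + b + c - a - b = c by intros; ring] at hgg
      have hstep : HasVal (pairWt n) (stepVal (mayWeight n (s - n))) g := by
        intro e'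
        rw [stepVal]
        split_ifs with h1 h2
        · simp
        · simpa using hgg e' 0 (by omega)
        · exact hgg e' 1 (by omega)
      have hv := hasVal_add_pow (W := pairWt n) pairWt_add_le pairWt_add_self
        (M := mayWeight n (s - n)) (i := Sum.inl (s - n)) (j := Sum.inr (s - n))
        (fun k => by simp [pairWt_single, digitSum_two_pow])
        (fun k => by simp [pairWt_single, digitSum_two_pow]) hstep (n - 1) e
      rw [Nat.sub_add_cancel hn, ← hc, ← hg, stepVal, if_neg (by omega), if_neg (by omega)] at hv
      have ht := growsBy_redSum_sub hn (s := s - n) (by omega) n e 1 (by omega)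
      have hd := dvd_sub ht hv
      rw [← coeff_sub] at hd
      have he2 : 2 ^ (m + 1 - (0 + 1)) * (redSum n (s - n * (0 + 1)) (n * (0 + 1)) -
          redCoprod n (s - n * (0 + 1)) ^ 2 ^ (n * (0 + 1))) + 2 ^ (m + 1) * c =
          2 ^ m * (redSum n (s - n) n - X (Sum.inl (s - n)) ^ 2 ^ n - X (Sum.inr (s - n)) ^ 2 ^ n -
          (redCoprod n (s - n) ^ 2 ^ n - X (Sum.inl (s - n)) ^ 2 ^ n - X (Sum.inr (s - n)) ^ 2 ^ n
            - 2 * c)) := by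
        simp only [zero_add, mul_one, Nat.add_sub_cancel, pow_succ]
        ring
      rw [he2, coeff_two_pow_mul, show m + 1 + 1 = m + 2 from rfl, pow_add]
      exact mul_dvd_mul_left _ hd
  rw [show redCoprod n s - X (Sum.inl s) - X (Sum.inr s) -
      (if s = 2 * n then X (Sum.inl n) * X (Sum.inr n) ^ 2 ^ n else 0) + c =
      (redCoprod n s - redSum n s 0 + c) + (redSum n s 0 - X (Sum.inl s) - X (Sum.inr s) -
      (if s = 2 * n then X (Sum.inl n) * X (Sum.inr n) ^ 2 ^ n else 0)) by ring, coeff_add,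
    redSum_sub_even hn hs e he, add_zero]
  simpa using key

/-- The coproduct of `t₂ₙ` modulo `2`. -/
theorem redCoprod_two_mul_even (hn : 0 < n) (e : ℕ ⊕ ℕ →₀ ℕ) :
    2 ∣ coeff e (redCoprod n (2 * n) - X (Sum.inl (2 * n)) - X (Sum.inr (2 * n)) -
      X (Sum.inl n) * X (Sum.inr n) ^ 2 ^ n + (X (Sum.inl n) * X (Sum.inr n)) ^ 2 ^ (n - 1)) := by
  have h := redCoprod_rec hn (s := 2 * n)
  have hfil : ∀ s, n ≤ s → s ≤ 2 * n → (Finset.HasAntidiagonal.antidiagonal s).filter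
      (fun jl => n ≤ jl.1 ∧ n ≤ jl.2) = if s = 2 * n then {(n, n)} else ∅ := by
    intro s h1 h2
    ext ⟨j, l⟩
    rw [Finset.mem_filter, Finset.HasAntidiagonal.mem_antidiagonal]
    split_ifs with h3
    · rw [Finset.mem_singleton, Prod.mk.injEq]
      simp only
      omega
    · simp only [Finset.notMem_empty, iff_false]
      omega
  have h1 : redSum n (2 * n) 0 = X (Sum.inl (2 * n)) + X (Sum.inr (2 * n)) +
      X (Sum.inl n) * X (Sum.inr n) ^ 2 ^ n := by
    rw [redSum_eq hn (by omega), hfil _ (by omega) le_rfl, if_pos rfl, Finset.sum_singleton]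
    simp
  have h2 : redSum n n n = X (Sum.inl n) ^ 2 ^ n + X (Sum.inr n) ^ 2 ^ n := by
    rw [redSum_eq hn le_rfl, hfil _ le_rfl (by omega), if_neg (by omega), Finset.sum_empty, add_zero]
  rw [Nat.mul_div_cancel _ hn, Finset.sum_range_succ, Finset.sum_range_one,
    redSum_sub_pow_of_lt (s := 2 * n - n * (1 + 1)) (by omega), mul_zero, add_zero, h1] at h
  simp only [zero_add, mul_one, show 2 * n - n = n by omega] at h
  rw [h2, redCoprod_of_lt_two_mul hn le_rfl (by omega)] at h
  -- with the trivial weight, `hasVal_add_pow` is a congruence modulo `4`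
  have hv := hasVal_add_pow (W := fun _ : ℕ ⊕ ℕ →₀ ℕ => 0) (fun _ _ => le_rfl) (fun _ => rfl)
    (M := 0) (i := Sum.inl n) (j := Sum.inr n) (fun _ => le_rfl) (fun _ => le_rfl) (g := 0)
    (fun e => by simp) (n - 1) e
  rw [Nat.sub_add_cancel hn, add_zero, stepVal, if_neg (by omega), if_neg (by omega)] at hv
  have h3 : (2 : ℤ) ^ 1 ∣ coeff e (redCoprod n (2 * n) - X (Sum.inl (2 * n)) - X (Sum.inr (2 * n)) -
      X (Sum.inl n) * X (Sum.inr n) ^ 2 ^ n + (X (Sum.inl n) * X (Sum.inr n)) ^ 2 ^ (n - 1)) := by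
    refine dvd_of_two_pow_mul (m := 2) ?_
    have h4 : (2 : MvPolynomial (ℕ ⊕ ℕ) ℤ) ^ 2 * (redCoprod n (2 * n) - X (Sum.inl (2 * n)) -
        X (Sum.inr (2 * n)) - X (Sum.inl n) * X (Sum.inr n) ^ 2 ^ n +
        (X (Sum.inl n) * X (Sum.inr n)) ^ 2 ^ (n - 1)) =
        2 ^ 1 * -((X (Sum.inl n) + X (Sum.inr n)) ^ 2 ^ n - X (Sum.inl n) ^ 2 ^ n -
          X (Sum.inr n) ^ 2 ^ n - 2 * (X (Sum.inl n) * X (Sum.inr n)) ^ 2 ^ (n - 1)) := by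
      linear_combination h
    rw [← coeff_two_pow_mul, h4, coeff_two_pow_mul, coeff_neg, show 2 + 1 = 1 + 2 from rfl, pow_add]
    exact mul_dvd_mul_left _ (dvd_neg.2 hv)
  simpa using h3

theorem isWeightedHomogeneous_redVar (f : ℕ → ℕ ⊕ ℕ) (hf : ∀ j, Sum.elim id id (f j) = j) (j : ℕ) :
    IsWeightedHomogeneous (pairDeg n) (redVar n f j) (2 * (2 ^ j - 1)) := by
  rw [redVar]
  split_ifs with h1 h2
  · subst h1
    simpa using isWeightedHomogeneous_one ℤ (pairDeg n)
  · have := isWeightedHomogeneous_X ℤ (pairDeg n) (f j)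
    rwa [pairDeg, hf] at this
  · exact isWeightedHomogeneous_zero _ _ _

theorem isWeightedHomogeneous_redSum (s k : ℕ) :
    IsWeightedHomogeneous (pairDeg n) (redSum n s k) (2 ^ k * (2 * (2 ^ s - 1))) := by
  refine IsWeightedHomogeneous.sum _ _ _ fun jl hjl => ?_
  have h := ((isWeightedHomogeneous_redVar (n := n) Sum.inl (fun _ => rfl) jl.1).pow (2 ^ k)).mul
    ((isWeightedHomogeneous_redVar (n := n) Sum.inr (fun _ => rfl) jl.2).pow (2 ^ (k + jl.1)))
  convert h using 1
  rw [← Finset.HasAntidiagonal.mem_antidiagonal.1 hjl, nsmul_eq_mul, nsmul_eq_mul]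
  push_cast
  ring

theorem isWeightedHomogeneous_redCoprod [NeZero n] (s : ℕ) :
    IsWeightedHomogeneous (pairDeg n) (redCoprod n s) (2 * (2 ^ s - 1)) := by
  have hn := NeZero.pos n
  induction s using Nat.strong_induction_on with
  | _ s ih =>
  have h0 : IsWeightedHomogeneous (pairDeg n) (redCoprod n s - redSum n s 0) (2 * (2 ^ s - 1)) := by
    intro e he
    have h1 : coeff e (2 ^ (s / n) * (redCoprod n s - redSum n s 0)) ≠ 0 := by
      rw [coeff_two_pow_mul]
      exact mul_ne_zero (by positivity) he
    rw [redCoprod_rec hn] at h1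
    refine IsWeightedHomogeneous.sum (Finset.range (s / n)) _ (2 * (2 ^ s - 1)) (fun i hi => ?_) h1
    have hi' : n * (i + 1) ≤ s := by
      have h3 : i + 1 ≤ s / n := Finset.mem_range.1 hi
      calc n * (i + 1) ≤ n * (s / n) := Nat.mul_le_mul_left _ h3
        _ ≤ s := Nat.mul_div_le _ _
    have h2 : IsWeightedHomogeneous (pairDeg n) (2 ^ (s / n - (i + 1)) : MvPolynomial (ℕ ⊕ ℕ) ℤ) 0 := by
      have := isWeightedHomogeneous_C (pairDeg n) ((2 : ℤ) ^ (s / n - (i + 1)))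
      simpa using this
    have hpos : 0 < n * (i + 1) := by positivity
    have h4 := (ih (s - n * (i + 1)) (by omega)).pow (2 ^ (n * (i + 1)))
    rw [nsmul_eq_mul, Nat.cast_pow, Nat.cast_ofNat] at h4
    have h5 := h2.mul ((isWeightedHomogeneous_redSum (s - n * (i + 1)) (n * (i + 1))).sub h4)
    convert h5 using 1
    have h6 := two_mul_two_pow_mod (n := n) (n * (i + 1))
    rw [Nat.mul_mod_right, pow_zero] at h6
    obtain ⟨u, rfl⟩ := Nat.exists_eq_add_of_le hi'
    rw [Nat.add_sub_cancel_left, pow_add]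
    linear_combination (-1) * h6
  have := h0.add (by simpa using isWeightedHomogeneous_redSum (n := n) s 0)
  simpa using this

end CoproductPolynomials

/-! ### The coproduct and the filtration -/

section CoproductFiltration

open scoped TensorProduct

open MvPolynomial (X C IsWeightedHomogeneous eval₂Hom coeff monomial)

variable {n : ℕ} [NeZero n]

/-- The part of weight less than `m` and inner degree `t` in `S(n,n) ⊗ S(n,n)`. The strict
inequality allows for `m = 0`. -/
noncomputable def tensorFil (n : ℕ) [NeZero n] (m : ℕ) (t : ZMod (2 * (2 ^ n - 1))) :
    Submodule (ZMod 2) (StabAlg n ⊗[ZMod 2] StabAlg n) :=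
  Submodule.span (ZMod 2) ((fun p : Finset (Gen n) × Finset (Gen n) => setElt p.1 ⊗ₜ setElt p.2) ''
    {p | setWt p.1 + setWt p.2 < m ∧ setDeg p.1 + setDeg p.2 = t})

theorem tmul_mem {x y : StabAlg n} {m m' l : ℕ} {t t' u : ZMod (2 * (2 ^ n - 1))}
    (hx : x ∈ stabFil n m t) (hy : y ∈ stabFil n m' t') (hl : m + m' < l) (hu : t + t' = u) :
    x ⊗ₜ[ZMod 2] y ∈ tensorFil n l u := by
  induction hx using Submodule.span_induction with
  | mem x hx =>
    obtain ⟨A, ⟨h1, h2⟩, rfl⟩ := hx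
    induction hy using Submodule.span_induction with
    | mem y hy =>
      obtain ⟨B, ⟨h3, h4⟩, rfl⟩ := hy
      exact Submodule.subset_span ⟨(A, B), ⟨by dsimp only; omega, by simp only [h2, h4, hu]⟩, rfl⟩
    | zero => rw [TensorProduct.tmul_zero]; exact Submodule.zero_mem _
    | add a b _ _ ha hb => rw [TensorProduct.tmul_add]; exact Submodule.add_mem _ ha hb
    | smul c a _ ha => rw [TensorProduct.tmul_smul]; exact Submodule.smul_mem _ _ ha
  | zero => rw [TensorProduct.zero_tmul]; exact Submodule.zero_mem _
  | add a b _ _ ha hb => rw [TensorProduct.add_tmul]; exact Submodule.add_mem _ ha hb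
  | smul c a _ ha => rw [← TensorProduct.smul_tmul']; exact Submodule.smul_mem _ _ ha

theorem tensorFil_mul {x y : StabAlg n ⊗[ZMod 2] StabAlg n} {m m' l : ℕ}
    {t t' u : ZMod (2 * (2 ^ n - 1))} (hx : x ∈ tensorFil n m t) (hy : y ∈ tensorFil n m' t')
    (hl : m + m' ≤ l + 1) (hu : t + t' = u) : x * y ∈ tensorFil n l u := by
  induction hx using Submodule.span_induction with
  | mem x hx =>
    obtain ⟨⟨A, B⟩, ⟨h1, h2⟩, rfl⟩ := hx
    induction hy using Submodule.span_induction with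
    | mem y hy =>
      obtain ⟨⟨A', B'⟩, ⟨h3, h4⟩, rfl⟩ := hy
      simp only at h1 h2 h3 h4
      simp only [Algebra.TensorProduct.tmul_mul_tmul]
      refine tmul_mem (stabFil_mul (setElt_mem le_rfl rfl) (setElt_mem le_rfl rfl))
        (stabFil_mul (setElt_mem le_rfl rfl) (setElt_mem le_rfl rfl)) (by omega) ?_
      rw [← hu, ← h2, ← h4]
      ring
    | zero => rw [mul_zero]; exact Submodule.zero_mem _
    | add a b _ _ ha hb => rw [mul_add]; exact Submodule.add_mem _ ha hb
    | smul c a _ ha => rw [mul_smul_comm]; exact Submodule.smul_mem _ _ ha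
  | zero => rw [zero_mul]; exact Submodule.zero_mem _
  | add a b _ _ ha hb => rw [add_mul]; exact Submodule.add_mem _ ha hb
  | smul c a _ ha => rw [smul_mul_assoc]; exact Submodule.smul_mem _ _ ha

theorem setElt_sq (A : Finset (Gen n)) :
    setElt A ^ 2 = setElt (A.map ⟨Gen.fr, Gen.fr_injective⟩) := by
  rw [setElt, setElt, Finset.prod_map, ← Finset.prod_pow]
  exact Finset.prod_congr rfl fun i _ => genElt_sq i

theorem setWt_map_fr (A : Finset (Gen n)) :
    setWt (A.map ⟨Gen.fr, Gen.fr_injective⟩) = setWt A := by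
  rw [setWt, Finset.sum_map]
  rfl

theorem setDeg_map_fr (A : Finset (Gen n)) :
    setDeg (A.map ⟨Gen.fr, Gen.fr_injective⟩) = 2 * setDeg A := by
  rw [setDeg, Finset.sum_map, setDeg, Finset.mul_sum]
  exact Finset.sum_congr rfl fun i _ => i.deg_fr

/-- The Frobenius preserves the weight and doubles the inner degree. -/
theorem tensorFil_sq {x : StabAlg n ⊗[ZMod 2] StabAlg n} {m : ℕ} {t : ZMod (2 * (2 ^ n - 1))}
    (hx : x ∈ tensorFil n m t) : x ^ 2 ∈ tensorFil n m (2 * t) := by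
  induction hx using Submodule.span_induction with
  | mem x hx =>
    obtain ⟨⟨A, B⟩, ⟨h1, h2⟩, rfl⟩ := hx
    simp only at h1 h2
    simp only [Algebra.TensorProduct.tmul_pow, setElt_sq]
    refine tmul_mem (setElt_mem le_rfl rfl) (setElt_mem le_rfl rfl) ?_ ?_
    · rwa [setWt_map_fr, setWt_map_fr]
    · rw [setDeg_map_fr, setDeg_map_fr, ← h2, mul_add]
  | zero => rw [zero_pow (by norm_num)]; exact Submodule.zero_mem _
  | add a b _ _ ha hb =>
    have := add_pow_two_pow 1 a b
    rw [pow_one] at this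
    rw [this]
    exact Submodule.add_mem _ ha hb
  | smul c a _ ha => rw [smul_pow]; exact Submodule.smul_mem _ _ ha

theorem tensorFil_pow {x : StabAlg n ⊗[ZMod 2] StabAlg n} {m : ℕ} {t : ZMod (2 * (2 ^ n - 1))}
    (hx : x ∈ tensorFil n m t) (j : ℕ) : x ^ 2 ^ j ∈ tensorFil n m (2 ^ j * t) := by
  induction j with
  | zero => simpa using hx
  | succ j ih =>
    have h1 : x ^ 2 ^ (j + 1) = (x ^ 2 ^ j) ^ 2 := by rw [← pow_mul, ← pow_succ]
    rw [h1, pow_succ', mul_assoc]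
    exact tensorFil_sq ih

/-- The evaluation of integral polynomials at the `tⱼ ⊗ 1` and `1 ⊗ tⱼ`. -/
noncomputable def evalPair (n : ℕ) :
    MvPolynomial (ℕ ⊕ ℕ) ℤ →+* StabAlg n ⊗[ZMod 2] StabAlg n :=
  eval₂Hom (Int.castRingHom _)
    (Sum.elim (fun j => tGen n j ⊗ₜ[ZMod 2] 1) (fun j => 1 ⊗ₜ[ZMod 2] tGen n j))

theorem evalPair_X (i : ℕ ⊕ ℕ) : evalPair n (X i) =
    Sum.elim (fun j => tGen n j ⊗ₜ[ZMod 2] 1) (fun j => 1 ⊗ₜ[ZMod 2] tGen n j) i :=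
  MvPolynomial.eval₂Hom_X' _ _ _

theorem two_eq_zero_tensor : (2 : StabAlg n ⊗[ZMod 2] StabAlg n) = 0 := by
  have : algebraMap (ZMod 2) (StabAlg n ⊗[ZMod 2] StabAlg n) 2 = 0 := by
    rw [show (2 : ZMod 2) = 0 from rfl, map_zero]
  rwa [map_ofNat] at this

theorem comul_tGen_eq_evalPair (s : ℕ) : comul n (tGen n s) = evalPair n (redCoprod n s) := by
  rw [comul_tGen, redCoprod, map_coprodEval]
  have h : ∀ (f : ℕ → ℕ ⊕ ℕ) (j : ℕ), evalPair n (redVar n f j) =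
      if j = 0 then 1 else if n ≤ j then
        Sum.elim (fun j => tGen n j ⊗ₜ[ZMod 2] 1) (fun j => 1 ⊗ₜ[ZMod 2] tGen n j) (f j) else 0 := by
    intro f j
    rw [redVar]
    split_ifs with h1 h2
    · exact map_one _
    · exact evalPair_X _
    · exact map_zero _
  have h0 : ∀ j, tGen n j = if j = 0 then 1 else if n ≤ j then tGen n j else 0 := by
    intro j
    split_ifs with h1 h2
    · rw [tGen, if_pos h1]
    · rfl
    · rw [tGen, if_neg h1, dif_neg h2]
  congr 1 <;> funext j <;> rw [h] <;> simp only [Sum.elim_inl, Sum.elim_inr] <;>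
    conv_lhs => rw [h0 j]
  · split_ifs
    · exact Algebra.TensorProduct.one_def.symm
    · rfl
    · exact TensorProduct.zero_tmul _ _
  · split_ifs
    · exact Algebra.TensorProduct.one_def.symm
    · rfl
    · exact TensorProduct.tmul_zero _ _

theorem tGen_pow_mem (s k : ℕ) :
    tGen n s ^ k ∈ stabFil n (digitSum k * mayWeight n s) (k * (2 * (2 ^ s - 1))) := by
  rcases lt_or_ge s n with hs | hs
  · rcases Nat.eq_zero_or_pos s with rfl | h0
    · rw [tGen, if_pos rfl, one_pow]
      have := stabFil_mono (n := n) (Nat.zero_le (digitSum k * mayWeight n 0)) 0 one_mem_stabFil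
      simpa using this
    · rcases Nat.eq_zero_or_pos k with rfl | hk
      · simpa [digitSum_zero] using one_mem_stabFil (n := n)
      · rw [tGen, if_neg (by omega), dif_neg (by omega), zero_pow (by omega)]
        exact Submodule.zero_mem _
  · have h := genElt_pow_mem (n := n) ⟨s, hs, ((0 : ℕ) : ZMod n)⟩ k
    rw [Gen.deg_natCast, ← tGen_pow] at h
    simp only [pow_zero, pow_one, one_mul] at h
    exact h

theorem evalPair_monomial_mem (e : ℕ ⊕ ℕ →₀ ℕ) {m : ℕ} (hm : pairWt n e < m) :
    evalPair n (monomial e 1) ∈ tensorFil n m (Finsupp.weight (pairDeg n) e) := by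
  induction e using Finsupp.induction generalizing m with
  | zero =>
    have h1 : evalPair n (monomial 0 1) = 1 := by simp
    rw [h1, Algebra.TensorProduct.one_def, map_zero]
    exact tmul_mem one_mem_stabFil one_mem_stabFil (by omega) (add_zero _)
  | single_add i k e hi _ ih =>
    have h1 : pairWt n (Finsupp.single i k + e) = pairWt n (Finsupp.single i k) + pairWt n e := by
      refine Finsupp.sum_add_index_of_disjoint ?_ _
      refine Finset.disjoint_of_subset_left Finsupp.support_single_subset ?_
      rwa [Finset.disjoint_singleton_left]
    rw [h1, pairWt_single] at hm
    have h2 : monomial (Finsupp.single i k + e) (1 : ℤ) = X i ^ k * monomial e 1 := by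
      rw [MvPolynomial.X_pow_eq_monomial, MvPolynomial.monomial_mul, mul_one]
    rw [h2, map_mul, map_pow, map_add, Finsupp.weight_single, evalPair_X]
    refine tensorFil_mul (m := digitSum k * mayWeight n (Sum.elim id id i) + 1) ?_
      (ih (m := pairWt n e + 1) (by omega)) (by omega) rfl
    rw [nsmul_eq_mul, pairDeg]
    rcases i with j | j
    · simp only [Sum.elim_inl, Algebra.TensorProduct.tmul_pow, one_pow, id]
      exact tmul_mem (tGen_pow_mem j k) one_mem_stabFil (by omega) (add_zero _)
    · simp only [Sum.elim_inr, Algebra.TensorProduct.tmul_pow, one_pow, id]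
      exact tmul_mem one_mem_stabFil (tGen_pow_mem j k) (by omega) (zero_add _)

theorem evalPair_mem {f : MvPolynomial (ℕ ⊕ ℕ) ℤ} {m : ℕ} {t : ZMod (2 * (2 ^ n - 1))}
    (hf : IsWeightedHomogeneous (pairDeg n) f t) (h2 : ∀ e, m ≤ pairWt n e → 2 ∣ coeff e f) :
    evalPair n f ∈ tensorFil n m t := by
  rw [f.as_sum, map_sum]
  refine Submodule.sum_mem _ fun e he => ?_
  have h1 : monomial e (coeff e f) = C (coeff e f) * monomial e 1 := by
    rw [MvPolynomial.C_mul_monomial, mul_one]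
  rw [h1, map_mul]
  rcases lt_or_ge (pairWt n e) m with h | h
  · have h3 := evalPair_monomial_mem e h
    rw [hf (MvPolynomial.mem_support_iff.1 he)] at h3
    have h4 : evalPair n (C (coeff e f)) = algebraMap (ZMod 2) _ ((coeff e f : ℤ) : ZMod 2) := by
      rw [map_intCast]
      exact MvPolynomial.eval₂Hom_C _ _ _
    rw [h4, ← Algebra.smul_def]
    exact Submodule.smul_mem _ _ h3
  · obtain ⟨c, hc⟩ := h2 e h
    rw [hc, map_mul, map_mul, map_ofNat, map_ofNat, two_eq_zero_tensor, zero_mul, zero_mul]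
    exact Submodule.zero_mem _

/-- The reduced coproduct `Δ(x) - x ⊗ 1 - 1 ⊗ x`. -/
noncomputable def redComul (x : StabAlg n) : StabAlg n ⊗[ZMod 2] StabAlg n :=
  comul n x - x ⊗ₜ 1 - 1 ⊗ₜ x

theorem redComul_pow (x : StabAlg n) (j : ℕ) : redComul (x ^ 2 ^ j) = redComul x ^ 2 ^ j := by
  have h : ∀ a b : StabAlg n ⊗[ZMod 2] StabAlg n, (a - b) ^ 2 ^ j = a ^ 2 ^ j - b ^ 2 ^ j := by
    intro a b
    have := add_pow_two_pow j (a - b) b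
    rw [sub_add_cancel] at this
    rw [this, add_sub_cancel_right]
  rw [redComul, redComul, h, h, map_pow, Algebra.TensorProduct.tmul_pow, one_pow,
    Algebra.TensorProduct.tmul_pow, one_pow]

theorem redComul_tGen (s : ℕ) :
    redComul (tGen n s) = evalPair n (redCoprod n s - X (Sum.inl s) - X (Sum.inr s)) := by
  rw [redComul, comul_tGen_eq_evalPair, map_sub, map_sub, evalPair_X, evalPair_X]
  rfl

theorem isWeightedHomogeneous_redCoprod_sub (s : ℕ) : IsWeightedHomogeneous (pairDeg n)
    (redCoprod n s - X (Sum.inl s) - X (Sum.inr s)) (2 * (2 ^ s - 1)) :=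
  ((isWeightedHomogeneous_redCoprod s).sub
    (MvPolynomial.isWeightedHomogeneous_X ℤ (pairDeg n) (Sum.inl s))).sub
    (MvPolynomial.isWeightedHomogeneous_X ℤ (pairDeg n) (Sum.inr s))

theorem Gen.deg_eq (i : Gen n) : i.deg = 2 ^ i.frob.val * (2 * (2 ^ i.lev - 1)) := rfl

theorem redComul_genElt_mem (i : Gen n) : redComul (genElt i) ∈ tensorFil n i.wt i.deg := by
  rw [genElt, redComul_pow, Gen.deg_eq]
  refine tensorFil_pow ?_ _
  rw [redComul_tGen]
  refine evalPair_mem (isWeightedHomogeneous_redCoprod_sub _) fun e he => ?_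
  have hpos := mayWeight_pos (NeZero.pos n) i.le
  have := growsBy_redCoprod_sub (NeZero.pos n) i.le e 0 (by
    change mayWeight n i.lev ≤ _ at he
    omega)
  simpa using this

theorem redComul_genElt_of_lt {i : Gen n} (hi : i.lev < 2 * n) : redComul (genElt i) = 0 := by
  rw [genElt, redComul_pow, redComul_tGen, redCoprod_of_lt_two_mul (NeZero.pos n) i.le hi]
  simp

theorem redComul_tGen_sub_mem {s : ℕ} (hs : 2 * n ≤ s) {m : ℕ}
    (hm : ∀ e, m ≤ pairWt n e → 2 ∣ coeff e (redCoprod n s - X (Sum.inl s) - X (Sum.inr s) -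
      (if s = 2 * n then X (Sum.inl n) * X (Sum.inr n) ^ 2 ^ n else 0) +
      (X (Sum.inl (s - n)) * X (Sum.inr (s - n))) ^ 2 ^ (n - 1))) :
    redComul (tGen n s) - (if s = 2 * n then tGen n n ⊗ₜ tGen n n else 0) -
      (tGen n (s - n) ⊗ₜ tGen n (s - n)) ^ 2 ^ (n - 1) ∈ tensorFil n m (2 * (2 ^ s - 1)) := by
  have hn := NeZero.pos n
  have h1 : redComul (tGen n s) - (if s = 2 * n then tGen n n ⊗ₜ tGen n n else 0) -
      (tGen n (s - n) ⊗ₜ tGen n (s - n)) ^ 2 ^ (n - 1) =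
      evalPair n (redCoprod n s - X (Sum.inl s) - X (Sum.inr s) -
      (if s = 2 * n then X (Sum.inl n) * X (Sum.inr n) ^ 2 ^ n else 0) +
      (X (Sum.inl (s - n)) * X (Sum.inr (s - n))) ^ 2 ^ (n - 1)) := by
    rw [redComul_tGen, map_add, map_sub _ (_ - _ - _), map_pow, map_mul, evalPair_X, evalPair_X,
      Sum.elim_inl, Sum.elim_inr, Algebra.TensorProduct.tmul_mul_tmul, one_mul, mul_one,
      apply_ite (evalPair n), map_mul, map_pow, evalPair_X, evalPair_X, map_zero,
      Sum.elim_inl, Sum.elim_inr, Algebra.TensorProduct.tmul_pow 1, one_pow,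
      Algebra.TensorProduct.tmul_mul_tmul, one_mul, mul_one, stab_pow]
    linear_combination (-(tGen n (s - n) ⊗ₜ tGen n (s - n)) ^ 2 ^ (n - 1)) *
      two_eq_zero_tensor (n := n)
  rw [h1]
  refine evalPair_mem ?_ hm
  have h2 := two_mul_two_pow (n := n)
  have hX := fun i => MvPolynomial.isWeightedHomogeneous_X ℤ (pairDeg n) i
  refine ((isWeightedHomogeneous_redCoprod_sub s).sub ?_).add ?_
  · split_ifs with h
    · have h3 := (hX (Sum.inl n)).mul ((hX (Sum.inr n)).pow (2 ^ n))
      have h4 : pairDeg n (Sum.inl n) + 2 ^ n • pairDeg n (Sum.inr n) = 2 * (2 ^ s - 1) := by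
        rw [h, nsmul_eq_mul, pairDeg, pairDeg]
        push_cast
        simp only [Sum.elim_inl, Sum.elim_inr, id]
        ring
      rw [h4] at h3
      exact h3
    · exact MvPolynomial.isWeightedHomogeneous_zero _ _ _
  · have h3 := ((hX (Sum.inl (s - n))).mul (hX (Sum.inr (s - n)))).pow (2 ^ (n - 1))
    have h5 : 2 ^ (n - 1) • (pairDeg n (Sum.inl (s - n)) + pairDeg n (Sum.inr (s - n))) =
        2 * (2 ^ s - 1) := by
      obtain ⟨u, rfl⟩ := Nat.exists_eq_add_of_le (show n ≤ s by omega)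
      rw [nsmul_eq_mul, pairDeg, pairDeg, Sum.elim_inl, Sum.elim_inr, Nat.add_sub_cancel_left,
        pow_add 2 n]
      push_cast
      simp only [id]
      have h4 : (2 : ZMod (2 * (2 ^ n - 1))) * 2 ^ (n - 1) = 2 ^ n := by
        rw [← pow_succ', Nat.sub_add_cancel hn]
      linear_combination (2 * 2 ^ u - 2) * h4 - h2
    rw [h5] at h3
    exact h3

theorem redComul_genElt_succ_sub_mem (i : Gen n) {m : ℕ}
    (hm : ∀ e, m ≤ pairWt n e → 2 ∣ coeff e (redCoprod n (i.lev + n) - X (Sum.inl (i.lev + n)) -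
      X (Sum.inr (i.lev + n)) -
      (if i.lev + n = 2 * n then X (Sum.inl n) * X (Sum.inr n) ^ 2 ^ n else 0) +
      (X (Sum.inl (i.lev + n - n)) * X (Sum.inr (i.lev + n - n))) ^ 2 ^ (n - 1))) :
    redComul (genElt i.succ) - genElt i ⊗ₜ genElt i -
      (if i.lev = n then genElt i.rot ⊗ₜ genElt i.rot else 0) ∈ tensorFil n m i.succ.deg := by
  have hn := NeZero.pos n
  have hs : 2 * n ≤ i.lev + n := by have := i.le; omega
  have h := tensorFil_pow (redComul_tGen_sub_mem hs hm) i.succ.frob.val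
  have hsub : ∀ (j : ℕ) (a b : StabAlg n ⊗[ZMod 2] StabAlg n),
      (a - b) ^ 2 ^ j = a ^ 2 ^ j - b ^ 2 ^ j := by
    intro j a b
    have := add_pow_two_pow j (a - b) b
    rw [sub_add_cancel] at this
    rw [this, add_sub_cancel_right]
  have hcast : ((i.succ.frob.val : ℕ) : ZMod n) = i.succ.frob := ZMod.natCast_zmod_val _
  have hn1 : ((n - 1 : ℕ) : ZMod n) = -1 := by
    rw [Nat.cast_sub hn, ZMod.natCast_self, Nat.cast_one, zero_sub]
  rw [hsub, hsub, ← redComul_pow, ← pow_mul, ← pow_add, Nat.add_sub_cancel,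
    Algebra.TensorProduct.tmul_pow, tGen_pow _ i.le] at h
  have h5 : tensorFil n m i.succ.deg = tensorFil n m
      (2 ^ i.succ.frob.val * (2 * (2 ^ (i.lev + n) - 1))) := rfl
  rw [h5]
  convert h using 1
  by_cases h6 : i.lev = n
  · have h7 : i.lev + n = 2 * n := by omega
    have h8 : i.succ.frob = i.frob := by simp [Gen.succ, h6]
    rw [if_pos h6, if_pos h7, Algebra.TensorProduct.tmul_pow, tGen_pow _ le_rfl, hcast]
    have h9 : (⟨n, le_rfl, i.succ.frob⟩ : Gen n) = i := Gen.ext h6.symm h8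
    have h10 : (⟨i.lev, i.le, ((n - 1 + i.succ.frob.val : ℕ) : ZMod n)⟩ : Gen n) = i.rot := by
      refine Gen.ext rfl ?_
      rw [Nat.cast_add, hn1, hcast, h8, Gen.rot]
      ring
    rw [h9, h10]
    rfl
  · have h7 : i.lev + n ≠ 2 * n := by omega
    have h8 : i.succ.frob = i.frob + 1 := by simp [Gen.succ, h6]
    have h10 : (⟨i.lev, i.le, ((n - 1 + i.succ.frob.val : ℕ) : ZMod n)⟩ : Gen n) = i := by
      refine Gen.ext rfl ?_
      rw [Nat.cast_add, hn1, hcast, h8]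
      ring
    rw [if_neg h6, if_neg h7, h10, zero_pow (by positivity), sub_zero, sub_zero]
    rfl

/-- The leading part of the reduced coproduct of a generator `tₛ^(2^j)` with `s ≥ 2 n`. -/
theorem redComul_genElt_succ_mem (i : Gen n) : redComul (genElt i.succ) - genElt i ⊗ₜ genElt i -
      (if i.lev = n then genElt i.rot ⊗ₜ genElt i.rot else 0) ∈
    tensorFil n (i.succ.wt - 1) i.succ.deg :=
  redComul_genElt_succ_sub_mem i
    (redCoprod_even (s := i.lev + n) (NeZero.pos n) (by have := i.le; omega))

/-- For `s = 2 n` there are no further terms. -/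
theorem redComul_genElt_succ_of_lev (i : Gen n) (hi : i.lev = n) :
    redComul (genElt i.succ) = genElt i ⊗ₜ genElt i + genElt i.rot ⊗ₜ genElt i.rot := by
  have h := redComul_genElt_succ_sub_mem i (m := 0) fun e _ => by
    have h2 : i.lev + n = 2 * n := by omega
    rw [h2, if_pos rfl, show 2 * n - n = n by omega]
    exact redCoprod_two_mul_even (NeZero.pos n) e
  have h0 : ∀ t, tensorFil n 0 t = ⊥ := by
    intro t
    rw [tensorFil, Submodule.span_eq_bot]
    rintro _ ⟨p, hp, rfl⟩
    exact absurd hp.1 (Nat.not_lt_zero _)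
  rw [h0, Submodule.mem_bot, if_pos hi, sub_sub, sub_eq_zero] at h
  exact h

/-- The coproduct of a monomial agrees with the coproduct of an exterior algebra on primitive
generators up to terms of smaller weight. -/
theorem comul_setElt_sub_mem (A : Finset (Gen n)) :
    comul n (setElt A) - ∑ B ∈ A.powerset, setElt B ⊗ₜ setElt (A \ B) ∈
      tensorFil n (setWt A) (setDeg A) := by
  induction A using Finset.induction_on with
  | empty =>
    rw [setElt, Finset.prod_empty, map_one, Finset.powerset_empty, Finset.sum_singleton]
    simp [setElt, Algebra.TensorProduct.one_def]
  | insert i A hi ih =>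
    have hD : ∑ B ∈ A.powerset, setElt B ⊗ₜ[ZMod 2] setElt (A \ B) ∈
        tensorFil n (setWt A + 1) (setDeg A) := by
      refine Submodule.sum_mem _ fun B hB => ?_
      have hB' := Finset.mem_powerset.1 hB
      refine tmul_mem (setElt_mem le_rfl rfl) (setElt_mem le_rfl rfl) ?_ ?_
      · rw [setWt, setWt, setWt, add_comm, Finset.sum_sdiff hB']
        omega
      · rw [setDeg, setDeg, setDeg, add_comm, Finset.sum_sdiff hB']
    have hg : genElt i ⊗ₜ[ZMod 2] 1 + 1 ⊗ₜ[ZMod 2] genElt i ∈ tensorFil n (i.wt + 1) i.deg :=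
      Submodule.add_mem _ (tmul_mem (genElt_mem i) one_mem_stabFil (by omega) (add_zero _))
        (tmul_mem one_mem_stabFil (genElt_mem i) (by omega) (zero_add _))
    have hins : ∀ B : Finset (Gen n), i ∉ B → setElt (insert i B) = genElt i * setElt B :=
      fun B hB => Finset.prod_insert hB
    have hsum : ∑ B ∈ (insert i A).powerset, setElt B ⊗ₜ[ZMod 2] setElt (insert i A \ B) =
        (genElt i ⊗ₜ[ZMod 2] 1 + 1 ⊗ₜ[ZMod 2] genElt i) *
          ∑ B ∈ A.powerset, setElt B ⊗ₜ[ZMod 2] setElt (A \ B) := by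
      rw [Finset.sum_powerset_insert hi, add_mul, Finset.mul_sum, Finset.mul_sum, add_comm]
      congr 1 <;> refine Finset.sum_congr rfl fun B hB => ?_ <;>
        have hB' := fun h => hi (Finset.mem_powerset.1 hB h)
      · rw [hins B hB', Finset.insert_sdiff_insert, Finset.sdiff_insert_of_notMem hi,
          Algebra.TensorProduct.tmul_mul_tmul, one_mul]
      · rw [Finset.insert_sdiff_of_notMem _ hB', hins _ fun h => hi (Finset.mem_sdiff.1 h).1,
          Algebra.TensorProduct.tmul_mul_tmul, one_mul]
    have hw : setWt (insert i A) = i.wt + setWt A := Finset.sum_insert hi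
    have hd : setDeg (insert i A) = i.deg + setDeg A := Finset.sum_insert hi
    have h1 := tensorFil_mul hg ih (l := setWt (insert i A)) (by omega) hd.symm
    have h2 := tensorFil_mul (redComul_genElt_mem i) hD (l := setWt (insert i A)) (by omega) hd.symm
    have h3 := tensorFil_mul (redComul_genElt_mem i) ih (l := setWt (insert i A)) (by omega) hd.symm
    have h4 := Submodule.add_mem _ (Submodule.add_mem _ h1 h2) h3
    rw [hsum, hins A hi, map_mul]
    convert h4 using 1
    rw [redComul]
    ring

end CoproductFiltration

/-! ### The word basis of the cobar complex -/

section CobarBasis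

open scoped TensorProduct

open Module

variable {n : ℕ} [NeZero n]

theorem counit_genElt (i : Gen n) : counit n (genElt i) = 0 := by
  rw [genElt, map_pow, tGen_of_le i.le, counit, StabAlg.lift_mk_X, zero_pow (by positivity)]

theorem counit_setElt {A : Finset (Gen n)} (hA : A.Nonempty) : counit n (setElt A) = 0 := by
  obtain ⟨i, hi⟩ := hA
  rw [setElt, map_prod]
  exact Finset.prod_eq_zero hi (counit_genElt i)

theorem setElt_empty : setElt (∅ : Finset (Gen n)) = 1 := Finset.prod_empty

/-- The element of the augmentation ideal given by a letter. -/
noncomputable def letterElt (A : Letter (Gen n)) : AugIdeal n :=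
  ⟨setElt A.1, counit_setElt A.2⟩

/-- The products of nonempty sets of generators form a basis of the augmentation ideal. -/
noncomputable def letterBasis (n : ℕ) [NeZero n] : Basis (Letter (Gen n)) (ZMod 2) (AugIdeal n) :=
  Basis.mk (v := letterElt)
    (LinearIndependent.of_comp (AugIdeal n).subtype
      (linearIndependent_setElt.comp (fun A : Letter (Gen n) => A.1) Subtype.val_injective))
    (by
      have h : ∀ x : StabAlg n, augProj n x ∈ Submodule.span (ZMod 2) (Set.range letterElt) := by
        intro x
        have hx : x ∈ Submodule.span (ZMod 2) (Set.range (setElt (n := n))) := by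
          rw [span_setElt]; trivial
        induction hx using Submodule.span_induction with
        | mem x hx =>
          obtain ⟨A, rfl⟩ := hx
          rcases A.eq_empty_or_nonempty with rfl | hA
          · have h0 : augProj n (setElt ∅) = 0 := Subtype.ext <| by
              change setElt ∅ - algebraMap (ZMod 2) (StabAlg n) (counit n (setElt ∅)) = 0
              simp [setElt_empty]
            rw [h0]
            exact Submodule.zero_mem _
          · refine Submodule.subset_span ⟨⟨A, hA⟩, Subtype.ext ?_⟩
            change setElt A = setElt A - algebraMap (ZMod 2) (StabAlg n) (counit n (setElt A))
            rw [counit_setElt hA, map_zero, sub_zero]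
        | zero => rw [map_zero]; exact Submodule.zero_mem _
        | add a b _ _ ha hb => rw [map_add]; exact Submodule.add_mem _ ha hb
        | smul c a _ ha => rw [map_smul]; exact Submodule.smul_mem _ _ ha
      rintro ⟨x, hx⟩ -
      have h1 : augProj n x = ⟨x, hx⟩ := Subtype.ext <| by
        change x - algebraMap (ZMod 2) (StabAlg n) (counit n x) = x
        rw [show counit n x = 0 from hx, map_zero, sub_zero]
      exact h1 ▸ h x)

theorem letterBasis_apply (A : Letter (Gen n)) : letterBasis n A = letterElt A := by
  simp [letterBasis]

theorem bar_letter (A : Letter (Gen n)) :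
    bar n (setElt A.1) = TensorAlgebra.ι (ZMod 2) (letterBasis n A) := by
  rw [bar, LinearMap.comp_apply, letterBasis_apply]
  congr 1
  refine Subtype.ext ?_
  change setElt A.1 - algebraMap (ZMod 2) (StabAlg n) (counit n (setElt A.1)) = setElt A.1
  rw [counit_setElt A.2, map_zero, sub_zero]

/-- The basis of the cobar complex given by the words of letters. -/
noncomputable def wordBasis (n : ℕ) [NeZero n] : Basis (List (Letter (Gen n))) (ZMod 2) (Cobar n) :=
  (letterBasis n).tensorAlgebra.reindex FreeMonoid.toList

theorem wordBasis_apply (w : List (Letter (Gen n))) :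
    wordBasis n w = (w.map fun A => bar n (setElt A.1)).prod := by
  rw [wordBasis, Basis.reindex_apply, Basis.tensorAlgebra, Basis.map_apply]
  simp [FreeAlgebra.basisFreeMonoid, FreeAlgebra.equivMonoidAlgebraFreeMonoid, bar_letter]
  rw [map_list_prod, List.map_map]
  congr 2
  funext A
  exact TensorAlgebra.equivFreeAlgebra_symm_ι _ _

theorem wordBasis_nil : wordBasis n [] = 1 := by simp [wordBasis_apply]

theorem wordBasis_cons (A : Letter (Gen n)) (w : List (Letter (Gen n))) :
    wordBasis n (A :: w) = bar n (setElt A.1) * wordBasis n w := by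
  simp [wordBasis_apply]

theorem wordBasis_append (v w : List (Letter (Gen n))) :
    wordBasis n (v ++ w) = wordBasis n v * wordBasis n w := by
  simp [wordBasis_apply]

/-- The May weight of a word. -/
def wordWt (w : List (Letter (Gen n))) : ℕ := (w.map fun A => setWt A.1).sum

/-- The inner degree of a word. -/
def wordDeg (w : List (Letter (Gen n))) : ZMod (2 * (2 ^ n - 1)) := (w.map fun A => setDeg A.1).sum

theorem image_barWord (P : List (Expo n) → Prop) (Q : List (Letter (Gen n)) → Prop)
    (h : ∀ w : List (Letter (Gen n)), P (w.map fun A => setExpo A.1) ↔ Q w) :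
    barWord n '' {L | IsBarWord n L ∧ P L} = wordBasis n '' {w | Q w} := by
  have hb : ∀ w : List (Letter (Gen n)), barWord n (w.map fun A => setExpo A.1) = wordBasis n w := by
    intro w
    rw [barWord, List.map_map, wordBasis_apply]
    congr 2
    funext A
    simp [tMonomial_setExpo]
  ext x
  constructor
  · rintro ⟨L, ⟨hL, hP⟩, rfl⟩
    have hw : ∃ w : List (Letter (Gen n)), w.map (fun A => setExpo A.1) = L := by
      clear hP
      induction L with
      | nil => exact ⟨[], rfl⟩
      | cons e L ih =>
        obtain ⟨w, hw⟩ := ih fun e' he' => hL e' (List.mem_cons_of_mem _ he')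
        obtain ⟨h0, h1⟩ := hL e List.mem_cons_self
        obtain ⟨A, rfl⟩ := exists_setExpo_eq e h1
        refine ⟨⟨A, ?_⟩ :: w, by simp [hw]⟩
        rw [Finset.nonempty_iff_ne_empty]
        rintro rfl
        exact h0 (by simp [setExpo])
    obtain ⟨w, rfl⟩ := hw
    exact ⟨w, (h w).1 hP, (hb w).symm⟩
  · rintro ⟨w, hw, rfl⟩
    refine ⟨w.map fun A => setExpo A.1, ⟨fun e he => ?_, (h w).2 hw⟩, hb w⟩
    obtain ⟨A, -, rfl⟩ := List.mem_map.1 he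
    refine ⟨fun h0 => A.2.ne_empty (setExpo_injective ?_), setExpo_lt _⟩
    rw [h0]
    simp [setExpo]

theorem cobarPart_eq (s : ℤ) (t : ZMod (2 * (2 ^ n - 1))) : cobarPart n s t =
    Submodule.span (ZMod 2) (wordBasis n '' {w | (w.length : ℤ) = s ∧ wordDeg w = t}) := by
  rw [cobarPart, image_barWord]
  intro w
  rw [List.length_map, List.map_map, wordDeg]
  simp only [Function.comp_def, expoDeg_setExpo]

theorem mayFil_eq (s : ℤ) (t : ZMod (2 * (2 ^ n - 1))) (M : ℤ) : mayFil n s t M =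
    Submodule.span (ZMod 2) (wordBasis n ''
      {w | (w.length : ℤ) = s ∧ wordDeg w = t ∧ (wordWt w : ℤ) ≤ M}) := by
  rw [mayFil, image_barWord]
  intro w
  rw [List.length_map, List.map_map, List.map_map, wordDeg, wordWt]
  simp only [Function.comp_def, expoDeg_setExpo, expoMay_setExpo]

theorem mem_span_wordBasis {P : Set (List (Letter (Gen n)))} {x : Cobar n} :
    x ∈ Submodule.span (ZMod 2) (wordBasis n '' P) ↔ ∀ w, (wordBasis n).repr x w ≠ 0 → w ∈ P := by
  rw [(wordBasis n).mem_span_image]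
  constructor
  · exact fun h w hw => h (Finsupp.mem_support_iff.2 hw)
  · exact fun h w hw => h w (Finsupp.mem_support_iff.1 hw)

/-- The part of weight at most `M` of the cobar complex, in all bidegrees. -/
noncomputable def wtFil (n : ℕ) [NeZero n] (M : ℤ) : Submodule (ZMod 2) (Cobar n) :=
  Submodule.span (ZMod 2) (wordBasis n '' {w | (wordWt w : ℤ) ≤ M})

theorem mem_wtFil {x : Cobar n} {M : ℤ} :
    x ∈ wtFil n M ↔ ∀ w, (wordBasis n).repr x w ≠ 0 → (wordWt w : ℤ) ≤ M :=
  mem_span_wordBasis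

theorem wtFil_mono {M M' : ℤ} (h : M ≤ M') : wtFil n M ≤ wtFil n M' :=
  Submodule.span_mono (Set.image_mono fun _ hw => le_trans hw h)

theorem mayFil_mono {s : ℤ} {t : ZMod (2 * (2 ^ n - 1))} {M M' : ℤ} (h : M ≤ M') :
    mayFil n s t M ≤ mayFil n s t M' := by
  rw [mayFil_eq, mayFil_eq]
  exact Submodule.span_mono (Set.image_mono fun _ hw => ⟨hw.1, hw.2.1, hw.2.2.trans h⟩)

theorem mayFil_le_wtFil (s : ℤ) (t : ZMod (2 * (2 ^ n - 1))) (M : ℤ) :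
    mayFil n s t M ≤ wtFil n M := by
  rw [mayFil_eq]
  exact Submodule.span_mono (Set.image_mono fun _ hw => hw.2.2)

theorem mayFil_le_cobarPart (s : ℤ) (t : ZMod (2 * (2 ^ n - 1))) (M : ℤ) :
    mayFil n s t M ≤ cobarPart n s t := by
  rw [mayFil_eq, cobarPart_eq]
  exact Submodule.span_mono (Set.image_mono fun _ hw => ⟨hw.1, hw.2.1⟩)

theorem mem_mayFil_iff {s : ℤ} {t : ZMod (2 * (2 ^ n - 1))} {M : ℤ} {x : Cobar n} :
    x ∈ mayFil n s t M ↔ x ∈ cobarPart n s t ∧ x ∈ wtFil n M := by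
  rw [mayFil_eq, cobarPart_eq, wtFil, mem_span_wordBasis, mem_span_wordBasis, mem_span_wordBasis]
  exact ⟨fun h => ⟨fun w hw => ⟨(h w hw).1, (h w hw).2.1⟩, fun w hw => (h w hw).2.2⟩,
    fun h w hw => ⟨(h.1 w hw).1, (h.1 w hw).2, h.2 w hw⟩⟩

theorem span_mul_mem {P Q R : Set (List (Letter (Gen n)))} (h : ∀ v ∈ P, ∀ w ∈ Q, v ++ w ∈ R)
    {x y : Cobar n} (hx : x ∈ Submodule.span (ZMod 2) (wordBasis n '' P))
    (hy : y ∈ Submodule.span (ZMod 2) (wordBasis n '' Q)) :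
    x * y ∈ Submodule.span (ZMod 2) (wordBasis n '' R) := by
  have h1 := Submodule.mul_mem_mul hx hy
  rw [Submodule.span_mul_span] at h1
  refine Submodule.span_mono ?_ h1
  rintro _ ⟨_, ⟨v, hv, rfl⟩, _, ⟨w, hw, rfl⟩, rfl⟩
  exact ⟨v ++ w, h v hv w hw, wordBasis_append v w⟩

theorem wordWt_append (v w : List (Letter (Gen n))) : wordWt (v ++ w) = wordWt v + wordWt w := by
  simp [wordWt]

theorem wordDeg_append (v w : List (Letter (Gen n))) : wordDeg (v ++ w) = wordDeg v + wordDeg w := by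
  simp [wordDeg]

theorem mayFil_mul {x y : Cobar n} {s s' r : ℤ} {t t' u : ZMod (2 * (2 ^ n - 1))} {M M' L : ℤ}
    (hx : x ∈ mayFil n s t M) (hy : y ∈ mayFil n s' t' M') (hr : s + s' = r) (hu : t + t' = u)
    (hL : M + M' ≤ L) : x * y ∈ mayFil n r u L := by
  rw [mayFil_eq] at hx hy ⊢
  refine span_mul_mem (fun v hv w hw => ?_) hx hy
  simp only [Set.mem_ofPred_eq] at hv hw ⊢
  rw [wordWt_append, wordDeg_append, hv.2.1, hw.2.1, List.length_append]
  push_cast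
  exact ⟨by omega, hu, by omega⟩

theorem wordBasis_mem_mayFil (w : List (Letter (Gen n))) :
    wordBasis n w ∈ mayFil n w.length (wordDeg w) (wordWt w) := by
  rw [mayFil_eq]
  exact Submodule.subset_span ⟨w, ⟨rfl, rfl, le_rfl⟩, rfl⟩

theorem bar_setElt_mem (A : Finset (Gen n)) : bar n (setElt A) ∈ mayFil n 1 (setDeg A) (setWt A) := by
  rcases A.eq_empty_or_nonempty with rfl | hA
  · rw [setElt_empty, bar_one]
    exact Submodule.zero_mem _
  · have h := wordBasis_mem_mayFil [(⟨A, hA⟩ : Letter (Gen n))]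
    simpa [wordBasis_apply, wordDeg, wordWt] using h

/-- The juxtaposition `x ⊗ y ↦ [x|y]`. -/
noncomputable def barTensor (n : ℕ) : StabAlg n ⊗[ZMod 2] StabAlg n →ₗ[ZMod 2] Cobar n :=
  (LinearMap.mul' (ZMod 2) (Cobar n)).comp (TensorProduct.map (bar n) (bar n))

theorem barTensor_tmul (x y : StabAlg n) : barTensor n (x ⊗ₜ y) = bar n x * bar n y := rfl

theorem barComul_eq (x : StabAlg n) : barComul n x = barTensor n (comul n x) := rfl

theorem barComul_eq_redComul (x : StabAlg n) : barComul n x = barTensor n (redComul x) := by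
  rw [barComul_eq, redComul, map_sub, map_sub, barTensor_tmul, barTensor_tmul, bar_one, mul_zero,
    zero_mul, sub_zero, sub_zero]

theorem barTensor_mem {z : StabAlg n ⊗[ZMod 2] StabAlg n} {m : ℕ} {t : ZMod (2 * (2 ^ n - 1))}
    (hz : z ∈ tensorFil n m t) : barTensor n z ∈ mayFil n 2 t (m - 1) := by
  induction hz using Submodule.span_induction with
  | mem z hz =>
    obtain ⟨⟨A, B⟩, ⟨h1, h2⟩, rfl⟩ := hz
    simp only at h1 h2
    exact mayFil_mul (bar_setElt_mem A) (bar_setElt_mem B) rfl h2 (by push_cast; omega)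
  | zero => rw [map_zero]; exact Submodule.zero_mem _
  | add a b _ _ ha hb => rw [map_add]; exact Submodule.add_mem _ ha hb
  | smul c a _ ha => rw [map_smul]; exact Submodule.smul_mem _ _ ha

/-- The part of the differential of the cobar complex that preserves the weight. -/
noncomputable def splitD (n : ℕ) [NeZero n] : Cobar n →ₗ[ZMod 2] Cobar n :=
  (wordBasis n).repr.symm.toLinearMap.comp (extD.comp (wordBasis n).repr.toLinearMap)

theorem repr_splitD (x : Cobar n) :
    (wordBasis n).repr (splitD n x) = extD ((wordBasis n).repr x) := by
  simp [splitD]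

theorem repr_bar_mul (A : Finset (Gen n)) (x : Cobar n) :
    (wordBasis n).repr (bar n (setElt A) * x) = consLin A ((wordBasis n).repr x) := by
  by_cases hA : A.Nonempty
  · have h : ((wordBasis n).repr.toLinearMap.comp (LinearMap.mulLeft (ZMod 2) (bar n (setElt A)))) =
        (consLin A).comp (wordBasis n).repr.toLinearMap := by
      refine (wordBasis n).ext fun w => ?_
      have h1 := consLin_letter (⟨A, hA⟩ : Letter (Gen n))
      simp only at h1
      rw [LinearMap.comp_apply, LinearMap.mulLeft_apply, ← wordBasis_cons ⟨A, hA⟩]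
      simp [h1, Finsupp.mapDomain_single]
    exact DFunLike.congr_fun h x
  · rw [Finset.not_nonempty_iff_eq_empty] at hA
    subst hA
    rw [setElt_empty, bar_one, zero_mul, map_zero]
    simp [consLin]

theorem splitD_wordBasis_cons (A : Letter (Gen n)) (w : List (Letter (Gen n))) :
    splitD n (wordBasis n (A :: w)) =
      (∑ B ∈ A.1.powerset, bar n (setElt B) * bar n (setElt (A.1 \ B))) * wordBasis n w +
      bar n (setElt A.1) * splitD n (wordBasis n w) := by
  apply (wordBasis n).repr.injective
  rw [repr_splitD, Basis.repr_self, extD_single, wordD_cons, map_add, repr_bar_mul, repr_splitD,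
    Basis.repr_self, extD_single, Finset.sum_mul, map_sum]
  congr 1
  refine Finset.sum_congr rfl fun B _ => ?_
  rw [mul_assoc, repr_bar_mul, repr_bar_mul, Basis.repr_self]

theorem splitD_one : splitD n (wordBasis n []) = 0 := by
  apply (wordBasis n).repr.injective
  rw [repr_splitD, Basis.repr_self, extD_single, map_zero, wordD]

theorem cobarD_one : cobarD n 1 = 0 := by
  have := cobarD_mul n 1 1
  rw [mul_one, one_mul, mul_one] at this
  simpa using this

theorem cobarD_wordBasis_cons (A : Letter (Gen n)) (w : List (Letter (Gen n))) :
    cobarD n (wordBasis n (A :: w)) =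
      barComul n (setElt A.1) * wordBasis n w + bar n (setElt A.1) * cobarD n (wordBasis n w) := by
  rw [wordBasis_cons, cobarD_mul, cobarD_bar]

theorem barComul_sub_mem (A : Finset (Gen n)) :
    barComul n (setElt A) - ∑ B ∈ A.powerset, bar n (setElt B) * bar n (setElt (A \ B)) ∈
      mayFil n 2 (setDeg A) (setWt A - 1) := by
  have h := barTensor_mem (comul_setElt_sub_mem A)
  rw [map_sub, map_sum] at h
  exact h

theorem wordWt_cons (A : Letter (Gen n)) (w : List (Letter (Gen n))) :
    wordWt (A :: w) = setWt A.1 + wordWt w := by simp [wordWt]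

theorem wordDeg_cons (A : Letter (Gen n)) (w : List (Letter (Gen n))) :
    wordDeg (A :: w) = setDeg A.1 + wordDeg w := by simp [wordDeg]

/-- The difference of the differential and its weight-preserving part lowers the weight. -/
theorem cobarD_sub_splitD_wordBasis (w : List (Letter (Gen n))) :
    cobarD n (wordBasis n w) - splitD n (wordBasis n w) ∈
      mayFil n (w.length + 1) (wordDeg w) (wordWt w - 1) := by
  induction w with
  | nil =>
    rw [splitD_one, wordBasis_nil, cobarD_one, sub_zero]
    exact Submodule.zero_mem _
  | cons A w ih =>
    rw [cobarD_wordBasis_cons, splitD_wordBasis_cons, add_sub_add_comm, ← sub_mul, ← mul_sub]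
    refine Submodule.add_mem _ (mayFil_mul (barComul_sub_mem A.1) (wordBasis_mem_mayFil w) ?_ ?_ ?_)
      (mayFil_mul (bar_setElt_mem A.1) ih ?_ ?_ ?_)
    all_goals simp only [wordWt_cons, wordDeg_cons, List.length_cons]
    all_goals push_cast
    all_goals ring_nf
    all_goals rfl

theorem splitD_wordBasis_mem (w : List (Letter (Gen n))) :
    splitD n (wordBasis n w) ∈ mayFil n (w.length + 1) (wordDeg w) (wordWt w) := by
  rw [mayFil_eq, mem_span_wordBasis]
  intro v hv
  rw [repr_splitD, Basis.repr_self, extD_single] at hv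
  have h := split_of_wordD hv
  refine ⟨by rw [h.length_eq]; push_cast; rfl, (h.sum_eq Gen.deg).symm, ?_⟩
  exact_mod_cast (h.sum_eq Gen.wt).symm.le

theorem cobarD_wordBasis_mem (w : List (Letter (Gen n))) :
    cobarD n (wordBasis n w) ∈ mayFil n (w.length + 1) (wordDeg w) (wordWt w) := by
  rw [← sub_add_cancel (cobarD n (wordBasis n w)) (splitD n (wordBasis n w))]
  exact Submodule.add_mem _ (mayFil_mono (by omega) (cobarD_sub_splitD_wordBasis w))
    (splitD_wordBasis_mem w)

theorem map_mem_of_span {P : Set (List (Letter (Gen n)))} {N : Submodule (ZMod 2) (Cobar n)}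
    {f : Cobar n →ₗ[ZMod 2] Cobar n} (h : ∀ w ∈ P, f (wordBasis n w) ∈ N) {x : Cobar n}
    (hx : x ∈ Submodule.span (ZMod 2) (wordBasis n '' P)) : f x ∈ N := by
  have : Submodule.span (ZMod 2) (wordBasis n '' P) ≤ N.comap f := by
    rw [Submodule.span_le]
    rintro _ ⟨w, hw, rfl⟩
    exact h w hw
  exact this hx

theorem cobarD_sub_splitD_mem {x : Cobar n} {M : ℤ} (hx : x ∈ wtFil n M) :
    cobarD n x - splitD n x ∈ wtFil n (M - 1) :=
  map_mem_of_span (f := cobarD n - splitD n) (fun w hw =>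
    wtFil_mono (by have : (wordWt w : ℤ) ≤ M := hw; omega)
      (mayFil_le_wtFil _ _ _ (cobarD_sub_splitD_wordBasis w))) hx

theorem cobarD_mem_wtFil {x : Cobar n} {M : ℤ} (hx : x ∈ wtFil n M) : cobarD n x ∈ wtFil n M :=
  map_mem_of_span (fun w hw => wtFil_mono hw
      (mayFil_le_wtFil _ _ _ (cobarD_wordBasis_mem w))) hx

theorem cobarD_mem_cobarPart {x : Cobar n} {s : ℤ} {t : ZMod (2 * (2 ^ n - 1))}
    (hx : x ∈ cobarPart n s t) : cobarD n x ∈ cobarPart n (s + 1) t := by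
  rw [cobarPart_eq] at hx
  refine map_mem_of_span (fun w hw => ?_) hx
  rw [← hw.1, ← hw.2]
  exact mayFil_le_cobarPart _ _ _ (cobarD_wordBasis_mem w)

/-- The projection of the cobar complex onto its part of bidegree `(s, t)`. -/
noncomputable def partProj (n : ℕ) [NeZero n] (s : ℤ) (t : ZMod (2 * (2 ^ n - 1))) :
    Cobar n →ₗ[ZMod 2] Cobar n := by
  classical
  exact (wordBasis n).constr (ZMod 2) fun w =>
    if (w.length : ℤ) = s ∧ wordDeg w = t then wordBasis n w else 0

theorem partProj_wordBasis_of {s : ℤ} {t : ZMod (2 * (2 ^ n - 1))} {w : List (Letter (Gen n))}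
    (h : (w.length : ℤ) = s ∧ wordDeg w = t) : partProj n s t (wordBasis n w) = wordBasis n w := by
  rw [partProj, Basis.constr_basis, if_pos h]

theorem partProj_wordBasis_of_not {s : ℤ} {t : ZMod (2 * (2 ^ n - 1))} {w : List (Letter (Gen n))}
    (h : ¬((w.length : ℤ) = s ∧ wordDeg w = t)) : partProj n s t (wordBasis n w) = 0 := by
  rw [partProj, Basis.constr_basis, if_neg h]

theorem partProj_eq_self {s : ℤ} {t : ZMod (2 * (2 ^ n - 1))} {x : Cobar n}
    (hx : x ∈ cobarPart n s t) : partProj n s t x = x := by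
  rw [cobarPart_eq] at hx
  have := map_mem_of_span (f := partProj n s t - LinearMap.id) (N := ⊥) (fun w hw => by
    rw [LinearMap.sub_apply, partProj_wordBasis_of hw]
    simp) hx
  simpa [sub_eq_zero] using this

theorem partProj_eq_zero {s s' : ℤ} {t t' : ZMod (2 * (2 ^ n - 1))} {x : Cobar n}
    (hx : x ∈ cobarPart n s' t') (h : ¬(s' = s ∧ t' = t)) : partProj n s t x = 0 := by
  rw [cobarPart_eq] at hx
  have := map_mem_of_span (f := partProj n s t) (N := ⊥) (fun w hw => by
    rw [partProj_wordBasis_of_not, Submodule.mem_bot]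
    rw [hw.1, hw.2]
    exact h) hx
  simpa using this

theorem partProj_mem {x : Cobar n} {M : ℤ} (s : ℤ) (t : ZMod (2 * (2 ^ n - 1)))
    (hx : x ∈ wtFil n M) : partProj n s t x ∈ mayFil n s t M := by
  refine map_mem_of_span (fun w hw => ?_) hx
  by_cases h : (w.length : ℤ) = s ∧ wordDeg w = t
  · rw [partProj_wordBasis_of h, ← h.1, ← h.2]
    exact mayFil_mono hw (wordBasis_mem_mayFil w)
  · rw [partProj_wordBasis_of_not h]
    exact Submodule.zero_mem _

theorem partProj_cobarD (s : ℤ) (t : ZMod (2 * (2 ^ n - 1))) (x : Cobar n) :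
    partProj n (s + 1) t (cobarD n x) = cobarD n (partProj n s t x) := by
  have h : (partProj n (s + 1) t).comp (cobarD n) = (cobarD n).comp (partProj n s t) := by
    refine (wordBasis n).ext fun w => ?_
    rw [LinearMap.comp_apply, LinearMap.comp_apply]
    have h1 := mayFil_le_cobarPart _ _ _ (cobarD_wordBasis_mem w)
    by_cases hw : (w.length : ℤ) = s ∧ wordDeg w = t
    · rw [partProj_wordBasis_of hw]
      rw [hw.1, hw.2] at h1
      exact partProj_eq_self h1
    · rw [partProj_wordBasis_of_not hw, map_zero]
      refine partProj_eq_zero h1 fun h2 => hw ⟨by omega, h2.2⟩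
  exact DFunLike.congr_fun h x

theorem exists_mem_wtFil (x : Cobar n) : ∃ M : ℕ, x ∈ wtFil n M := by
  refine ⟨((wordBasis n).repr x).support.sup wordWt, mem_wtFil.2 fun w hw => ?_⟩
  exact_mod_cast Finset.le_sup (f := wordWt) (Finsupp.mem_support_iff.2 hw)

end CobarBasis

/-! ### Symbols of cochains -/

section Symbols

open Module

open MvPolynomial (coeff monomial)

variable {n : ℕ} [NeZero n]

/-- The polynomials of weight at most `M`. -/
noncomputable def polyFil (n : ℕ) [NeZero n] (M : ℤ) :
    Submodule (ZMod 2) (MvPolynomial (Gen n) (ZMod 2)) where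
  carrier := {f | ∀ μ, coeff μ f ≠ 0 → (monoWt μ : ℤ) ≤ M}
  zero_mem' := fun μ h => absurd (MvPolynomial.coeff_zero μ) h
  add_mem' := fun {f g} hf hg μ h => by
    by_cases h1 : coeff μ f = 0
    · refine hg μ fun h2 => h ?_
      rw [MvPolynomial.coeff_add, h1, h2, add_zero]
    · exact hf μ h1
  smul_mem' := fun c f hf μ h => hf μ fun h1 => h (by rw [MvPolynomial.coeff_smul, h1, smul_zero])

/-- The polynomials that are homogeneous of weight `M`. -/
noncomputable def polyHom (n : ℕ) [NeZero n] (M : ℤ) :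
    Submodule (ZMod 2) (MvPolynomial (Gen n) (ZMod 2)) where
  carrier := {f | ∀ μ, coeff μ f ≠ 0 → (monoWt μ : ℤ) = M}
  zero_mem' := fun μ h => absurd (MvPolynomial.coeff_zero μ) h
  add_mem' := fun {f g} hf hg μ h => by
    by_cases h1 : coeff μ f = 0
    · refine hg μ fun h2 => h ?_
      rw [MvPolynomial.coeff_add, h1, h2, add_zero]
    · exact hf μ h1
  smul_mem' := fun c f hf μ h => hf μ fun h1 => h (by rw [MvPolynomial.coeff_smul, h1, smul_zero])

theorem polyFil_mono {M M' : ℤ} (h : M ≤ M') : polyFil n M ≤ polyFil n M' :=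
  fun _ hf μ hμ => (hf μ hμ).trans h

theorem polyHom_le (M : ℤ) : polyHom n M ≤ polyFil n M := fun _ hf μ hμ => (hf μ hμ).le

theorem eq_zero_of_mem_polyHom {M : ℤ} {f : MvPolynomial (Gen n) (ZMod 2)} (h : f ∈ polyHom n M)
    (h' : f ∈ polyFil n (M - 1)) : f = 0 := by
  ext μ
  rw [MvPolynomial.coeff_zero]
  by_contra h1
  have h2 := h μ h1
  have h3 := h' μ h1
  omega

theorem exists_polyHom {M : ℤ} {f : MvPolynomial (Gen n) (ZMod 2)} (h : f ∈ polyFil n M) :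
    ∃ g ∈ polyHom n M, f - g ∈ polyFil n (M - 1) := by
  classical
  refine ⟨∑ μ ∈ f.support with (monoWt μ : ℤ) = M, monomial μ (coeff μ f), ?_, ?_⟩
  · refine Submodule.sum_mem _ fun μ hμ => ?_
    intro v hv
    rw [MvPolynomial.coeff_monomial] at hv
    split_ifs at hv with h1
    · rw [← h1]
      exact (Finset.mem_filter.1 hμ).2
    · exact absurd rfl hv
  · intro v hv
    rw [MvPolynomial.coeff_sub, MvPolynomial.coeff_sum] at hv
    simp only [MvPolynomial.coeff_monomial] at hv
    rw [Finset.sum_ite_eq'] at hv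
    have hv0 : coeff v f ≠ 0 := by
      intro h0
      rw [h0] at hv
      simp at hv
    rcases (h v hv0).lt_or_eq with h1 | h1
    · omega
    · rw [if_pos (Finset.mem_filter.2 ⟨MvPolynomial.mem_support_iff.2 hv0, h1⟩), sub_self] at hv
      exact absurd rfl hv

theorem polyFil_mul {f g : MvPolynomial (Gen n) (ZMod 2)} {M M' L : ℤ} (hf : f ∈ polyFil n M)
    (hg : g ∈ polyFil n M') (hL : M + M' ≤ L) : f * g ∈ polyFil n L := by
  classical
  intro μ hμ
  rw [MvPolynomial.coeff_mul] at hμ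
  obtain ⟨⟨a, b⟩, hab, h⟩ := Finset.exists_ne_zero_of_sum_ne_zero hμ
  have h1 := hf a (left_ne_zero_of_mul h)
  have h2 := hg b (right_ne_zero_of_mul h)
  rw [← Finset.HasAntidiagonal.mem_antidiagonal.1 hab, monoWt_add]
  push_cast
  omega

theorem polyHom_mul {f g : MvPolynomial (Gen n) (ZMod 2)} {M M' : ℤ} (hf : f ∈ polyHom n M)
    (hg : g ∈ polyHom n M') : f * g ∈ polyHom n (M + M') := by
  classical
  intro μ hμ
  rw [MvPolynomial.coeff_mul] at hμ
  obtain ⟨⟨a, b⟩, hab, h⟩ := Finset.exists_ne_zero_of_sum_ne_zero hμ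
  rw [← Finset.HasAntidiagonal.mem_antidiagonal.1 hab, monoWt_add, Nat.cast_add,
    hf a (left_ne_zero_of_mul h), hg b (right_ne_zero_of_mul h)]

theorem monomial_mem_polyHom (μ : Gen n →₀ ℕ) : monomial μ 1 ∈ polyHom n (monoWt μ) := by
  classical
  intro v hv
  rw [MvPolynomial.coeff_monomial] at hv
  split_ifs at hv with h1
  · rw [h1]
  · exact absurd rfl hv

theorem X_mem_polyHom (i : Gen n) : MvPolynomial.X i ∈ polyHom n i.wt := by
  have := monomial_mem_polyHom (Finsupp.single i 1)
  rwa [monoWt_single, one_mul] at this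

theorem one_mem_polyHom : (1 : MvPolynomial (Gen n) (ZMod 2)) ∈ polyHom n 0 := by
  have := monomial_mem_polyHom (0 : Gen n →₀ ℕ)
  rwa [show monoWt (0 : Gen n →₀ ℕ) = 0 from Finsupp.sum_zero_index] at this

theorem critPoly_mem_polyHom (μ : Gen n →₀ ℕ) : critPoly μ ∈ polyHom n (monoWt μ) := by
  set b := (Gen.base n).succ with hb
  have h1 : rhoPoly n ∈ polyHom n b.wt :=
    Submodule.sum_mem _ fun j _ => X_mem_polyHom _
  have h2 : ∀ k : ℕ, rhoPoly n ^ k ∈ polyHom n (k * b.wt : ℕ) := by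
    intro k
    induction k with
    | zero => simpa using one_mem_polyHom (n := n)
    | succ k ih =>
      rw [pow_succ, add_mul, one_mul, Nat.cast_add]
      exact polyHom_mul ih h1
  have h3 : monoWt μ = monoWt (μ.erase b) + μ b * b.wt := by
    conv_lhs => rw [← Finsupp.erase_add_single b μ]
    rw [monoWt_add, monoWt_single]
  rw [h3, Nat.cast_add]
  exact polyHom_mul (monomial_mem_polyHom _) (h2 _)

theorem exists_coeff_polyD {f : MvPolynomial (Gen n) (ZMod 2)} {v : Gen n →₀ ℕ}
    (h : coeff v (polyD f) ≠ 0) : ∃ μ, coeff μ f ≠ 0 ∧ monoWt μ = monoWt v + 1 := by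
  rw [f.as_sum, map_sum, MvPolynomial.coeff_sum] at h
  obtain ⟨μ, hμ, h1⟩ := Finset.exists_ne_zero_of_sum_ne_zero h
  refine ⟨μ, MvPolynomial.mem_support_iff.1 hμ, monoWt_of_coeff_polyD (v := v) fun h2 => h1 ?_⟩
  have h3 : monomial μ (coeff μ f) = coeff μ f • monomial μ (1 : ZMod 2) := by
    rw [MvPolynomial.smul_monomial, smul_eq_mul, mul_one]
  rw [h3, Derivation.map_smul, MvPolynomial.coeff_smul, h2, smul_zero]

theorem polyD_mem_polyHom {f : MvPolynomial (Gen n) (ZMod 2)} {M : ℤ} (hf : f ∈ polyHom n M) :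
    polyD f ∈ polyHom n (M - 1) := fun v hv => by
  obtain ⟨μ, h1, h2⟩ := exists_coeff_polyD hv
  have := hf μ h1
  omega

/-- The symbol of a cochain: the algebra homomorphism to the polynomial algebra that sends the
generators to the variables and products of at least two generators to zero. -/
noncomputable def symb (n : ℕ) [NeZero n] : Cobar n →ₐ[ZMod 2] MvPolynomial (Gen n) (ZMod 2) :=
  TensorAlgebra.lift (ZMod 2) ((letterBasis n).constr (ZMod 2) letterVal)

theorem symb_bar_letter (A : Letter (Gen n)) : symb n (bar n (setElt A.1)) = letterVal A := by
  rw [bar_letter, symb, TensorAlgebra.lift_ι_apply, Basis.constr_basis]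

theorem symb_wordBasis (w : List (Letter (Gen n))) : symb n (wordBasis n w) = wordVal w := by
  rw [wordBasis_apply, map_list_prod, List.map_map, wordVal]
  congr 2
  funext A
  exact symb_bar_letter A

theorem symb_eq (x : Cobar n) :
    symb n x = Finsupp.linearCombination (ZMod 2) wordVal ((wordBasis n).repr x) := by
  have h : (symb n).toLinearMap = (Finsupp.linearCombination (ZMod 2) wordVal).comp
      (wordBasis n).repr.toLinearMap := by
    refine (wordBasis n).ext fun w => ?_
    simp [symb_wordBasis]
  exact DFunLike.congr_fun h x

theorem setElt_singleton (i : Gen n) : setElt {i} = genElt i := Finset.prod_singleton _ _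

theorem symb_bar_genElt (i : Gen n) : symb n (bar n (genElt i)) = MvPolynomial.X i := by
  have := symb_bar_letter (Letter.sing i)
  rwa [letterVal_sing, Letter.sing, setElt_singleton] at this

theorem letterVal_mem (A : Letter (Gen n)) : letterVal A ∈ polyHom n (setWt A.1) := by
  rw [letterVal]
  split_ifs with h
  · obtain ⟨i, hi⟩ := Finset.card_eq_one.1 h
    have hA : A = Letter.sing i := Subtype.ext hi
    rw [hA, Letter.top_sing]
    have := X_mem_polyHom i
    simpa [setWt, Letter.sing] using this
  · exact Submodule.zero_mem _

theorem wordVal_mem (w : List (Letter (Gen n))) : wordVal w ∈ polyHom n (wordWt w) := by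
  induction w with
  | nil => simpa [wordVal, wordWt] using one_mem_polyHom (n := n)
  | cons A w ih =>
    rw [wordVal, List.map_cons, List.prod_cons, wordWt_cons, Nat.cast_add]
    exact polyHom_mul (letterVal_mem A) ih

theorem symb_mem {x : Cobar n} {M : ℤ} (hx : x ∈ wtFil n M) : symb n x ∈ polyFil n M := by
  have h : wtFil n M ≤ (polyFil n M).comap (symb n).toLinearMap := by
    rw [wtFil, Submodule.span_le]
    rintro _ ⟨w, hw, rfl⟩
    change symb n (wordBasis n w) ∈ polyFil n M
    rw [symb_wordBasis]
    exact polyFil_mono hw (polyHom_le _ (wordVal_mem w))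
  exact h hx

theorem symb_splitD (x : Cobar n) : symb n (splitD n x) = 0 := by
  have h : (symb n).toLinearMap.comp (splitD n) = 0 := by
    refine (wordBasis n).ext fun w => ?_
    rw [LinearMap.comp_apply, AlgHom.toLinearMap_apply, symb_eq, repr_splitD, Basis.repr_self,
      extD_single, wordVal_wordD]
    rfl
  exact DFunLike.congr_fun h x

theorem symb_cobarD_mem {x : Cobar n} {M : ℤ} (hx : x ∈ wtFil n M) :
    symb n (cobarD n x) ∈ polyFil n (M - 1) := by
  have h := symb_mem (cobarD_sub_splitD_mem hx)
  rwa [map_sub, symb_splitD, sub_zero] at h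

theorem symb_barComul_genElt_sub (i : Gen n) :
    symb n (barComul n (genElt i)) - genD i ∈ polyFil n (i.wt - 2) := by
  rw [barComul_eq_redComul]
  rcases lt_or_ge i.lev (2 * n) with h | h
  · rw [redComul_genElt_of_lt h, genD_of_lt h, map_zero, map_zero, sub_zero]
    exact Submodule.zero_mem _
  · obtain ⟨i, rfl⟩ := i.exists_succ_eq h
    have h1 := symb_mem (mayFil_le_wtFil _ _ _ (barTensor_mem (redComul_genElt_succ_mem i)))
    rw [map_sub, map_sub, map_sub, map_sub, barTensor_tmul, map_mul, symb_bar_genElt,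
      apply_ite (barTensor n), apply_ite (symb n), barTensor_tmul, map_mul, symb_bar_genElt,
      map_zero, map_zero, sub_sub, ← sq, ← sq, ← genD_succ] at h1
    refine polyFil_mono ?_ h1
    have := i.wt_succ
    omega

theorem wordWt_map_sing (l : List (Gen n)) :
    wordWt (l.map Letter.sing) = monoWt (Multiset.toFinsupp (l : Multiset (Gen n))) := by
  induction l with
  | nil => simp [wordWt, monoWt]
  | cons i l ih =>
    rw [List.map_cons, wordWt_cons, ih, ← Multiset.cons_coe, ← Multiset.singleton_add, map_add,
      monoWt_add, Multiset.toFinsupp_singleton, monoWt_single, one_mul]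
    simp [setWt, Letter.sing]

theorem splitD_map_sing (l : List (Gen n)) : splitD n (wordBasis n (l.map Letter.sing)) = 0 := by
  induction l with
  | nil => exact splitD_one
  | cons i l ih =>
    rw [List.map_cons, splitD_wordBasis_cons, ih, mul_zero, add_zero, Letter.sing,
      Finset.sum_eq_zero, zero_mul]
    intro B hB
    rcases Finset.subset_singleton_iff.1 (Finset.mem_powerset.1 hB) with rfl | rfl
    · rw [setElt_empty, bar_one, zero_mul]
    · rw [Finset.sdiff_self, setElt_empty, bar_one, mul_zero]

/-- On words of generators the differential is given on symbols by the derivation `polyD`. -/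
theorem symb_cobarD_map_sing (l : List (Gen n)) :
    symb n (cobarD n (wordBasis n (l.map Letter.sing))) - polyD (wordVal (l.map Letter.sing)) ∈
      polyFil n (wordWt (l.map Letter.sing) - 2) := by
  induction l with
  | nil =>
    simp only [List.map_nil]
    rw [wordBasis_nil, cobarD_one]
    simp [wordVal]
  | cons i l ih =>
    have h1 : polyD (wordVal ((i :: l).map Letter.sing)) =
        genD i * wordVal (l.map Letter.sing) +
        MvPolynomial.X i * polyD (wordVal (l.map Letter.sing)) := by
      rw [List.map_cons, wordVal, List.map_cons, List.prod_cons, letterVal_sing, Derivation.leibniz,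
        polyD_X, smul_eq_mul, smul_eq_mul, ← wordVal]
      ring
    have hs : setElt (Letter.sing i).1 = genElt i := setElt_singleton i
    rw [h1, List.map_cons, cobarD_wordBasis_cons, hs, map_add, map_mul, map_mul, symb_bar_genElt,
      symb_wordBasis, add_sub_add_comm, ← sub_mul, ← mul_sub, wordWt_cons]
    have hw : setWt (Letter.sing i).1 = i.wt := by simp [setWt, Letter.sing]
    rw [hw]
    exact Submodule.add_mem _
      (polyFil_mul (symb_barComul_genElt_sub i) (polyHom_le _ (wordVal_mem _)) (by push_cast; omega))
      (polyFil_mul (polyHom_le _ (X_mem_polyHom i)) ih (by push_cast; omega))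

/-- The linear section of the symbol that sends a monomial to a word of generators. -/
noncomputable def polyLift (n : ℕ) [NeZero n] : MvPolynomial (Gen n) (ZMod 2) →ₗ[ZMod 2] Cobar n :=
  (MvPolynomial.basisMonomials (Gen n) (ZMod 2)).constr (ZMod 2) fun μ =>
    wordBasis n ((Finsupp.toMultiset μ).toList.map Letter.sing)

theorem polyLift_monomial (μ : Gen n →₀ ℕ) : polyLift n (monomial μ 1) =
    wordBasis n ((Finsupp.toMultiset μ).toList.map Letter.sing) := by
  have := (MvPolynomial.basisMonomials (Gen n) (ZMod 2)).constr_basis (ZMod 2)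
    (fun μ => wordBasis n ((Finsupp.toMultiset μ).toList.map Letter.sing)) μ
  rwa [MvPolynomial.coe_basisMonomials] at this

theorem wordVal_toList (μ : Gen n →₀ ℕ) :
    wordVal ((Finsupp.toMultiset μ).toList.map Letter.sing) = monomial μ 1 := by
  rw [wordVal_map_sing, Multiset.coe_toList, Finsupp.toMultiset_toFinsupp]

theorem wordWt_toList (μ : Gen n →₀ ℕ) :
    wordWt ((Finsupp.toMultiset μ).toList.map Letter.sing) = monoWt μ := by
  rw [wordWt_map_sing, Multiset.coe_toList, Finsupp.toMultiset_toFinsupp]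

theorem symb_polyLift (f : MvPolynomial (Gen n) (ZMod 2)) : symb n (polyLift n f) = f := by
  have h : (symb n).toLinearMap.comp (polyLift n) = LinearMap.id := by
    refine (MvPolynomial.basisMonomials (Gen n) (ZMod 2)).ext fun μ => ?_
    rw [MvPolynomial.coe_basisMonomials, LinearMap.comp_apply, polyLift_monomial,
      AlgHom.toLinearMap_apply, symb_wordBasis, wordVal_toList]
    rfl
  exact DFunLike.congr_fun h f

theorem splitD_polyLift (f : MvPolynomial (Gen n) (ZMod 2)) : splitD n (polyLift n f) = 0 := by
  have h : (splitD n).comp (polyLift n) = 0 := by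
    refine (MvPolynomial.basisMonomials (Gen n) (ZMod 2)).ext fun μ => ?_
    rw [MvPolynomial.coe_basisMonomials, LinearMap.comp_apply, polyLift_monomial, splitD_map_sing]
    rfl
  exact DFunLike.congr_fun h f

theorem map_polyFil {V : Type*} [AddCommGroup V] [Module (ZMod 2) V] {N : Submodule (ZMod 2) V}
    {φ : MvPolynomial (Gen n) (ZMod 2) →ₗ[ZMod 2] V} {M : ℤ}
    (h : ∀ μ : Gen n →₀ ℕ, (monoWt μ : ℤ) ≤ M → φ (monomial μ 1) ∈ N)
    {f : MvPolynomial (Gen n) (ZMod 2)} (hf : f ∈ polyFil n M) : φ f ∈ N := by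
  rw [f.as_sum, map_sum]
  refine Submodule.sum_mem _ fun μ hμ => ?_
  have h3 : monomial μ (coeff μ f) = coeff μ f • monomial μ (1 : ZMod 2) := by
    rw [MvPolynomial.smul_monomial, smul_eq_mul, mul_one]
  rw [h3, map_smul]
  exact Submodule.smul_mem _ _ (h μ (hf μ (MvPolynomial.mem_support_iff.1 hμ)))

theorem polyLift_mem {f : MvPolynomial (Gen n) (ZMod 2)} {M : ℤ} (hf : f ∈ polyFil n M) :
    polyLift n f ∈ wtFil n M := by
  refine map_polyFil (fun μ hμ => ?_) hf
  rw [polyLift_monomial]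
  refine Submodule.subset_span ⟨_, ?_, rfl⟩
  change (wordWt _ : ℤ) ≤ M
  rwa [wordWt_toList]

theorem cobarD_polyLift_mem {f : MvPolynomial (Gen n) (ZMod 2)} {M : ℤ} (hf : f ∈ polyFil n M) :
    cobarD n (polyLift n f) ∈ wtFil n (M - 1) := by
  have := cobarD_sub_splitD_mem (polyLift_mem hf)
  rwa [splitD_polyLift, sub_zero] at this

theorem symb_cobarD_polyLift_sub {f : MvPolynomial (Gen n) (ZMod 2)} {M : ℤ}
    (hf : f ∈ polyFil n M) :
    symb n (cobarD n (polyLift n f)) - polyD f ∈ polyFil n (M - 2) := by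
  refine map_polyFil (φ := (symb n).toLinearMap.comp ((cobarD n).comp (polyLift n)) -
    polyD.toLinearMap) (fun μ hμ => ?_) hf
  have h := symb_cobarD_map_sing (Finsupp.toMultiset μ).toList
  rw [← polyLift_monomial, wordVal_toList, wordWt_toList] at h
  exact polyFil_mono (by omega) h

end Symbols

/-! ### Leading terms of cocycles and of boundaries -/

section LeadingTerms

open Module

variable {n : ℕ} [NeZero n]

theorem cobarD_cobarD (x : Cobar n) : cobarD n (cobarD n x) = 0 :=
  DFunLike.congr_fun (cobarD_comp_self n) x

/-- A cochain whose leading part is a cocycle for the weight-preserving differential and has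
vanishing symbol can be moved into lower weight by a coboundary. -/
theorem exists_sub_cobarD_mem {x : Cobar n} {M : ℤ} (hx : x ∈ wtFil n M)
    (hd : cobarD n x ∈ wtFil n (M - 1)) (hs : symb n x ∈ polyFil n (M - 1)) :
    ∃ z ∈ wtFil n M, x - cobarD n z ∈ wtFil n (M - 1) := by
  classical
  set b := wordBasis n with hb
  let u : List (Letter (Gen n)) →₀ ZMod 2 := (b.repr x).filter fun w => (wordWt w : ℤ) = M
  have hu : ∀ w, u w ≠ 0 → (wordWt w : ℤ) = M := by
    intro w hw
    by_contra h
    exact hw (Finsupp.filter_apply_neg _ _ h)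
  obtain ⟨x', hx'⟩ : ∃ x', b.repr x' = u := ⟨b.repr.symm u, LinearEquiv.apply_symm_apply _ _⟩
  have h1 : x - x' ∈ wtFil n (M - 1) := by
    rw [mem_wtFil]
    intro w hw
    rw [map_sub, Finsupp.sub_apply, ← hb, hx'] at hw
    by_cases h : (wordWt w : ℤ) = M
    · rw [Finsupp.filter_apply_pos (fun w => (wordWt w : ℤ) = M) _ h, sub_self] at hw
      exact absurd rfl hw
    · rw [Finsupp.filter_apply_neg (fun w => (wordWt w : ℤ) = M) _ h, sub_zero] at hw
      have := mem_wtFil.1 hx w hw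
      omega
  have hx'M : x' ∈ wtFil n M := by
    rw [mem_wtFil]
    intro w hw
    rw [← hb, hx'] at hw
    exact (hu w hw).le
  have h2 : splitD n x' ∈ wtFil n (M - 1) := by
    have e : splitD n x' = cobarD n x - cobarD n (x - x') - (cobarD n x' - splitD n x') := by
      rw [map_sub]; abel
    rw [e]
    exact Submodule.sub_mem _ (Submodule.sub_mem _ hd (cobarD_mem_wtFil h1))
      (cobarD_sub_splitD_mem hx'M)
  have h3 : extD u = 0 := by
    ext v
    rw [Finsupp.zero_apply]
    by_contra hv
    have h4 := mem_wtFil.1 h2 v (by rwa [repr_splitD, ← hb, hx'])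
    have h5 : extD u v = (u.sum fun w c => c • wordD w) v := rfl
    rw [h5, Finsupp.sum, Finsupp.finsetSum_apply] at hv
    obtain ⟨w, hw, h6⟩ := Finset.exists_ne_zero_of_sum_ne_zero hv
    have h7 : wordD w v ≠ 0 := fun h0 => h6 (by rw [Finsupp.smul_apply, h0, smul_zero])
    have h8 := (split_of_wordD h7).sum_eq Gen.wt
    have h9 := hu w (Finsupp.mem_support_iff.1 hw)
    have h10 : wordWt v = wordWt w := h8.symm
    omega
  have h4 : Finsupp.linearCombination (ZMod 2) wordVal u = 0 := by
    have h5 : symb n x' ∈ polyFil n (M - 1) := by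
      have e : symb n x' = symb n x - symb n (x - x') := by rw [map_sub]; abel
      rw [e]
      exact Submodule.sub_mem _ hs (symb_mem h1)
    rw [symb_eq, ← hb, hx'] at h5
    refine eq_zero_of_mem_polyHom (M := M) ?_ h5
    rw [Finsupp.linearCombination_apply, Finsupp.sum]
    refine Submodule.sum_mem _ fun w hw => Submodule.smul_mem _ _ ?_
    rw [← hu w (Finsupp.mem_support_iff.1 hw)]
    exact wordVal_mem w
  obtain ⟨y, hy, hyS⟩ := exists_extD_eq Gen.wt {m : ℕ | (m : ℤ) = M} u h3 h4
    (fun w hw => hu w (Finsupp.mem_support_iff.1 hw))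
  obtain ⟨z, hz⟩ : ∃ z, b.repr z = y := ⟨b.repr.symm y, LinearEquiv.apply_symm_apply _ _⟩
  have hzM : z ∈ wtFil n M := by
    rw [mem_wtFil]
    intro w hw
    rw [← hb, hz] at hw
    have h5 : (wordWt w : ℤ) = M := hyS w (Finsupp.mem_support_iff.2 hw)
    exact h5.le
  refine ⟨z, hzM, ?_⟩
  have h5 : splitD n z = x' := by
    apply b.repr.injective
    rw [hb, repr_splitD, ← hb, hz, hx', hy]
  have e : x - cobarD n z = (x - x') - (cobarD n z - splitD n z) := by rw [h5]; abel
  rw [e]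
  exact Submodule.sub_mem _ h1 (cobarD_sub_splitD_mem hzM)

variable {E : (Gen n →₀ ℕ) → Cobar n}

theorem symb_linearCombination (hE : ∀ μ, MonoCrit μ → symb n (E μ) = critPoly μ)
    {c : (Gen n →₀ ℕ) →₀ ZMod 2} (hc : ∀ μ ∈ c.support, MonoCrit μ) :
    symb n (Finsupp.linearCombination (ZMod 2) E c) =
      Finsupp.linearCombination (ZMod 2) critPoly c := by
  rw [Finsupp.linearCombination_apply, Finsupp.linearCombination_apply, Finsupp.sum, Finsupp.sum,
    map_sum]
  refine Finset.sum_congr rfl fun μ hμ => ?_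
  rw [map_smul, hE μ (hc μ hμ)]

theorem linearCombination_mem_wtFil (hE : ∀ μ, MonoCrit μ → E μ ∈ wtFil n (monoWt μ))
    {c : (Gen n →₀ ℕ) →₀ ZMod 2} {M : ℤ} (hc : ∀ μ ∈ c.support, MonoCrit μ ∧ (monoWt μ : ℤ) = M) :
    Finsupp.linearCombination (ZMod 2) E c ∈ wtFil n M := by
  rw [Finsupp.linearCombination_apply, Finsupp.sum]
  refine Submodule.sum_mem _ fun μ hμ => Submodule.smul_mem _ _ ?_
  rw [← (hc μ hμ).2]
  exact hE μ (hc μ hμ).1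

theorem cobarD_linearCombination (hE : ∀ μ, MonoCrit μ → cobarD n (E μ) = 0)
    {c : (Gen n →₀ ℕ) →₀ ZMod 2} (hc : ∀ μ ∈ c.support, MonoCrit μ) :
    cobarD n (Finsupp.linearCombination (ZMod 2) E c) = 0 := by
  rw [Finsupp.linearCombination_apply, Finsupp.sum, map_sum]
  refine Finset.sum_eq_zero fun μ hμ => ?_
  rw [map_smul, hE μ (hc μ hμ), smul_zero]

/-- A cochain of weight `M` whose differential has weight at most `M - 2` is, up to lower weight and
a coboundary, a combination of the cocycles `E μ` with critical `μ`. -/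
theorem exists_eq_linearCombination_add (hE : ∀ μ, MonoCrit μ → symb n (E μ) = critPoly μ)
    (hE1 : ∀ μ, MonoCrit μ → E μ ∈ wtFil n (monoWt μ)) (hE2 : ∀ μ, MonoCrit μ → cobarD n (E μ) = 0)
    {x : Cobar n} {M : ℤ} (hx : x ∈ wtFil n M) (hd : cobarD n x ∈ wtFil n (M - 2)) :
    ∃ (c : (Gen n →₀ ℕ) →₀ ZMod 2) (y z : Cobar n),
      (∀ μ ∈ c.support, MonoCrit μ ∧ (monoWt μ : ℤ) = M) ∧ y ∈ wtFil n (M - 1) ∧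
      z ∈ wtFil n (M + 1) ∧ x = Finsupp.linearCombination (ZMod 2) E c + y + cobarD n z := by
  obtain ⟨f, hf, hxf⟩ := exists_polyHom (symb_mem hx)
  have hf' := polyHom_le M hf
  have hdM : cobarD n x ∈ wtFil n (M - 1) := wtFil_mono (by omega) hd
  have h1 : ∃ z ∈ wtFil n M, x - polyLift n f - cobarD n z ∈ wtFil n (M - 1) := by
    refine exists_sub_cobarD_mem (Submodule.sub_mem _ hx (polyLift_mem hf')) ?_ ?_
    · rw [map_sub]
      exact Submodule.sub_mem _ hdM (cobarD_polyLift_mem hf')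
    · rwa [map_sub, symb_polyLift]
  obtain ⟨w, hw, hy⟩ := h1
  have h2 : polyD f = 0 := by
    refine eq_zero_of_mem_polyHom (polyD_mem_polyHom hf) ?_
    have e : polyD f = symb n (cobarD n x) - symb n (cobarD n (x - polyLift n f - cobarD n w)) -
        (symb n (cobarD n (polyLift n f)) - polyD f) := by
      rw [map_sub (cobarD n), map_sub (cobarD n), cobarD_cobarD, map_sub, map_sub, map_zero]
      abel
    rw [e]
    refine Submodule.sub_mem _ (Submodule.sub_mem _ (polyFil_mono ?_ (symb_mem hd))
      (polyFil_mono ?_ (symb_cobarD_mem hy))) (polyFil_mono ?_ (symb_cobarD_polyLift_sub hf'))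
    all_goals omega
  obtain ⟨c, g, hc, hg, hfg⟩ := exists_polyD_eq {m : ℕ | (m : ℤ) = M} f h2
    (fun μ hμ => hf μ (MvPolynomial.mem_support_iff.1 hμ))
  have hc' : ∀ μ ∈ c.support, MonoCrit μ := fun μ hμ => (hc μ hμ).1
  have hg' : g ∈ polyFil n (M + 1) := by
    intro μ hμ
    obtain ⟨m, hm, h3⟩ := hg μ (MvPolynomial.mem_support_iff.2 hμ)
    have hm' : (m : ℤ) = M := hm
    omega
  have h3 : ∃ z ∈ wtFil n M, x - Finsupp.linearCombination (ZMod 2) E c - cobarD n (polyLift n g) -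
      cobarD n z ∈ wtFil n (M - 1) := by
    refine exists_sub_cobarD_mem ?_ ?_ ?_
    · refine Submodule.sub_mem _ (Submodule.sub_mem _ hx (linearCombination_mem_wtFil hE1 hc)) ?_
      have := cobarD_polyLift_mem hg'
      rwa [add_sub_cancel_right] at this
    · rwa [map_sub, map_sub, cobarD_linearCombination hE2 hc', cobarD_cobarD, sub_zero, sub_zero]
    · have e : symb n (x - Finsupp.linearCombination (ZMod 2) E c - cobarD n (polyLift n g)) =
          (symb n x - f) - (symb n (cobarD n (polyLift n g)) - polyD g) := by
        rw [map_sub, map_sub, symb_linearCombination hE hc', hfg]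
        abel
      rw [e]
      refine Submodule.sub_mem _ hxf (polyFil_mono ?_ (symb_cobarD_polyLift_sub hg'))
      omega
  obtain ⟨z, hz, hyz⟩ := h3
  refine ⟨c, _, polyLift n g + z, hc, hyz,
    Submodule.add_mem _ (polyLift_mem hg') (wtFil_mono (by omega) hz), ?_⟩
  rw [map_add]
  abel

/-- The combinations of the cocycles `E μ` of weight `M` are independent modulo lower weight and
boundaries of cochains of weight `M + 1`. -/
theorem eq_zero_of_linearCombination_eq (hE : ∀ μ, MonoCrit μ → symb n (E μ) = critPoly μ)
    (hE1 : ∀ μ, MonoCrit μ → E μ ∈ wtFil n (monoWt μ))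
    {c : (Gen n →₀ ℕ) →₀ ZMod 2} {M : ℤ} (hc : ∀ μ ∈ c.support, MonoCrit μ ∧ (monoWt μ : ℤ) = M)
    {y z : Cobar n} (hy : y ∈ wtFil n (M - 1)) (hz : z ∈ wtFil n (M + 1))
    (h : Finsupp.linearCombination (ZMod 2) E c = y + cobarD n z) : c = 0 := by
  have hc' : ∀ μ ∈ c.support, MonoCrit μ := fun μ hμ => (hc μ hμ).1
  obtain ⟨g, hg, hzg⟩ := exists_polyHom (symb_mem hz)
  have hg' := polyHom_le _ hg
  have hcM := linearCombination_mem_wtFil hE1 hc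
  have hdz : cobarD n z ∈ wtFil n M := by
    have e : cobarD n z = Finsupp.linearCombination (ZMod 2) E c - y := by rw [h]; abel
    rw [e]
    exact Submodule.sub_mem _ hcM (wtFil_mono (by omega) hy)
  have hdl := cobarD_polyLift_mem hg'
  have h1 : ∃ w ∈ wtFil n (M + 1), z - polyLift n g - cobarD n w ∈ wtFil n (M + 1 - 1) := by
    refine exists_sub_cobarD_mem (Submodule.sub_mem _ hz (polyLift_mem hg')) ?_ ?_
    · rw [map_sub]
      refine Submodule.sub_mem _ ?_ hdl
      rwa [add_sub_cancel_right]
    · rwa [map_sub, symb_polyLift]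
  obtain ⟨w, hw, hyw⟩ := h1
  rw [add_sub_cancel_right] at hyw
  refine eq_zero_of_eq_polyD c hc' g ?_
  rw [← sub_eq_zero]
  have hhom : Finsupp.linearCombination (ZMod 2) critPoly c - polyD g ∈ polyHom n M := by
    refine Submodule.sub_mem _ ?_ ?_
    · rw [Finsupp.linearCombination_apply, Finsupp.sum]
      refine Submodule.sum_mem _ fun μ hμ => Submodule.smul_mem _ _ ?_
      rw [← (hc μ hμ).2]
      exact critPoly_mem_polyHom μ
    · have := polyD_mem_polyHom hg
      rwa [add_sub_cancel_right] at this
  refine eq_zero_of_mem_polyHom hhom ?_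
  have e : Finsupp.linearCombination (ZMod 2) critPoly c - polyD g = symb n y +
      (symb n (cobarD n (polyLift n g)) - polyD g) +
      symb n (cobarD n (z - polyLift n g - cobarD n w)) := by
    rw [← symb_linearCombination hE hc', h, map_add, map_sub (cobarD n), map_sub (cobarD n),
      cobarD_cobarD, map_sub, map_sub, map_zero]
    abel
  rw [e]
  refine Submodule.add_mem _ (Submodule.add_mem _ (symb_mem hy)
    (polyFil_mono ?_ (symb_cobarD_polyLift_sub hg'))) (symb_cobarD_mem hyw)
  omega

end LeadingTerms

/-! ### Products in the cobar complex -/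

section Products

variable {n : ℕ} [NeZero n]

theorem pow_mem_mayFil {x : Cobar n} {s : ℤ} {t : ZMod (2 * (2 ^ n - 1))} {M : ℤ}
    (hx : x ∈ mayFil n s t M) (k : ℕ) : x ^ k ∈ mayFil n (k * s) (k * t) (k * M) := by
  induction k with
  | zero =>
    have := wordBasis_mem_mayFil ([] : List (Letter (Gen n)))
    simpa [wordBasis_nil, wordDeg, wordWt] using this
  | succ k ih =>
    rw [pow_succ]
    exact mayFil_mul ih hx (by push_cast; ring) (by push_cast; ring) (by push_cast; linarith)

theorem prod_ofFn_mem_mayFil {m : ℕ} {f : Fin m → Cobar n} {s : Fin m → ℤ}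
    {t : Fin m → ZMod (2 * (2 ^ n - 1))} {M : Fin m → ℤ} (h : ∀ i, f i ∈ mayFil n (s i) (t i) (M i)) :
    (List.ofFn f).prod ∈ mayFil n (∑ i, s i) (∑ i, t i) (∑ i, M i) := by
  induction m with
  | zero =>
    have := wordBasis_mem_mayFil ([] : List (Letter (Gen n)))
    simpa [wordBasis_nil, wordDeg, wordWt] using this
  | succ m ih =>
    rw [List.ofFn_succ, List.prod_cons, Fin.sum_univ_succ, Fin.sum_univ_succ, Fin.sum_univ_succ]
    exact mayFil_mul (h 0) (ih fun i => h i.succ) rfl rfl le_rfl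

theorem cobarD_pow {x : Cobar n} (hx : cobarD n x = 0) (k : ℕ) : cobarD n (x ^ k) = 0 := by
  induction k with
  | zero => rw [pow_zero, cobarD_one]
  | succ k ih => rw [pow_succ, cobarD_mul, ih, hx, zero_mul, mul_zero, add_zero]

theorem cobarD_prod {l : List (Cobar n)} (h : ∀ x ∈ l, cobarD n x = 0) : cobarD n l.prod = 0 := by
  induction l with
  | nil => rw [List.prod_nil, cobarD_one]
  | cons x l ih =>
    rw [List.prod_cons, cobarD_mul, h x List.mem_cons_self,
      ih fun y hy => h y (List.mem_cons_of_mem _ hy), zero_mul, mul_zero, add_zero]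

theorem bar_genElt_mem (i : Gen n) : bar n (genElt i) ∈ mayFil n 1 i.deg i.wt := by
  have := bar_setElt_mem ({i} : Finset (Gen n))
  rwa [setElt_singleton, setDeg, Finset.sum_singleton, setWt, Finset.sum_singleton] at this

end Products

/-! ### Primitive elements and the relations between their classes -/

section Primitives

open scoped TensorProduct

variable {n : ℕ} [NeZero n]

/-- The primitive element `∑ⱼ t_{2n}^(2^j)`. -/
noncomputable def rhoGen (n : ℕ) : StabAlg n := ∑ j ∈ Finset.range n, tGen n (2 * n) ^ 2 ^ j

theorem rhoElt_eq : rhoElt n = bar n (rhoGen n) := by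
  rw [rhoElt, rhoGen, map_sum]
  rfl

theorem sum_range_zmod {V : Type*} [AddCommMonoid V] (f : ZMod n → V) :
    ∑ j ∈ Finset.range n, f (j : ZMod n) = ∑ j : ZMod n, f j := by
  refine Finset.sum_nbij' (fun j => (j : ZMod n)) (fun j => j.val) (fun _ _ => Finset.mem_univ _)
    (fun j _ => Finset.mem_range.2 (ZMod.val_lt j)) (fun j hj => ?_) (fun j _ => ?_) fun _ _ => rfl
  · exact ZMod.val_natCast_of_lt (Finset.mem_range.1 hj)
  · exact ZMod.natCast_zmod_val j

theorem Gen.succ_bot (j : ZMod n) :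
    (⟨n, le_rfl, j⟩ : Gen n).succ = ⟨2 * n, by omega, j⟩ :=
  Gen.ext (two_mul n).symm (if_pos rfl)

theorem rhoGen_eq : rhoGen n = ∑ j : ZMod n, genElt (Gen.succ (⟨n, le_rfl, j⟩ : Gen n)) := by
  rw [rhoGen, ← sum_range_zmod]
  refine Finset.sum_congr rfl fun j _ => ?_
  rw [Gen.succ_bot, tGen_pow]

theorem redComul_sum {ι : Type*} (T : Finset ι) (f : ι → StabAlg n) :
    redComul (∑ i ∈ T, f i) = ∑ i ∈ T, redComul (f i) := by
  simp only [redComul, map_sum, TensorProduct.sum_tmul, TensorProduct.tmul_sum,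
    Finset.sum_sub_distrib]

theorem redComul_rhoGen : redComul (rhoGen n) = 0 := by
  rw [rhoGen_eq, redComul_sum, Finset.sum_congr rfl fun j _ =>
    redComul_genElt_succ_of_lev (⟨n, le_rfl, j⟩ : Gen n) rfl, Finset.sum_add_distrib]
  have h := (Equiv.subRight (1 : ZMod n)).sum_comp fun j =>
    genElt (⟨n, le_rfl, j⟩ : Gen n) ⊗ₜ[ZMod 2] genElt (⟨n, le_rfl, j⟩ : Gen n)
  have h2 : ∑ j : ZMod n, genElt (⟨n, le_rfl, j⟩ : Gen n).rot ⊗ₜ[ZMod 2]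
      genElt (⟨n, le_rfl, j⟩ : Gen n).rot = ∑ j : ZMod n,
        genElt (⟨n, le_rfl, j⟩ : Gen n) ⊗ₜ[ZMod 2] genElt (⟨n, le_rfl, j⟩ : Gen n) := h
  rw [h2, ← two_mul, two_eq_zero_tensor, zero_mul]

theorem hElt_eq {s : ℕ} (hs : n ≤ s) (j : ℕ) :
    hElt n s j = bar n (genElt (⟨s, hs, (j : ZMod n)⟩ : Gen n)) := by
  rw [hElt, tGen_pow]

theorem cobarD_bar_of_primitive {x : StabAlg n} (hx : redComul x = 0) : cobarD n (bar n x) = 0 := by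
  rw [cobarD_bar, barComul_eq_redComul, hx, map_zero]

theorem cobarD_hElt {s : ℕ} (hs : n ≤ s) (hs2 : s < 2 * n) (j : ℕ) : cobarD n (hElt n s j) = 0 := by
  rw [hElt_eq hs]
  exact cobarD_bar_of_primitive (redComul_genElt_of_lt hs2)

theorem cobarD_rhoElt : cobarD n (rhoElt n) = 0 := by
  rw [rhoElt_eq]
  exact cobarD_bar_of_primitive redComul_rhoGen

theorem cobar_sub_eq_add (x y : Cobar n) : x - y = x + y := by
  rw [sub_eq_iff_eq_add, add_assoc, ← two_smul (ZMod 2) y, show (2 : ZMod 2) = 0 from rfl, zero_smul,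
    add_zero]

/-- The classes of two primitive elements commute: their commutator is the boundary of the
product. -/
theorem bar_mul_sub_mem_range {x y : StabAlg n} (hx : redComul x = 0) (hy : redComul y = 0) :
    bar n x * bar n y - bar n y * bar n x ∈ LinearMap.range (cobarD n) := by
  refine ⟨bar n (x * y), ?_⟩
  have h : ∀ z : StabAlg n, redComul z = 0 → comul n z = z ⊗ₜ 1 + 1 ⊗ₜ z := by
    intro z hz
    rw [redComul, sub_sub, sub_eq_zero] at hz
    exact hz
  rw [cobarD_bar, barComul_eq, map_mul, h x hx, h y hy, add_mul, mul_add, mul_add]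
  simp only [Algebra.TensorProduct.tmul_mul_tmul, one_mul, mul_one, map_add, barTensor_tmul,
    bar_one, mul_zero, zero_mul, zero_add, add_zero]
  rw [cobar_sub_eq_add]

theorem exists_primitive {x : Cobar n}
    (hx : x = rhoElt n ∨ ∃ s j : ℕ, n ≤ s ∧ s < 2 * n ∧ j < n ∧ x = hElt n s j) :
    ∃ a : StabAlg n, redComul a = 0 ∧ x = bar n a := by
  rcases hx with rfl | ⟨s, j, h1, h2, -, rfl⟩
  · exact ⟨_, redComul_rhoGen, rhoElt_eq⟩
  · exact ⟨_, redComul_genElt_of_lt h2, hElt_eq h1 j⟩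

/-- The boundary of `[t_{2n}^(2^j)]` is `h_{n,j}² + h_{n,j-1}²`. -/
theorem hElt_sq_sub_mem_range (j : ℕ) :
    hElt n n j ^ 2 - hElt n n 0 ^ 2 ∈ LinearMap.range (cobarD n) := by
  induction j with
  | zero => rw [sub_self]; exact Submodule.zero_mem _
  | succ j ih =>
    have h : hElt n n (j + 1) ^ 2 - hElt n n j ^ 2 ∈ LinearMap.range (cobarD n) := by
      refine ⟨bar n (genElt (⟨n, le_rfl, ((j + 1 : ℕ) : ZMod n)⟩ : Gen n).succ), ?_⟩
      rw [cobarD_bar, barComul_eq_redComul, redComul_genElt_succ_of_lev _ rfl, map_add,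
        barTensor_tmul, barTensor_tmul, hElt_eq le_rfl, hElt_eq le_rfl, cobar_sub_eq_add, sq, sq]
      have h2 : (⟨n, le_rfl, ((j + 1 : ℕ) : ZMod n)⟩ : Gen n).rot = ⟨n, le_rfl, (j : ZMod n)⟩ :=
        Gen.ext rfl (by simp [Gen.rot])
      rw [h2]
    have := Submodule.add_mem _ h ih
    rwa [sub_add_sub_cancel] at this

/-- For `s > n` the square of `h_{s,j}` is the leading term of the boundary of `[t_{s+n}^(2^(j+1))]`. -/
theorem hElt_sq_mem {s : ℕ} (hs : n < s) (j : ℕ) :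
    hElt n s j ^ 2 ∈ mayFil n 2 (2 * (2 * (2 ^ s - 1) * 2 ^ j)) (2 * mayWeight n s - 1) ⊔
      LinearMap.range (cobarD n) := by
  set i : Gen n := ⟨s, hs.le, (j : ZMod n)⟩ with hi
  have hl : i.lev ≠ n := hs.ne'
  have h := barTensor_mem (redComul_genElt_succ_mem i)
  rw [if_neg hl, sub_zero, map_sub, ← barComul_eq_redComul, ← cobarD_bar, barTensor_tmul, ← sq,
    ← hElt_eq hs.le] at h
  have hdeg : i.succ.deg = 2 * (2 * (2 ^ s - 1) * 2 ^ j) := by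
    have h1 : i.succ = ⟨s + n, by omega, ((j + 1 : ℕ) : ZMod n)⟩ :=
      Gen.ext rfl (by simp [Gen.succ, hi, hs.ne'])
    rw [h1, Gen.deg_natCast]
    linear_combination 2 ^ (j + 1) * 2 ^ s * two_mul_two_pow (n := n)
  have hwt : ((i.succ.wt - 1 : ℕ) : ℤ) - 1 = 2 * mayWeight n s - 1 := by
    have h1 := i.wt_succ
    have h2 : i.wt = mayWeight n s := rfl
    omega
  rw [hdeg, hwt] at h
  have e : hElt n s j ^ 2 = -(cobarD n (bar n (genElt i.succ)) - hElt n s j ^ 2) +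
      cobarD n (bar n (genElt i.succ)) := by abel
  rw [e]
  exact Submodule.add_mem_sup (Submodule.neg_mem _ h) ⟨_, rfl⟩

theorem two_mul_two_pow_two_mul : (2 * (2 ^ (2 * n) - 1) : ZMod (2 * (2 ^ n - 1))) = 0 := by
  have h := two_mul_two_pow (n := n)
  rw [two_mul n, pow_add]
  linear_combination (2 ^ n + 1) * h

theorem rhoElt_mem : rhoElt n ∈ mayFil n 1 (2 * (2 ^ (2 * n) - 1)) (mayWeight n (2 * n)) := by
  rw [rhoElt]
  refine Submodule.sum_mem _ fun j _ => ?_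
  have h2 : n ≤ 2 * n := by omega
  rw [hElt_eq h2]
  have := bar_genElt_mem (⟨2 * n, h2, (j : ZMod n)⟩ : Gen n)
  rw [Gen.deg_natCast, two_mul_two_pow_two_mul, mul_zero] at this
  rw [two_mul_two_pow_two_mul]
  exact this

end Primitives

/-! ### The monomials in the classes `h_{s,j}` and `ρ_{2n}` -/

section MonomialBasis

open MvPolynomial (monomial)

variable {n : ℕ} [NeZero n]

/-- The generator of `h_{n+a,j}`. -/
def genOf (a j : Fin n) : Gen n := ⟨n + a, Nat.le_add_right _ _, ((j : ℕ) : ZMod n)⟩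

theorem genOf_inj {a j a' j' : Fin n} (h : genOf a j = genOf a' j') : a = a' ∧ j = j' := by
  have h1 := congrArg Gen.lev h
  have h2 := congrArg (fun i : Gen n => i.frob.val) h
  simp only [genOf, ZMod.val_natCast_of_lt (Fin.is_lt _)] at h1 h2
  exact ⟨Fin.ext (by omega), Fin.ext h2⟩

theorem exists_genOf (i : Gen n) (hi : i.lev < 2 * n) : ∃ a j, genOf a j = i := by
  have := i.le
  refine ⟨⟨i.lev - n, by omega⟩, ⟨i.frob.val, ZMod.val_lt _⟩, Gen.ext ?_ ?_⟩
  · simp only [genOf]; omega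
  · exact ZMod.natCast_zmod_val _

theorem genOf_lev_lt (a j : Fin n) : (genOf a j).lev < 2 * n := by
  have := a.2
  simp only [genOf]
  omega

theorem genOf_ne_succ (a j : Fin n) (i : Gen n) : genOf a j ≠ i.succ := by
  intro h
  have h1 := genOf_lev_lt a j
  have h2 := i.le
  rw [h] at h1
  simp only [Gen.succ] at h1
  omega

theorem genOf_eq_base {a j : Fin n} (h : genOf a j = Gen.base n) : (a : ℕ) = 0 ∧ (j : ℕ) = 0 := by
  have h1 := congrArg Gen.lev h
  have h2 := congrArg (fun i : Gen n => i.frob.val) h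
  simp only [genOf, Gen.base, ZMod.val_natCast_of_lt (Fin.is_lt _), ZMod.val_zero] at h1 h2
  exact ⟨by omega, h2⟩

/-- The exponents of the monomial as exponents of the polynomial generators; the exponent of
`ρ_{2n}` is recorded at `t_{2n}`. -/
noncomputable def MonExp.toMono (x : MonExp n) : Gen n →₀ ℕ :=
  ∑ a, ∑ j, Finsupp.single (genOf a j) (x.exp a j) + Finsupp.single (Gen.base n).succ x.rho

theorem MonExp.toMono_genOf (x : MonExp n) (a j : Fin n) : x.toMono (genOf a j) = x.exp a j := by
  classical
  rw [toMono, Finsupp.add_apply, Finsupp.single_eq_of_ne (genOf_ne_succ a j _), add_zero,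
    Finsupp.finsetSum_apply, Finset.sum_eq_single a, Finsupp.finsetSum_apply,
    Finset.sum_eq_single j, Finsupp.single_eq_same]
  · intro j' _ hj
    exact Finsupp.single_eq_of_ne fun h => hj (genOf_inj h).2.symm
  · exact fun h => absurd (Finset.mem_univ _) h
  · intro a' _ ha
    rw [Finsupp.finsetSum_apply]
    exact Finset.sum_eq_zero fun j' _ => Finsupp.single_eq_of_ne fun h => ha (genOf_inj h).1.symm
  · exact fun h => absurd (Finset.mem_univ _) h

theorem MonExp.toMono_succ (x : MonExp n) (i : Gen n) :
    x.toMono i.succ = if i = Gen.base n then x.rho else 0 := by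
  classical
  rw [toMono, Finsupp.add_apply, Finsupp.finsetSum_apply, Finset.sum_eq_zero, zero_add]
  · split_ifs with h
    · rw [h, Finsupp.single_eq_same]
    · exact Finsupp.single_eq_of_ne fun h' => h (Gen.succ_injective h')
  · intro a _
    rw [Finsupp.finsetSum_apply]
    exact Finset.sum_eq_zero fun j _ =>
      Finsupp.single_eq_of_ne fun h => genOf_ne_succ a j i h.symm

theorem MonExp.monoCrit_toMono (x : MonExp n) : MonoCrit x.toMono := by
  rintro i ⟨hi, h | h⟩
  · rcases lt_or_ge i.lev (2 * n) with hl | hl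
    · obtain ⟨a, j, rfl⟩ := exists_genOf i hl
      rw [toMono_genOf] at h
      have := x.exp_le a j fun h0 => hi (Gen.ext (by simp [genOf, Gen.base, h0.1])
        (by simp [genOf, Gen.base, h0.2]))
      omega
    · obtain ⟨i, rfl⟩ := i.exists_succ_eq hl
      rw [toMono_succ] at h
      have := x.rho_le
      split_ifs at h <;> omega
  · rw [toMono_succ, if_neg hi] at h
    exact absurd h (by decide)

theorem exists_toMono_eq {μ : Gen n →₀ ℕ} (h : MonoCrit μ) : ∃ x : MonExp n, x.toMono = μ := by
  refine ⟨⟨fun a j => μ (genOf a j), μ (Gen.base n).succ, fun a j h0 => h.le_one fun h1 =>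
    h0 (genOf_eq_base h1), h.le_one (Gen.succ_ne _)⟩, ?_⟩
  ext i
  rcases lt_or_ge i.lev (2 * n) with hl | hl
  · obtain ⟨a, j, rfl⟩ := exists_genOf i hl
    rw [MonExp.toMono_genOf]
  · obtain ⟨i, rfl⟩ := i.exists_succ_eq hl
    rw [MonExp.toMono_succ]
    split_ifs with h1
    · rw [h1]
    · exact (h.eq_zero h1).symm

theorem MonExp.toMono_injective : Function.Injective (MonExp.toMono : MonExp n → _) := by
  intro x y h
  have h1 : x.exp = y.exp := by
    funext a j
    rw [← x.toMono_genOf, ← y.toMono_genOf, h]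
  have h2 : x.rho = y.rho := by
    have hx := x.toMono_succ (Gen.base n)
    have hy := y.toMono_succ (Gen.base n)
    rw [if_pos rfl] at hx hy
    rw [← hx, ← hy, h]
  cases x
  cases y
  simp only at h1 h2
  subst h1
  subst h2
  rfl

/-- The product of the cocycles `h_{n+a,j}` and `ρ_{2n}` with exponents read off from `μ`. -/
noncomputable def monoElt (μ : Gen n →₀ ℕ) : Cobar n :=
  (List.ofFn fun a : Fin n =>
    (List.ofFn fun j : Fin n => hElt n (n + a) j ^ μ (genOf a j)).prod).prod *
      rhoElt n ^ μ (Gen.base n).succ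

theorem MonExp.elt_eq (x : MonExp n) : x.elt = monoElt x.toMono := by
  simp only [MonExp.elt, monoElt, toMono_genOf, toMono_succ, if_pos]

theorem cobarD_monoElt (μ : Gen n →₀ ℕ) : cobarD n (monoElt μ) = 0 := by
  rw [monoElt, cobarD_mul, cobarD_pow cobarD_rhoElt, mul_zero, add_zero, cobarD_prod, zero_mul]
  intro x hx
  obtain ⟨a, rfl⟩ := List.mem_ofFn.1 hx
  refine cobarD_prod fun y hy => ?_
  obtain ⟨j, rfl⟩ := List.mem_ofFn.1 hy
  exact cobarD_pow (cobarD_hElt (by omega) (by omega) _) _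

theorem MonExp.elt_mem (x : MonExp n) : x.elt ∈ mayFil n x.homDeg x.innerDeg x.mayDeg := by
  have h : ∀ a j : Fin n, hElt n (n + a) j ^ x.exp a j ∈ mayFil n (x.exp a j * 1)
      ((x.exp a j : ZMod (2 * (2 ^ n - 1))) * (2 * (2 ^ (n + (a : ℕ)) - 1) * 2 ^ (j : ℕ)))
      (x.exp a j * mayWeight n (n + a)) := by
    intro a j
    refine pow_mem_mayFil ?_ _
    rw [hElt_eq (Nat.le_add_right n a)]
    have := bar_genElt_mem (⟨n + a, Nat.le_add_right n a, ((j : ℕ) : ZMod n)⟩ : Gen n)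
    rw [Gen.deg_natCast, mul_comm] at this
    exact this
  refine mayFil_mul (prod_ofFn_mem_mayFil fun a => prod_ofFn_mem_mayFil fun j => h a j)
    (pow_mem_mayFil rhoElt_mem x.rho) ?_ rfl ?_
  · rw [homDeg]
    push_cast
    simp
  · rw [mayDeg]
    push_cast
    rfl

theorem monoWt_sum {ι : Type*} (T : Finset ι) (f : ι → Gen n →₀ ℕ) :
    monoWt (∑ i ∈ T, f i) = ∑ i ∈ T, monoWt (f i) := by
  classical
  induction T using Finset.induction_on with
  | empty => simp [monoWt]
  | insert i T hi ih => rw [Finset.sum_insert hi, Finset.sum_insert hi, monoWt_add, ih]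

theorem MonExp.monoWt_toMono (x : MonExp n) : monoWt x.toMono = x.mayDeg := by
  rw [toMono, monoWt_add, monoWt_sum, monoWt_single, mayDeg]
  have h1 : (Gen.base n).succ.wt = mayWeight n (2 * n) := by
    rw [two_mul]; rfl
  rw [h1]
  congr 1
  refine Finset.sum_congr rfl fun a _ => ?_
  rw [monoWt_sum]
  refine Finset.sum_congr rfl fun j _ => ?_
  rw [monoWt_single]
  rfl

theorem symb_hElt (a j : Fin n) : symb n (hElt n (n + a) j) = MvPolynomial.X (genOf a j) := by
  rw [hElt_eq (Nat.le_add_right n a), symb_bar_genElt]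
  rfl

theorem symb_rhoElt : symb n (rhoElt n) = rhoPoly n := by
  rw [rhoElt_eq, rhoGen_eq, map_sum, map_sum, rhoPoly]
  simp only [symb_bar_genElt]

theorem MonExp.symb_elt (x : MonExp n) : symb n x.elt = critPoly x.toMono := by
  have he : x.toMono.erase (Gen.base n).succ =
      ∑ a, ∑ j, Finsupp.single (genOf a j) (x.exp a j) := by
    ext i
    by_cases hi : i = (Gen.base n).succ
    · rw [hi, Finsupp.erase_same, Finsupp.finsetSum_apply, Finset.sum_eq_zero]
      intro a _
      rw [Finsupp.finsetSum_apply]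
      exact Finset.sum_eq_zero fun j _ =>
        Finsupp.single_eq_of_ne fun h => genOf_ne_succ a j _ h.symm
    · rw [Finsupp.erase_ne hi, toMono, Finsupp.add_apply, Finsupp.single_eq_of_ne hi, add_zero]
  rw [critPoly, toMono_succ, if_pos rfl, he, MonExp.elt, map_mul, map_pow, symb_rhoElt,
    MvPolynomial.monomial_sum_one, map_list_prod, List.map_ofFn, List.prod_ofFn]
  congr 1
  refine Finset.prod_congr rfl fun a _ => ?_
  rw [Function.comp_apply, map_list_prod, List.map_ofFn, List.prod_ofFn,
    MvPolynomial.monomial_sum_one]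
  refine Finset.prod_congr rfl fun j _ => ?_
  rw [Function.comp_apply, map_pow, symb_hElt, MvPolynomial.X_pow_eq_monomial]

theorem symb_monoElt {μ : Gen n →₀ ℕ} (h : MonoCrit μ) : symb n (monoElt μ) = critPoly μ := by
  obtain ⟨x, rfl⟩ := exists_toMono_eq h
  rw [← x.elt_eq, x.symb_elt]

theorem monoElt_mem {μ : Gen n →₀ ℕ} (h : MonoCrit μ) : monoElt μ ∈ wtFil n (monoWt μ) := by
  obtain ⟨x, rfl⟩ := exists_toMono_eq h
  rw [← x.elt_eq, x.monoWt_toMono]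
  exact mayFil_le_wtFil _ _ _ x.elt_mem

end MonomialBasis

/-! ### The collapse of the spectral sequence -/

section Collapse

open Module

variable {n : ℕ} [NeZero n]

/-- The monomials of bidegree `(s, t)`. -/
abbrev MonIdx (n : ℕ) (s : ℤ) (t : ZMod (2 * (2 ^ n - 1))) : Type :=
  {x : MonExp n // (x.homDeg : ℤ) = s ∧ x.innerDeg = t}

variable {s : ℤ} {t : ZMod (2 * (2 ^ n - 1))} {M : ℤ}

/-- The cocycle of a monomial of bidegree `(s, t)`. -/
noncomputable def idxElt (x : MonIdx n s t) : Cobar n := x.1.elt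

theorem idxElt_mem (x : MonIdx n s t) : idxElt x ∈ mayFil n s t x.1.mayDeg := by
  have h := x.1.elt_mem
  rw [x.2.1, x.2.2] at h
  exact h

theorem cobarD_elt (x : MonExp n) : cobarD n x.elt = 0 := by
  rw [x.elt_eq, cobarD_monoElt]

theorem idxElt_mem_cocycles (x : MonIdx n s t) : idxElt x ∈ cocycles n s t :=
  ⟨mayFil_le_cobarPart _ _ _ (idxElt_mem x), cobarD_elt x.1⟩

/-- The span of the monomials of bidegree `(s, t)` and weight `M`. -/
noncomputable def monSpan (n : ℕ) [NeZero n] (s : ℤ) (t : ZMod (2 * (2 ^ n - 1))) (M : ℤ) :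
    Submodule (ZMod 2) (Cobar n) :=
  Submodule.span (ZMod 2) (idxElt '' {x : MonIdx n s t | (x.1.mayDeg : ℤ) = M})

theorem monSpan_le_mayFil : monSpan n s t M ≤ mayFil n s t M := by
  rw [monSpan, Submodule.span_le]
  rintro _ ⟨x, hx, rfl⟩
  exact mayFil_mono (le_of_eq hx) (idxElt_mem x)

theorem cobarD_of_mem_monSpan {x : Cobar n} (hx : x ∈ monSpan n s t M) : cobarD n x = 0 := by
  have h : monSpan n s t M ≤ LinearMap.ker (cobarD n) := by
    rw [monSpan, Submodule.span_le]
    rintro _ ⟨x, -, rfl⟩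
    exact cobarD_elt x.1
  exact h hx

theorem partProj_linearCombination_mem {c : (Gen n →₀ ℕ) →₀ ZMod 2}
    (hc : ∀ μ ∈ c.support, MonoCrit μ ∧ (monoWt μ : ℤ) = M) :
    partProj n s t (Finsupp.linearCombination (ZMod 2) monoElt c) ∈ monSpan n s t M := by
  rw [Finsupp.linearCombination_apply, Finsupp.sum, map_sum]
  refine Submodule.sum_mem _ fun μ hμ => ?_
  rw [map_smul]
  refine Submodule.smul_mem _ _ ?_
  obtain ⟨hcrit, hM⟩ := hc μ hμ
  obtain ⟨x, rfl⟩ := exists_toMono_eq hcrit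
  rw [← x.elt_eq]
  have hx := mayFil_le_cobarPart _ _ _ x.elt_mem
  by_cases h : (x.homDeg : ℤ) = s ∧ x.innerDeg = t
  · have h1 : partProj n s t x.elt = x.elt := by
      rw [h.1, h.2] at hx
      exact partProj_eq_self hx
    rw [h1]
    refine Submodule.subset_span ⟨⟨x, h⟩, ?_, rfl⟩
    rw [x.monoWt_toMono] at hM
    exact hM
  · rw [partProj_eq_zero hx h]
    exact Submodule.zero_mem _

/-- The elements of `E₁` that survive to `E₂` are represented by combinations of monomials. -/
theorem exists_eq_mono_add {x : Cobar n} (hx : x ∈ mayFil n s t M)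
    (hd : cobarD n x ∈ wtFil n (M - 2)) :
    ∃ m ∈ monSpan n s t M, ∃ y ∈ mayFil n s t (M - 1), ∃ z ∈ mayFil n (s - 1) t (M + 1),
      x = m + y + cobarD n z := by
  rw [mem_mayFil_iff] at hx
  obtain ⟨c, y, z, hc, hy, hz, h⟩ := exists_eq_linearCombination_add
    (fun μ => symb_monoElt) (fun μ => monoElt_mem) (fun μ _ => cobarD_monoElt μ) hx.2 hd
  refine ⟨_, partProj_linearCombination_mem (s := s) (t := t) hc, _, partProj_mem s t hy, _,
    partProj_mem (s - 1) t hz, ?_⟩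
  have h1 := congrArg (partProj n s t) h
  have h2 := partProj_cobarD (s - 1) t z
  rw [sub_add_cancel] at h2
  rw [partProj_eq_self hx.1, map_add, map_add, h2] at h1
  exact h1

/-- A boundary of weight `M` is the boundary of a cochain of weight `M + 1`. -/
theorem exists_cobarD_eq {z : Cobar n} {N : ℤ} (hz : z ∈ wtFil n N) (hd : cobarD n z ∈ wtFil n M) :
    ∃ z' ∈ wtFil n (M + 1), cobarD n z' = cobarD n z := by
  obtain ⟨k, hk⟩ : ∃ k : ℕ, N ≤ M + 1 + k := ⟨(N - (M + 1)).toNat, by omega⟩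
  induction k generalizing z N with
  | zero => exact ⟨z, wtFil_mono (by omega) hz, rfl⟩
  | succ k ih =>
    obtain ⟨c, y, w, hc, hy, -, h⟩ := exists_eq_linearCombination_add
      (fun μ => symb_monoElt) (fun μ => monoElt_mem) (fun μ _ => cobarD_monoElt μ)
      (wtFil_mono hk hz) (wtFil_mono (by push_cast; omega) hd)
    have h1 : cobarD n z = cobarD n y := by
      rw [h, map_add, map_add, cobarD_cobarD, add_zero,
        cobarD_linearCombination (fun μ _ => cobarD_monoElt μ) fun μ hμ => (hc μ hμ).1, zero_add]
    rw [h1] at hd ⊢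
    exact ih hy hd (by push_cast; omega)

theorem exists_cobarD_eq_of_mem_mayFil {z : Cobar n} {N : ℤ} (hz : z ∈ mayFil n s t N)
    (hd : cobarD n z ∈ wtFil n M) : ∃ z' ∈ mayFil n s t (M + 1), cobarD n z' = cobarD n z := by
  obtain ⟨z', hz', h⟩ := exists_cobarD_eq (mayFil_le_wtFil _ _ _ hz) hd
  refine ⟨_, partProj_mem s t hz', ?_⟩
  rw [← partProj_cobarD, h, partProj_eq_self (cobarD_mem_cobarPart (mayFil_le_cobarPart _ _ _ hz))]

/-- An element of `E_r` is represented by a combination of monomials, which are cocycles, up to an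
element `y` of lower weight and a boundary; the differential of `y` is zero in `E_r`. -/
theorem mayD_eq_zero (r s : ℤ) (t : ZMod (2 * (2 ^ n - 1))) (M : ℤ) (hr : 2 ≤ r) :
    mayD n r s t M = 0 := by
  refine LinearMap.ext fun e => ?_
  obtain ⟨⟨x, hx⟩, rfl⟩ := Submodule.mkQ_surjective _ e
  obtain ⟨hx1, hx2⟩ := id hx
  have hx2' : cobarD n x ∈ mayFil n (s + 1) t (M - r) := hx2
  obtain ⟨m, hm, y, hy, z, hz, h⟩ := exists_eq_mono_add (x := x) hx1
    (wtFil_mono (by omega) (mayFil_le_wtFil _ _ _ hx2'))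
  have hdx : cobarD n x = cobarD n y := by
    rw [h, map_add, map_add, cobarD_cobarD, cobarD_of_mem_monSpan hm, zero_add, add_zero]
  rw [LinearMap.zero_apply]
  refine (Submodule.Quotient.mk_eq_zero _).2 ?_
  change cobarD n x ∈ specZ (cobarD n) (fun s M => mayFil n s t M) (r - 1) (s + 1) (M - r - 1) ⊔
    specB (cobarD n) (fun s M => mayFil n s t M) (r - 1) (s + 1) (M - r)
  refine Submodule.mem_sup_right ⟨y, ?_, hdx.symm⟩
  rw [show s + 1 - 1 = s by ring, show M - r + (r - 1) = M - 1 by ring]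
  refine ⟨hy, ?_⟩
  change cobarD n y ∈ mayFil n (s + 1) t (M - 1 - (r - 1))
  rw [← hdx, show M - 1 - (r - 1) = M - r by ring]
  exact hx2'

theorem mayFil_directed (s : ℤ) (t : ZMod (2 * (2 ^ n - 1))) :
    Directed (· ≤ ·) fun N : ℤ => mayFil n s t N :=
  Monotone.directed_le fun _ _ h => mayFil_mono h

theorem specZInf_le (r s : ℤ) (t : ZMod (2 * (2 ^ n - 1))) (M : ℤ) :
    specZInf (cobarD n) (fun s M => mayFil n s t M) s M ≤
      specZ (cobarD n) (fun s M => mayFil n s t M) r s M := by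
  rintro x ⟨h1, h2⟩
  refine ⟨h1, ?_⟩
  change cobarD n x ∈ mayFil n (s + 1) t (M - r)
  rw [LinearMap.mem_ker.1 h2]
  exact Submodule.zero_mem _

/-- The limit page agrees with the second page: an element of weight `M` whose differential has weight at
most `M - 2` is a permanent cocycle up to lower weight, and the boundaries are exhausted by
`exists_cobarD_eq`. -/
theorem nonempty_mayEInf_equiv (s : ℤ) (t : ZMod (2 * (2 ^ n - 1))) (M : ℤ) :
    Nonempty (MayEInf n s t M ≃ₗ[ZMod 2] MayE n 2 s t M) := by
  let F : ℤ → ℤ → Submodule (ZMod 2) (Cobar n) := fun s M => mayFil n s t M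
  let U := (specZ (cobarD n) F (2 - 1) s (M - 1) ⊔ specB (cobarD n) F (2 - 1) s M).submoduleOf
    (specZ (cobarD n) F 2 s M)
  let φ : specZInf (cobarD n) F s M →ₗ[ZMod 2] MayE n 2 s t M :=
    U.mkQ.comp (Submodule.inclusion (specZInf_le 2 s t M))
  have hsurj : Function.Surjective φ := by
    intro e
    obtain ⟨⟨x, hx⟩, rfl⟩ := Submodule.mkQ_surjective U e
    obtain ⟨hx1, hx2⟩ := id hx
    have hx2' : cobarD n x ∈ mayFil n (s + 1) t (M - 2) := hx2
    obtain ⟨m, hm, y, hy, z, hz, h⟩ := exists_eq_mono_add (x := x) hx1 (mayFil_le_wtFil _ _ _ hx2')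
    have hdx : cobarD n x = cobarD n y := by
      rw [h, map_add, map_add, cobarD_cobarD, cobarD_of_mem_monSpan hm, zero_add, add_zero]
    refine ⟨⟨m, monSpan_le_mayFil hm, cobarD_of_mem_monSpan hm⟩, ?_⟩
    refine (Submodule.Quotient.eq U).2 ?_
    change m - x ∈ specZ (cobarD n) F (2 - 1) s (M - 1) ⊔ specB (cobarD n) F (2 - 1) s M
    have e1 : m - x = -y + -cobarD n z := by rw [h]; abel
    rw [e1]
    refine Submodule.add_mem_sup (Submodule.neg_mem _ ⟨hy, ?_⟩)
      (Submodule.neg_mem _ ⟨z, ⟨?_, ?_⟩, rfl⟩)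
    · change cobarD n y ∈ mayFil n (s + 1) t (M - 1 - (2 - 1))
      rw [← hdx, show M - 1 - (2 - 1) = M - 2 by ring]
      exact hx2'
    · exact mayFil_mono (by omega) hz
    · change cobarD n z ∈ mayFil n (s - 1 + 1) t (M + (2 - 1) - (2 - 1))
      have e2 : cobarD n z = x - m - y := by rw [h]; abel
      rw [e2, show s - 1 + 1 = s by ring, show M + (2 - 1) - (2 - 1) = M by ring]
      exact Submodule.sub_mem _ (Submodule.sub_mem _ hx1 (monSpan_le_mayFil hm))
        (mayFil_mono (by omega) hy)
  have hker : LinearMap.ker φ = (specZInf (cobarD n) F s (M - 1) ⊔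
      specBInf (cobarD n) F s M).submoduleOf (specZInf (cobarD n) F s M) := by
    ext ⟨x, hx⟩
    obtain ⟨hx1, hx2⟩ := id hx
    have h0 : (⟨x, hx⟩ : specZInf (cobarD n) F s M) ∈ LinearMap.ker φ ↔
        x ∈ specZ (cobarD n) F (2 - 1) s (M - 1) ⊔ specB (cobarD n) F (2 - 1) s M :=
      Submodule.Quotient.mk_eq_zero U
    rw [h0]
    change _ ↔ x ∈ specZInf (cobarD n) F s (M - 1) ⊔ specBInf (cobarD n) F s M
    rw [Submodule.mem_sup, Submodule.mem_sup]
    constructor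
    · rintro ⟨y, ⟨hy, -⟩, _, ⟨z, ⟨hz, -⟩, rfl⟩, rfl⟩
      have hy0 : cobarD n y = 0 := by
        have h1 := LinearMap.mem_ker.1 hx2
        rwa [map_add, cobarD_cobarD, add_zero] at h1
      refine ⟨y, ⟨hy, hy0⟩, _, ⟨?_, z, Submodule.mem_iSup_of_mem _ hz, rfl⟩, rfl⟩
      have h1 := Submodule.sub_mem _ hx1 (mayFil_mono (M' := M) (by omega) hy)
      rwa [add_sub_cancel_left] at h1
    · rintro ⟨y, ⟨hy, hy0⟩, _, ⟨hdz, z, hz, rfl⟩, rfl⟩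
      obtain ⟨N, hN⟩ := (Submodule.mem_iSup_of_directed _ (mayFil_directed (s - 1) t)).1 hz
      have hdz' : cobarD n z ∈ mayFil n s t M := hdz
      obtain ⟨z', hz', h1⟩ := exists_cobarD_eq_of_mem_mayFil hN (mayFil_le_wtFil _ _ _ hdz')
      refine ⟨y, ⟨hy, ?_⟩, _, ⟨z', ⟨mayFil_mono (by omega) hz', ?_⟩, h1⟩, rfl⟩
      · change cobarD n y ∈ mayFil n (s + 1) t (M - 1 - (2 - 1))
        rw [LinearMap.mem_ker.1 hy0]
        exact Submodule.zero_mem _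
      · change cobarD n z' ∈ mayFil n (s - 1 + 1) t (M + (2 - 1) - (2 - 1))
        rw [h1, show s - 1 + 1 = s by ring, show M + (2 - 1) - (2 - 1) = M by ring]
        exact hdz'
  exact ⟨(Submodule.quotEquivOfEq _ _ hker.symm).trans
    (φ.quotKerEquivOfSurjective hsurj)⟩

/-- No nontrivial combination of the monomials is a boundary. -/
theorem eq_zero_of_linearCombination_idxElt {c : MonIdx n s t →₀ ZMod 2} {z : Cobar n}
    (h : Finsupp.linearCombination (ZMod 2) idxElt c = cobarD n z) : c = 0 := by
  classical
  by_contra hc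
  obtain ⟨x₀, hx₀, hmax⟩ := Finset.exists_max_image c.support (fun x => x.1.mayDeg)
    (Finsupp.support_nonempty_iff.2 hc)
  set M := x₀.1.mayDeg with hM
  have hlin : ∀ (c : MonIdx n s t →₀ ZMod 2) (N : ℤ), (∀ x ∈ c.support, (x.1.mayDeg : ℤ) ≤ N) →
      Finsupp.linearCombination (ZMod 2) idxElt c ∈ wtFil n N := by
    intro c N hN
    rw [Finsupp.linearCombination_apply, Finsupp.sum]
    exact Submodule.sum_mem _ fun x hx => Submodule.smul_mem _ _
      (wtFil_mono (hN x hx) (mayFil_le_wtFil _ _ _ (idxElt_mem x)))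
  set c₁ := c.filter fun x => x.1.mayDeg = M with hc₁
  set c₂ := c.filter fun x => ¬x.1.mayDeg = M with hc₂
  have hsum : c₁ + c₂ = c := Finsupp.filter_add_filter_not c _
  have h₂ : Finsupp.linearCombination (ZMod 2) idxElt c₂ ∈ wtFil n (M - 1) := by
    refine hlin _ _ fun x hx => ?_
    rw [hc₂, Finsupp.support_filter, Finset.mem_filter] at hx
    have := hmax x hx.1
    omega
  obtain ⟨N, hN⟩ := exists_mem_wtFil z
  obtain ⟨z', hz', hzz⟩ := exists_cobarD_eq (M := M) hN (by
    rw [← h]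
    exact hlin c M fun x hx => by exact_mod_cast hmax x hx)
  have h₁ : Finsupp.linearCombination (ZMod 2) monoElt
      (c₁.mapDomain fun x : MonIdx n s t => x.1.toMono) =
      -Finsupp.linearCombination (ZMod 2) idxElt c₂ + cobarD n z' := by
    rw [Finsupp.linearCombination_mapDomain, hzz, ← h, ← hsum, map_add]
    have e : (monoElt ∘ fun x : MonIdx n s t => x.1.toMono) = idxElt := by
      funext x
      exact x.1.elt_eq.symm
    rw [e]
    abel
  have h0 := eq_zero_of_linearCombination_eq (fun μ => symb_monoElt) (fun μ => monoElt_mem)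
    (M := M) (fun μ hμ => by
      obtain ⟨x, hx, rfl⟩ := Finset.mem_image.1 (Finsupp.mapDomain_support hμ)
      rw [hc₁, Finsupp.support_filter, Finset.mem_filter] at hx
      exact ⟨x.1.monoCrit_toMono, by rw [x.1.monoWt_toMono, hx.2]⟩)
    (Submodule.neg_mem _ h₂) hz' h₁
  have hinj : Function.Injective fun x : MonIdx n s t => x.1.toMono :=
    MonExp.toMono_injective.comp Subtype.val_injective
  have h3 : c₁ = 0 := Finsupp.mapDomain_injective hinj (by rw [h0, Finsupp.mapDomain_zero])
  have h4 := DFunLike.congr_fun h3 x₀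
  rw [hc₁, Finsupp.filter_apply_pos (fun x : MonIdx n s t => x.1.mayDeg = M) c hM.symm] at h4
  exact Finsupp.mem_support_iff.1 hx₀ h4

/-- Every cocycle of weight at most `M` is cohomologous to a combination of monomials of weight at
most `M`. -/
theorem exists_sub_mem_map {x : Cobar n} {M : ℤ} (hx : x ∈ mayFil n s t M) (hd : cobarD n x = 0) :
    ∃ m ∈ Submodule.span (ZMod 2) (idxElt '' {x : MonIdx n s t | (x.1.mayDeg : ℤ) ≤ M}),
      x - m ∈ (cobarPart n (s - 1) t).map (cobarD n) := by
  obtain ⟨k, hk⟩ : ∃ k : ℕ, M < k := ⟨(M + 1).toNat, by omega⟩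
  induction k generalizing x M with
  | zero =>
    have h0 : x = 0 := by
      have h1 := mem_wtFil.1 (mayFil_le_wtFil _ _ _ hx)
      apply (wordBasis n).repr.injective
      ext w
      rw [map_zero, Finsupp.zero_apply]
      by_contra hw
      have := h1 w hw
      omega
    exact ⟨0, Submodule.zero_mem _, by rw [h0, sub_zero]; exact Submodule.zero_mem _⟩
  | succ k ih =>
    obtain ⟨m, hm, y, hy, z, hz, h⟩ := exists_eq_mono_add hx (by rw [hd]; exact Submodule.zero_mem _)
    have hdy : cobarD n y = 0 := by
      rwa [h, map_add, map_add, cobarD_cobarD, cobarD_of_mem_monSpan hm, zero_add, add_zero] at hd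
    obtain ⟨m', hm', hym⟩ := ih hy hdy (by push_cast at hk; omega)
    have h1 : {x : MonIdx n s t | (x.1.mayDeg : ℤ) = M} ⊆ {x | (x.1.mayDeg : ℤ) ≤ M} :=
      fun x hx => le_of_eq hx
    have h2 : {x : MonIdx n s t | (x.1.mayDeg : ℤ) ≤ M - 1} ⊆ {x | (x.1.mayDeg : ℤ) ≤ M} :=
      fun x hx => le_trans (show (x.1.mayDeg : ℤ) ≤ M - 1 from hx) (by omega)
    refine ⟨m + m', Submodule.add_mem _ (Submodule.span_mono (Set.image_mono h1) hm)
      (Submodule.span_mono (Set.image_mono h2) hm'), ?_⟩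
    have e : x - (m + m') = (y - m') + cobarD n z := by rw [h]; abel
    rw [e]
    exact Submodule.add_mem _ hym ⟨z, mayFil_le_cobarPart _ _ _ hz, rfl⟩

theorem exists_mem_mayFil {x : Cobar n} (hx : x ∈ cobarPart n s t) : ∃ M : ℕ, x ∈ mayFil n s t M := by
  obtain ⟨M, hM⟩ := exists_mem_wtFil x
  exact ⟨M, mem_mayFil_iff.2 ⟨hx, hM⟩⟩

/-- The cohomology class of a monomial. -/
noncomputable def idxCoh (x : MonIdx n s t) : Coh n s t :=
  cohMk n s t ⟨idxElt x, idxElt_mem_cocycles x⟩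

theorem cohMk_eq_zero_iff (x : cocycles n s t) :
    cohMk n s t x = 0 ↔ (x : Cobar n) ∈ (cobarPart n (s - 1) t).map (cobarD n) :=
  Submodule.Quotient.mk_eq_zero _

theorem linearIndependent_idxCoh : LinearIndependent (ZMod 2) (idxCoh (n := n) (s := s) (t := t)) := by
  rw [linearIndependent_iff]
  intro c hc
  have h1 : Finsupp.linearCombination (ZMod 2) idxCoh c = cohMk n s t
      (Finsupp.linearCombination (ZMod 2)
        (fun x : MonIdx n s t => (⟨idxElt x, idxElt_mem_cocycles x⟩ : cocycles n s t)) c) := by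
    rw [Finsupp.apply_linearCombination]
    rfl
  rw [h1, cohMk_eq_zero_iff] at hc
  obtain ⟨z, -, hz⟩ := hc
  refine eq_zero_of_linearCombination_idxElt (z := z) ?_
  rw [hz]
  exact (Finsupp.apply_linearCombination (ZMod 2) (cocycles n s t).subtype
    (fun x : MonIdx n s t => (⟨idxElt x, idxElt_mem_cocycles x⟩ : cocycles n s t)) c).symm

theorem cohMk_mem_span {x : cocycles n s t} {M : ℤ} (hx : (x : Cobar n) ∈ mayFil n s t M) :
    cohMk n s t x ∈ Submodule.span (ZMod 2) (idxCoh '' {x : MonIdx n s t | (x.1.mayDeg : ℤ) ≤ M}) := by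
  obtain ⟨m, hm, h⟩ := exists_sub_mem_map hx x.2.2
  have key : ∀ m ∈ Submodule.span (ZMod 2) (idxElt '' {x : MonIdx n s t | (x.1.mayDeg : ℤ) ≤ M}),
      ∃ hm : m ∈ cocycles n s t, cohMk n s t ⟨m, hm⟩ ∈
        Submodule.span (ZMod 2) (idxCoh '' {x : MonIdx n s t | (x.1.mayDeg : ℤ) ≤ M}) := by
    intro m hm
    induction hm using Submodule.span_induction with
    | mem m hm =>
      obtain ⟨y, hy, rfl⟩ := hm
      exact ⟨idxElt_mem_cocycles y, Submodule.subset_span ⟨y, hy, rfl⟩⟩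
    | zero => exact ⟨Submodule.zero_mem _, by
        have : (⟨0, Submodule.zero_mem _⟩ : cocycles n s t) = 0 := rfl
        rw [this, map_zero]; exact Submodule.zero_mem _⟩
    | add a b _ _ ha hb =>
      obtain ⟨ha1, ha2⟩ := ha
      obtain ⟨hb1, hb2⟩ := hb
      exact ⟨Submodule.add_mem _ ha1 hb1, Submodule.add_mem _ ha2 hb2⟩
    | smul c a _ ha =>
      obtain ⟨ha1, ha2⟩ := ha
      exact ⟨Submodule.smul_mem _ c ha1, Submodule.smul_mem _ c ha2⟩
  obtain ⟨hmc, hms⟩ := key m hm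
  have e : cohMk n s t x = cohMk n s t ⟨m, hmc⟩ := by
    rw [← sub_eq_zero, ← map_sub, cohMk_eq_zero_iff]
    exact h
  rwa [e]

theorem span_idxCoh :
    Submodule.span (ZMod 2) (Set.range (idxCoh (n := n) (s := s) (t := t))) = ⊤ := by
  rw [eq_top_iff]
  rintro e -
  obtain ⟨x, rfl⟩ := Submodule.mkQ_surjective _ e
  obtain ⟨M, hM⟩ := exists_mem_mayFil x.2.1
  exact Submodule.span_mono (Set.image_subset_range _ _) (cohMk_mem_span hM)

/-- The classes represented by cocycles of weight at most `M` are spanned by the monomials of weight at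
most `M`. -/
theorem cohFil_eq (M : ℤ) : cohFil n s t M =
    Submodule.span (ZMod 2) (idxCoh '' {x : MonIdx n s t | (x.1.mayDeg : ℤ) ≤ M}) := by
  refine le_antisymm ?_ ?_
  · rintro _ ⟨x, hx, rfl⟩
    exact cohMk_mem_span hx
  · rw [Submodule.span_le]
    rintro _ ⟨x, hx, rfl⟩
    exact ⟨⟨idxElt x, idxElt_mem_cocycles x⟩, mayFil_mono hx (idxElt_mem x), rfl⟩

/-- The weight is at most `4n - 3` per factor `h_{s,j}` and `4n - 1` for `ρ_{2n}`. -/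
theorem MonExp.mayDeg_le (x : MonExp n) : x.mayDeg + (4 * n - 3) * x.rho ≤
    (4 * n - 3) * x.homDeg + (4 * n - 1) * x.rho := by
  have hn := NeZero.pos n
  have h : ∀ a j : Fin n, x.exp a j * mayWeight n (n + a) ≤ (4 * n - 3) * x.exp a j := by
    intro a j
    rw [mul_comm]
    refine Nat.mul_le_mul_right _ ?_
    rw [mayWeight_of_lt (by omega)]
    omega
  have h1 : ∑ a, ∑ j, x.exp a j * mayWeight n (n + a) ≤ (4 * n - 3) * ∑ a, ∑ j, x.exp a j := by
    rw [Finset.mul_sum]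
    refine Finset.sum_le_sum fun a _ => ?_
    rw [Finset.mul_sum]
    exact Finset.sum_le_sum fun j _ => h a j
  rw [mayDeg, homDeg, mayWeight_two_mul hn, mul_add, mul_comm x.rho]
  omega

/-- The leading term of `ρ_{2n}²` is a boundary, because no monomial has the cohomological degree and
the weight of `ρ_{2n}²`. -/
theorem rhoElt_sq_mem : rhoElt n ^ 2 ∈
    mayFil n 2 (2 * (2 * (2 ^ (2 * n) - 1))) (2 * mayWeight n (2 * n) - 1) ⊔
      LinearMap.range (cobarD n) := by
  have hn := NeZero.pos n
  have h1 := pow_mem_mayFil (rhoElt_mem (n := n)) 2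
  push_cast at h1
  obtain ⟨m, hm, y, hy, z, -, h⟩ := exists_eq_mono_add h1 (by
    rw [cobarD_pow cobarD_rhoElt]; exact Submodule.zero_mem _)
  have hm0 : m = 0 := by
    have h2 : monSpan n 2 (2 * (2 * (2 ^ (2 * n) - 1))) (2 * mayWeight n (2 * n)) = ⊥ := by
      rw [monSpan, Submodule.span_eq_bot]
      rintro _ ⟨x, hx, rfl⟩
      have h3 := x.1.mayDeg_le
      have h4 : (x.1.mayDeg : ℤ) = 2 * mayWeight n (2 * n) := hx
      have h5 : x.1.homDeg = 2 := by exact_mod_cast x.2.1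
      have h6 := mayWeight_two_mul hn
      rw [h5] at h3
      rcases Nat.le_one_iff_eq_zero_or_eq_one.1 x.1.rho_le with h7 | h7 <;> rw [h7] at h3 <;> omega
    rw [h2, Submodule.mem_bot] at hm
    exact hm
  rw [hm0, zero_add] at h
  rw [h]
  exact Submodule.add_mem_sup hy ⟨z, rfl⟩

end Collapse

end MoravaMay

open MoravaMay in
theorem theorem5p3 (n : ℕ) [NeZero n] :
    -- the May spectral sequence collapses at the second page
    (∀ (r s : ℤ) (t : ZMod (2 * (2 ^ n - 1))) (M : ℤ), 2 ≤ r → mayD n r s t M = 0) ∧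
    (∀ (s : ℤ) (t : ZMod (2 * (2 ^ n - 1))) (M : ℤ),
      Nonempty (MayEInf n s t M ≃ₗ[ZMod 2] MayE n 2 s t M)) ∧
    -- the monomials form a basis of the cohomology, compatible with the May filtration
    (∀ (s : ℤ) (t : ZMod (2 * (2 ^ n - 1))),
      ∃ hz : ∀ x : {x : MonExp n // (x.homDeg : ℤ) = s ∧ x.innerDeg = t},
          x.1.elt ∈ cocycles n s t,
        ∃ b : Module.Basis {x : MonExp n // (x.homDeg : ℤ) = s ∧ x.innerDeg = t} (ZMod 2)
            (Coh n s t),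
          (∀ x, b x = cohMk n s t ⟨x.1.elt, hz x⟩) ∧
          ∀ M : ℤ, cohFil n s t M = Submodule.span (ZMod 2) (b '' {x | (x.1.mayDeg : ℤ) ≤ M})) ∧
    -- multiplicative relations between the generators: commutativity in cohomology
    (∀ x y : Cobar n,
      (x = rhoElt n ∨ ∃ s j : ℕ, n ≤ s ∧ s < 2 * n ∧ j < n ∧ x = hElt n s j) →
      (y = rhoElt n ∨ ∃ s j : ℕ, n ≤ s ∧ s < 2 * n ∧ j < n ∧ y = hElt n s j) →
      x * y - y * x ∈ LinearMap.range (cobarD n)) ∧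
    -- the squares of the elements `h_{n,j}` agree in cohomology
    (∀ j < n, hElt n n j ^ 2 - hElt n n 0 ^ 2 ∈ LinearMap.range (cobarD n)) ∧
    -- the squares of the exterior generators drop in May filtration, so vanish on the limit page
    (∀ s j : ℕ, n < s → s < 2 * n → j < n →
      hElt n s j ^ 2 ∈ mayFil n 2 (2 * (2 * (2 ^ s - 1) * 2 ^ j)) (2 * mayWeight n s - 1) ⊔
        LinearMap.range (cobarD n)) ∧
    rhoElt n ^ 2 ∈ mayFil n 2 (2 * (2 * (2 ^ (2 * n) - 1))) (2 * mayWeight n (2 * n) - 1) ⊔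
      LinearMap.range (cobarD n) := by
  refine ⟨mayD_eq_zero, nonempty_mayEInf_equiv, fun s t => ?_, fun x y hx hy => ?_,
    fun j _ => hElt_sq_sub_mem_range j, fun s j hs _ _ => hElt_sq_mem hs j, rhoElt_sq_mem⟩
  · have hb : ∀ x, Module.Basis.mk linearIndependent_idxCoh span_idxCoh.ge x =
        idxCoh (n := n) (s := s) (t := t) x := fun x => by simp
    refine ⟨idxElt_mem_cocycles, Module.Basis.mk linearIndependent_idxCoh span_idxCoh.ge, hb,
      fun M => ?_⟩
    rw [cohFil_eq, funext hb]
  · obtain ⟨a, ha, rfl⟩ := exists_primitive hx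
    obtain ⟨b, hb, rfl⟩ := exists_primitive hy
    exact bar_mul_sub_mem_range ha hb
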